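/- **Notation.** Let $\Lambda=\mathbb Z^3$, $\Lambda^\vee$ its dual lattice, and $\Lambda_{prim}\subset\Lambda$ the set of primitive vectors. For $a\in\Lambda_{prim}$ let $U_a^+$ be the set of $x\in\Lambda\otimes\mathbb C=\mathbb C^3$ with $\mathrm{Im}(\alpha(x)\overline{\beta(x)})>0$ for one (equivalently any) oriented basis $(\alpha,\beta)$ of the plane $\{\delta\in\Lambda^\vee\otimes\mathbb R:\delta(a)=0\}$; here $(\alpha,\beta)$ is oriented if $(\eta,\alpha,\beta)$ is an oriented basis of $\Lambda^\vee\otimes\mathbb R$ whenever $\eta(a)>0$. For linearly independent $a,b\in\Lambda_{prim}$ let $\gamma=\gamma_{a,b}\in\Lambda^\vee$ be the primitive vector with $\det(a,b,\cdot)=s\gamma$, $s>0$, put $C(a,b)=\{\delta\in\Lambda^\vee:\delta(a)>0,\ \delta(b)\le 0\}$ and $$\Gamma_{a,b}(w,x)=\prod_{\delta\in C(a,b)/\mathbb Z\gamma}\bigl(1-e^{-2\pi i(\delta(x)-w)/\gamma(x)}\bigr)\prod_{\delta\in C(b,a)/\mathbb Z\gamma}\bigl(1-e^{2\pi i(\delta(x)-w)/\gamma(x)}\bigr)^{-1},$$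 for $w\in\mathbb C$ and $x\in U_a^+\cap U_b^+$; put $\Gamma_{a,\pm a}=1$. Let $\theta_0(z,\tau)=\prod_{j\ge0}(1-e^{2\pi i((j+1)\tau-z)})(1-e^{2\pi i(j\tau+z)})$. Fix a framing: for each $a\in\Lambda_{prim}$ an oriented basis $(\alpha_1,\alpha_2,\alpha_3)$ of the lattice $\Lambda^\vee$ with $\alpha_1(a)=1$, $\alpha_2(a)=\alpha_3(a)=0$. Let $ISL_3(\mathbb Z)=SL_3(\mathbb Z)\ltimes\mathbb Z^3$ be the group of pairs $\hat g=(g,\mu)$, $g\in SL_3(\mathbb Z)$, $\mu\in\Lambda^\vee$, with $(g,\mu)(h,\nu)=(gh,\nu+\mu\circ h)$. For $x\in U_a^+$ let $$\Delta_a((g,\mu);w,x)=\prod_{j=0}^{\mu(g^{-1}a)-1}\theta_0\Bigl(\frac{w+j\alpha_1(x)}{\alpha_3(x)},\frac{\alpha_2(x)}{\alpha_3(x)}\Bigr),$$ where $\prod_{j=0}^{n-1}f_j$ means $\prod_{j=n}^{-1}f_j^{-1}$ if $n<0$. Let $X=\{(w,x):w\in\mathbb C,\ x\in\mathbb C^3\text{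 not a complex multiple of a real vector}\}/\mathbb C^\times$, with $c\cdot(w,x)=(cw,cx)$; this is the dual of the tautological line bundle of $\mathbb CP^2$ restricted to $\mathbb CP^2-\mathbb RP^2$. The group $ISL_3(\mathbb Z)$ acts on $X$ by $(g,\mu)\cdot[(w,x)]=[(w-\mu(x),gx)]$, and $\mathcal V=(V_a)_{a\in\Lambda_{prim}}$, $V_a=\{(w,x):x\in U_a^+\}/\mathbb C^\times$, is an equivariant open covering of $X$. Let $\mathcal O^\times$ and $\mathcal M^\times$ be the sheaves of invertible holomorphic and of invertible meromorphic functions on $X$. For $\mathcal F=\mathcal O^\times,\mathcal M^\times$ let $C^n_{ISL_3(\mathbb Z)}(\mathcal V,\mathcal F)=\prod_{p+q=n}C^{p,q}$, where $C^{p,q}$ consists of all families $c_{a_0,\dots,a_q}(\hat g_1,\dots,\hat g_p)\in\mathcal F(V_{a_0}\cap\dots\cap V_{a_q})$, with coboundary given in additive notation by $(Dc)^{p,q}=(-1)^p(\delta_{\text{Čech}}c^{p,q-1}+\delta_{\text{group}}c^{p-1,q})$; $\delta_{\text{group}}$ is the inhomogeneous group coboundary for the action $(\hat g c)_{a_0,\dots,a_q}(y)=c_{g^{-1}a_0,\dots,g^{-1}a_q}(\hat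 g^{-1}y)$. Let $B_{3,3}(w|\omega_1,\omega_2,\omega_3)$ be the coefficient of $t^3/3!$ in $t^3e^{wt}/\prod_{j}(e^{\omega_jt}-1)$. For $a,b,c\in\Lambda_{prim}$ with $\det(a,b,c)>0$ put $\alpha=\gamma_{b,c}$, $\beta=\gamma_{c,a}$, $\gamma=\gamma_{a,b}$ and $$P_{a,b,c}(w,x)=\sum_{\delta}B_{3,3}(w+\delta(x)\,|\,\alpha(x),\beta(x),\gamma(x)),$$ the sum over all $\delta\in\Lambda^\vee$ with $0\le\delta(a)<\alpha(a)$, $0\le\delta(b)<\beta(b)$, $0\le\delta(c)<\gamma(c)$; put $P_{a,b,c}=-P_{a,c,b}$ if $\det(a,b,c)<0$ and $P_{a,b,c}=0$ if $\det(a,b,c)=0$. **Theorem 1.** The products defining $\Gamma_{a,b}$ converge on $\mathbb C\times(U_a^+\cap U_b^+)$, those defining $\theta_0$ in $\Delta_a$ converge on $\mathbb C\times U_a^+$, and $\Gamma_{a,b}$ and $\Delta_a(\hat g;\cdot)$ define invertible meromorphic functions on $V_a\cap V_b$ and $V_a$, respectively. One has $P_{a,b,c}\in\mathbb Q(x)[w]$,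 and there are $P_{a,b}(\hat g;w,x)$ and $P_a(\hat g,\hat h;w,x)$ in $\mathbb Q(x)[w]$ such that the coefficients of $P_{a,b,c}$, $P_{a,b}(\hat g;\cdot)$, $P_a(\hat g,\hat h;\cdot)$ have no poles for $x\in U_a^+\cap U_b^+\cap U_c^+$, $x\in U_a^+\cap U_b^+$, $x\in U_a^+$, respectively, and the following identities of meromorphic functions hold there for all $a,b,c\in\Lambda_{prim}$ and $\hat g=(g,\mu)$, $\hat h=(h,\nu)$ in $ISL_3(\mathbb Z)$: $$\Gamma_{a,b}\Gamma_{b,a}=1,\qquad \Gamma_{a,b}\Gamma_{b,c}\Gamma_{c,a}=\exp\bigl(-\tfrac{\pi i}{3}P_{a,b,c}\bigr),$$ $$\frac{\Gamma_{g^{-1}a,g^{-1}b}(w+\mu(g^{-1}x),g^{-1}x)}{\Gamma_{a,b}(w,x)}=e^{\pi iP_{a,b}(\hat g;w,x)}\frac{\Delta_a(\hat g;w,x)}{\Delta_b(\hat g;w,x)},$$ $$\Delta_a(\hat g\hat h;w,x)=e^{2\pi iP_a(\hat g,\hat h;w,x)}\Delta_a(\hat g;w,x)\,\Delta_{g^{-1}a}(\hat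 h;w+\mu(g^{-1}x),g^{-1}x).$$ Moreover $\phi=(\phi_{a,b,c},\phi_{a,b},\phi_a)=\bigl(e^{-\frac{2\pi i}{3!}P_{a,b,c}(w,x)},e^{-\frac{2\pi i}{2!}P_{a,b}(\hat g;w,x)},e^{-2\pi iP_a(\hat g,\hat h;w,x)}\bigr)$ is an $ISL_3(\mathbb Z)$-equivariant Čech 2-cocycle in $C^2_{ISL_3(\mathbb Z)}(\mathcal V,\mathcal O^\times)$, and its image in $C^2_{ISL_3(\mathbb Z)}(\mathcal V,\mathcal M^\times)$ is the coboundary of the equivariant cochain $(\Gamma_{a,b},\Delta_a)\in C^1_{ISL_3(\mathbb Z)}(\mathcal V,\mathcal M^\times)$. -/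

import Mathlib

open TopologicalSpace Filter
open scoped Matrix ComplexConjugate

noncomputable section

namespace GammaGerbe

/-! ### Equivariant Čech cochains for a group acting on a space -/

section Cech

variable {G X I : Type} [Group G] [TopologicalSpace X] [MulAction G X] [MulAction G I]

/-- A `G`-equivariant presheaf of abelian groups on `X`. The map `pull g : sec U → sec W`, for
`g⁻¹ W ⊆ U`, is the translation of a section by `g` followed by restriction; for functions it is
`s ↦ (y ↦ s (g⁻¹ • y))`. Ordinary restriction is `pull 1`. -/
structure EquivPresheaf (G X : Type) [Group G] [TopologicalSpace X] [MulAction G X] where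
  sec : Opens X → Type
  grp : ∀ U, CommGroup (sec U)
  pull : ∀ (g : G) {U W : Opens X}, (∀ y ∈ W, g⁻¹ • y ∈ U) → sec U →* sec W
  pull_one : ∀ {U : Opens X} (h : ∀ y ∈ U, (1 : G)⁻¹ • y ∈ U) (s : sec U), pull 1 h s = s
  pull_mul : ∀ (g g' : G) {U W T : Opens X} (h' : ∀ y ∈ W, g'⁻¹ • y ∈ U)
    (h : ∀ y ∈ T, g⁻¹ • y ∈ W) (hh : ∀ y ∈ T, (g * g')⁻¹ • y ∈ U) (s : sec U),
    pull (g * g') hh s = pull g h (pull g' h' s)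

attribute [instance] EquivPresheaf.grp

/-- Restriction of sections. -/
def EquivPresheaf.res (F : EquivPresheaf G X) {U W : Opens X} (h : W ≤ U) :
    F.sec U →* F.sec W :=
  F.pull 1 (fun y hy => by simpa using h hy)

/-- An equivariant open covering: `⋃ V_a = X` and `g V_a ⊆ V_{g a}` (hence `g V_a = V_{g a}`). -/
structure EquivCover (G X I : Type) [Group G] [TopologicalSpace X] [MulAction G X]
    [MulAction G I] where
  V : I → Opens X
  covers : ∀ y, ∃ a, y ∈ V a
  equivariant : ∀ (g : G) (a : I) (y : X), y ∈ V a → g • y ∈ V (g • a)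

variable (𝒱 : EquivCover G X I)

/-- The intersection `V_{a_0} ∩ ⋯ ∩ V_{a_q}`. -/
def EquivCover.inter {q : ℕ} (a : Fin (q + 1) → I) : Opens X :=
  ⟨⋂ i, (𝒱.V (a i) : Set X), isOpen_iInter_of_finite fun i => (𝒱.V (a i)).isOpen⟩

lemma EquivCover.mem_inter {q : ℕ} (a : Fin (q + 1) → I) (y : X) :
    y ∈ 𝒱.inter a ↔ ∀ i, y ∈ 𝒱.V (a i) := by
  change y ∈ ⋂ i, (𝒱.V (a i) : Set X) ↔ _
  simp

lemma EquivCover.inter_face {q : ℕ} (a : Fin (q + 2) → I) (i : Fin (q + 2)) :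
    𝒱.inter a ≤ 𝒱.inter (a ∘ i.succAbove) := fun y hy =>
  (𝒱.mem_inter _ y).2 fun j => (𝒱.mem_inter _ y).1 hy (i.succAbove j)

lemma EquivCover.inter_smul {q : ℕ} (g : G) (a : Fin (q + 1) → I) :
    ∀ y ∈ 𝒱.inter a, g⁻¹ • y ∈ 𝒱.inter (g⁻¹ • a) := fun y hy =>
  (𝒱.mem_inter _ _).2 fun j => 𝒱.equivariant g⁻¹ (a j) y ((𝒱.mem_inter _ y).1 hy j)

variable (F : EquivPresheaf G X)

/-- Cochains of bidegree `(p, q)`: families `c_{a_0,…,a_q}(g_1,…,g_p) ∈ F(V_{a_0} ∩ ⋯ ∩ V_{a_q})`. -/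
abbrev BiCochain (p q : ℕ) : Type :=
  (Fin p → G) → (a : Fin (q + 1) → I) → F.sec (𝒱.inter a)

/-- The Čech differential. -/
def cechD {p q : ℕ} (c : BiCochain 𝒱 F p q) : BiCochain 𝒱 F p (q + 1) := fun g a =>
  ∏ i : Fin (q + 2), (F.res (𝒱.inter_face a i) (c g (a ∘ i.succAbove))) ^ ((-1 : ℤ) ^ (i : ℕ))

/-- The group cohomology differential (inhomogeneous cochains), with respect to the action
`(g · s)_{a_0,…,a_q}(y) = s_{g⁻¹a_0,…,g⁻¹a_q}(g⁻¹ y)` of `G` on Čech cochains. -/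
def groupD {p q : ℕ} (c : BiCochain 𝒱 F p q) : BiCochain 𝒱 F (p + 1) q := fun g a =>
  F.pull (g 0) (𝒱.inter_smul (g 0) a) (c (fun j => g j.succ) ((g 0)⁻¹ • a)) *
    ∏ j : Fin (p + 1), (c (Fin.contractNth j (· * ·) g) a) ^ ((-1 : ℤ) ^ ((j : ℕ) + 1))

/-- The group `C^n_G(𝒱, F)` of equivariant Čech `n`-cochains, `∏_{p+q=n} C^{p,q}`. -/
abbrev EquivCochain (n : ℕ) : Type := ∀ p q : ℕ, p + q = n → BiCochain 𝒱 F p q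

variable {𝒱 F}

/-- The total differential of the double complex; in additive notation
`(D c)^{p,q} = (-1)^p (δ_Čech c^{p,q-1} + δ_group c^{p-1,q})`. -/
def totalD {n : ℕ} (c : EquivCochain 𝒱 F n) : EquivCochain 𝒱 F (n + 1)
  | 0, 0, h => absurd h (by omega)
  | 0, q + 1, h => cechD 𝒱 F (c 0 q (by omega))
  | p + 1, 0, h => (groupD 𝒱 F (c p 0 (by omega))) ^ ((-1 : ℤ) ^ (p + 1))
  | p + 1, q + 1, h =>
    (cechD 𝒱 F (c (p + 1) q (by omega)) * groupD 𝒱 F (c p (q + 1) (by omega))) ^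
      ((-1 : ℤ) ^ (p + 1))

/-- `D c = 1`. -/
def IsCocycle {n : ℕ} (c : EquivCochain 𝒱 F n) : Prop :=
  totalD c = fun _ _ _ _ _ => 1

end Cech

/-- The filter of subsets containing a dense open subset. -/
def denseOpens (Y : Type) [TopologicalSpace Y] : Filter Y where
  sets := {S | ∃ O : Set Y, IsOpen O ∧ Dense O ∧ O ⊆ S}
  univ_sets := ⟨Set.univ, isOpen_univ, dense_univ, Set.Subset.rfl⟩
  sets_of_superset := fun ⟨O, h1, h2, h3⟩ h => ⟨O, h1, h2, h3.trans h⟩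
  inter_sets := fun ⟨O, h1, h2, h3⟩ ⟨O', h1', h2', h3'⟩ =>
    ⟨O ∩ O', h1.inter h1', h2.inter_of_isOpen_left h2' h1, Set.inter_subset_inter h3 h3'⟩

lemma tendsto_denseOpens {Y Y' : Type} [TopologicalSpace Y] [TopologicalSpace Y'] {f : Y → Y'}
    (hc : Continuous f) (ho : IsOpenMap f) : Tendsto f (denseOpens Y) (denseOpens Y') := by
  rintro S ⟨O, h1, h2, h3⟩
  exact ⟨f ⁻¹' O, h1.preimage hc, h2.preimage ho, Set.preimage_mono h3⟩

/-! ### Lattice, dual lattice and the group `ISL₃(ℤ)` -/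

/-- A primitive vector of `ℤ³`: not a multiple of another vector, except for the sign. -/
def IsPrimitive (a : Fin 3 → ℤ) : Prop := ∀ (n : ℤ) (b : Fin 3 → ℤ), a = n • b → IsUnit n

/-- The set `Λ_prim` of primitive vectors in `Λ = ℤ³`. -/
def Prim : Type := {a : Fin 3 → ℤ // IsPrimitive a}

/-- The value `δ(x)` of `δ ∈ Λ^∨ = ℤ³` at `x ∈ Λ ⊗ ℂ = ℂ³`. -/
def pair (δ : Fin 3 → ℤ) (x : Fin 3 → ℂ) : ℂ := ∑ i, (δ i : ℂ) * x i

/-- The value `α(x)` of `α ∈ Λ^∨ ⊗ ℝ = ℝ³` at `x ∈ ℂ³`. -/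
def pairR (α : Fin 3 → ℝ) (x : Fin 3 → ℂ) : ℂ := ∑ i, (α i : ℂ) * x i

/-- The group `ISL₃(ℤ) = SL₃(ℤ) ⋉ ℤ³`, with elements `(g, μ)`, `μ ∈ Λ^∨`. -/
@[ext] structure ISL3 where
  g : Matrix.SpecialLinearGroup (Fin 3) ℤ
  μ : Fin 3 → ℤ

namespace ISL3

/-- `(g, μ)(h, ν) = (gh, ν + μ ∘ h)`; this is the law for which
`(g, μ)·(w, x) = (w - μ(x), g x)` is a left action. -/
instance : Mul ISL3 := ⟨fun s t => ⟨s.g * t.g, t.μ + s.μ ᵥ* t.g.1⟩⟩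
instance : One ISL3 := ⟨⟨1, 0⟩⟩
instance : Inv ISL3 := ⟨fun s => ⟨s.g⁻¹, -(s.μ ᵥ* (s.g⁻¹).1)⟩⟩

lemma mul_def (s t : ISL3) : s * t = ⟨s.g * t.g, t.μ + s.μ ᵥ* t.g.1⟩ := rfl
lemma one_def : (1 : ISL3) = ⟨1, 0⟩ := rfl
lemma inv_def (s : ISL3) : s⁻¹ = ⟨s.g⁻¹, -(s.μ ᵥ* (s.g⁻¹).1)⟩ := rfl

instance : Group ISL3 := Group.ofLeftAxioms
  (fun s t u => by
    ext1
    · simp [mul_def, mul_assoc]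
    · simp [mul_def, Matrix.add_vecMul, Matrix.vecMul_vecMul, add_assoc])
  (fun s => by ext1 <;> simp [mul_def, one_def])
  (fun s => by
    ext1
    · simp [mul_def, one_def, inv_def]
    · have h : (s.g⁻¹).1 * s.g.1 = 1 := by
        rw [← Matrix.SpecialLinearGroup.coe_mul]; simp
      simp only [mul_def, one_def, inv_def, Matrix.neg_vecMul, Matrix.vecMul_vecMul, h]
      simp)

end ISL3

lemma isPrimitive_mulVec (g : Matrix.SpecialLinearGroup (Fin 3) ℤ) {a : Fin 3 → ℤ}
    (ha : IsPrimitive a) : IsPrimitive (g.1 *ᵥ a) := by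
  intro n b h
  have hg : (g⁻¹).1 * g.1 = 1 := by rw [← Matrix.SpecialLinearGroup.coe_mul]; simp
  refine ha n ((g⁻¹).1 *ᵥ b) ?_
  rw [← Matrix.mulVec_smul, ← h, Matrix.mulVec_mulVec, hg, Matrix.one_mulVec]

/-- `ISL₃(ℤ)` acts on `Λ_prim` through `SL₃(ℤ)`. -/
instance : MulAction ISL3 Prim where
  smul s a := ⟨s.g.1 *ᵥ a.1, isPrimitive_mulVec s.g a.2⟩
  one_smul a := Subtype.ext (by change (1 : Matrix.SpecialLinearGroup (Fin 3) ℤ).1 *ᵥ a.1 = _; simp)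
  mul_smul s t a := Subtype.ext (by
    change (s.g * t.g).1 *ᵥ a.1 = s.g.1 *ᵥ (t.g.1 *ᵥ a.1); simp [Matrix.mulVec_mulVec])

/-! ### The space `X` -/

/-- The action `x ↦ g x` of `SL₃(ℤ)` on `ℂ³`. -/
def matAct (g : Matrix.SpecialLinearGroup (Fin 3) ℤ) (x : Fin 3 → ℂ) : Fin 3 → ℂ :=
  fun i => pair (g.1 i) x

/-- The action `(g, μ)·(w, x) = (w - μ(x), g x)` on `ℂ × ℂ³`. -/
def act (s : ISL3) (p : ℂ × (Fin 3 → ℂ)) : ℂ × (Fin 3 → ℂ) :=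
  (p.1 - pair s.μ p.2, matAct s.g p.2)

/-- `x ∈ ℂ³` is a complex multiple of a real vector: it is zero or represents a point of `ℝP²`. -/
def IsRealPoint (x : Fin 3 → ℂ) : Prop := ∃ (c : ℂ) (r : Fin 3 → ℝ), ∀ i, x i = c * (r i : ℂ)

/-- The pairs `(w, x)`, with `w ∈ ℂ` and `x ∈ ℂ³` over `ℂP² - ℝP²`. -/
abbrev Tot : Type := {p : ℂ × (Fin 3 → ℂ) // ¬ IsRealPoint p.2}

lemma pair_smul (δ : Fin 3 → ℤ) (c : ℂ) (x : Fin 3 → ℂ) : pair δ (c • x) = c * pair δ x := by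
  simp only [pair, Fin.sum_univ_three, Pi.smul_apply, smul_eq_mul]; ring

lemma pairR_smul (δ : Fin 3 → ℝ) (c : ℂ) (x : Fin 3 → ℂ) : pairR δ (c • x) = c * pairR δ x := by
  simp only [pairR, Fin.sum_univ_three, Pi.smul_apply, smul_eq_mul]; ring

lemma pair_mul (δ : Fin 3 → ℤ) (g : Matrix (Fin 3) (Fin 3) ℤ) (x : Fin 3 → ℂ) :
    pair δ (fun i => pair (g i) x) = pair (δ ᵥ* g) x := by
  simp only [pair, Fin.sum_univ_three, Matrix.vecMul, dotProduct]
  push_cast; ring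

lemma act_mul (s t : ISL3) (p : ℂ × (Fin 3 → ℂ)) : act (s * t) p = act s (act t p) := by
  refine Prod.ext ?_ (funext fun i => ?_)
  · change p.1 - pair (t.μ + s.μ ᵥ* t.g.1) p.2 = p.1 - pair t.μ p.2 - pair s.μ _
    change _ = _ - pair s.μ (fun i => pair (t.g.1 i) p.2)
    rw [pair_mul]
    simp only [pair, Fin.sum_univ_three, Pi.add_apply]
    push_cast; ring
  · change pair ((s.g * t.g).1 i) p.2 = pair (s.g.1 i) fun j => pair (t.g.1 j) p.2
    rw [pair_mul]; rfl

lemma act_one (p : ℂ × (Fin 3 → ℂ)) : act 1 p = p := by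
  refine Prod.ext ?_ (funext fun i => ?_)
  · change p.1 - pair 0 p.2 = p.1
    simp [pair]
  · change pair ((1 : Matrix.SpecialLinearGroup (Fin 3) ℤ).1 i) p.2 = p.2 i
    simp [pair, Matrix.one_apply]

lemma isRealPoint_smul {c : ℂ} (hc : c ≠ 0) {x : Fin 3 → ℂ} (h : IsRealPoint (c • x)) :
    IsRealPoint x := by
  obtain ⟨d, r, hr⟩ := h
  refine ⟨c⁻¹ * d, r, fun i => ?_⟩
  have := hr i
  simp only [Pi.smul_apply, smul_eq_mul] at this
  rw [mul_assoc, ← this]; field_simp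

lemma isRealPoint_act (s : ISL3) {p : ℂ × (Fin 3 → ℂ)} (h : IsRealPoint p.2) :
    IsRealPoint (act s p).2 := by
  obtain ⟨d, r, hr⟩ := h
  refine ⟨d, fun i => ∑ j, (s.g.1 i j : ℝ) * r j, fun i => ?_⟩
  simp only [act, matAct, pair, hr, Fin.sum_univ_three]
  push_cast; ring

lemma not_isRealPoint_act (s : ISL3) {p : ℂ × (Fin 3 → ℂ)} (h : ¬ IsRealPoint p.2) :
    ¬ IsRealPoint (act s p).2 := fun hh => h (by
  have := isRealPoint_act s⁻¹ hh
  rwa [← act_mul, inv_mul_cancel, act_one] at this)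

/-- `ℂˣ` acts by `c·(w, x) = (c w, c x)`. -/
instance : MulAction ℂˣ Tot where
  smul c p := ⟨((c : ℂ) * p.1.1, (c : ℂ) • p.1.2), fun h => p.2 (isRealPoint_smul c.ne_zero h)⟩
  one_smul p := Subtype.ext (by
    change (((1 : ℂˣ) : ℂ) * p.1.1, ((1 : ℂˣ) : ℂ) • p.1.2) = p.1; simp)
  mul_smul c d p := Subtype.ext (by
    change (((c * d : ℂˣ) : ℂ) * p.1.1, ((c * d : ℂˣ) : ℂ) • p.1.2) =
      ((c : ℂ) * ((d : ℂ) * p.1.1), (c : ℂ) • (d : ℂ) • p.1.2)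
    simp [mul_assoc, smul_smul])

/-- `ISL₃(ℤ)` acts on the pairs `(w, x)`. -/
instance : MulAction ISL3 Tot where
  smul s p := ⟨act s p.1, not_isRealPoint_act s p.2⟩
  one_smul p := Subtype.ext (act_one p.1)
  mul_smul s t p := Subtype.ext (act_mul s t p.1)

/-- The dual of the tautological line bundle of `ℂP²` restricted to `ℂP² - ℝP²`: the quotient by
`ℂˣ` of the space of pairs `(w, x)`. -/
def X : Type := MulAction.orbitRel.Quotient ℂˣ Tot

/-- The quotient topology. -/
instance : TopologicalSpace X :=
  inferInstanceAs (TopologicalSpace (Quotient (MulAction.orbitRel ℂˣ Tot)))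

/-- The class `[(w, x)]`. -/
def mk (p : Tot) : X := Quotient.mk (MulAction.orbitRel ℂˣ Tot) p

lemma act_scale (s : ISL3) (c : ℂˣ) (p : Tot) : s • c • p = c • s • p := by
  refine Subtype.ext (Prod.ext ?_ (funext fun i => ?_))
  · change (c : ℂ) * p.1.1 - pair s.μ ((c : ℂ) • p.1.2) = (c : ℂ) * (p.1.1 - pair s.μ p.1.2)
    rw [pair_smul]; ring
  · change pair (s.g.1 i) ((c : ℂ) • p.1.2) = (c : ℂ) * pair (s.g.1 i) p.1.2
    rw [pair_smul]

/-- The action `(g, μ)·[(w, x)] = [(w - μ(x), g x)]` of `ISL₃(ℤ)` on `X`. -/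
instance : MulAction ISL3 X where
  smul s := Quotient.map (fun p : Tot => s • p) (by
    rintro p q ⟨c, rfl⟩
    exact ⟨c, (act_scale s c q).symm⟩)
  one_smul y := by
    induction y using Quotient.inductionOn with
    | h p => exact congrArg mk (one_smul ISL3 p)
  mul_smul s t y := by
    induction y using Quotient.inductionOn with
    | h p => exact congrArg mk (mul_smul s t p)

lemma smul_mk (s : ISL3) (p : Tot) : s • mk p = mk (s • p) := rfl

lemma continuous_mk : Continuous mk := continuous_quot_mk

lemma differentiable_act (s : ISL3) : Differentiable ℂ (act s) := by
  unfold act matAct pair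
  refine Differentiable.prodMk (by fun_prop) (differentiable_pi.2 fun i => by fun_prop)

instance : ContinuousConstSMul ISL3 X where
  continuous_const_smul s := by
    refine Continuous.quotient_lift (f := fun p : Tot => mk (s • p)) ?_ _
    exact continuous_mk.comp
      (((differentiable_act s).continuous.comp continuous_subtype_val).subtype_mk _)

/-! ### Holomorphic and meromorphic functions on `X` -/

/-- The pull-back to `ℂ × ℂ³` of a function on `X` (extended by zero). -/
def lift (f : X → ℂ) (p : ℂ × (Fin 3 → ℂ)) : ℂ :=
  open Classical in if h : ¬ IsRealPoint p.2 then f (mk ⟨p, h⟩) else 0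

/-- The preimage in `ℂ × ℂ³` of a subset of `X`. -/
def cone (U : Set X) : Set (ℂ × (Fin 3 → ℂ)) := {p | ∃ h : ¬ IsRealPoint p.2, mk ⟨p, h⟩ ∈ U}

/-- `f` is holomorphic on the open set `U` of the quotient `X`: its pull-back is holomorphic. -/
def HolOn (U : Opens X) (f : X → ℂ) : Prop := DifferentiableOn ℂ (lift f) (cone U)

lemma lift_mk (f : X → ℂ) {p : ℂ × (Fin 3 → ℂ)} (h : ¬ IsRealPoint p.2) :
    lift f p = f (mk ⟨p, h⟩) := by simp [lift, h]

lemma HolOn.of_eq {U : Opens X} {f : X → ℂ} {F : ℂ × (Fin 3 → ℂ) → ℂ}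
    (hF : DifferentiableOn ℂ F (cone U)) (h : ∀ p ∈ cone U, lift f p = F p) : HolOn U f :=
  hF.congr h

lemma HolOn.one (U : Opens X) : HolOn U (fun _ => 1) :=
  HolOn.of_eq (differentiableOn_const (1 : ℂ)) fun _ ⟨h, _⟩ => lift_mk _ h

lemma HolOn.mul {U : Opens X} {f g : X → ℂ} (hf : HolOn U f) (hg : HolOn U g) :
    HolOn U (fun y => f y * g y) :=
  HolOn.of_eq (DifferentiableOn.mul hf hg) fun p ⟨h, _⟩ => by simp [lift_mk _ h]

lemma HolOn.inv {U : Opens X} {f : X → ℂ} (hf : HolOn U f) (h0 : ∀ y ∈ U, f y ≠ 0) :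
    HolOn U (fun y => (f y)⁻¹) :=
  HolOn.of_eq (DifferentiableOn.inv hf fun p ⟨h, hp⟩ => by rw [lift_mk _ h]; exact h0 _ hp)
    fun p ⟨h, _⟩ => by simp [lift_mk _ h]

lemma HolOn.pull {U W : Opens X} {f : X → ℂ} (hf : HolOn U f) (s : ISL3)
    (hs : ∀ y ∈ W, s • y ∈ U) : HolOn W (fun y => f (s • y)) := by
  refine HolOn.of_eq (F := fun p => lift f (act s p))
    (DifferentiableOn.comp hf (differentiable_act s).differentiableOn ?_) ?_
  · rintro p ⟨h, hp⟩
    exact ⟨not_isRealPoint_act s h, hs _ hp⟩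
  · rintro p ⟨h, hp⟩
    rw [lift_mk _ h, lift_mk _ (not_isRealPoint_act s h)]
    rfl

lemma HolOn.mono {U W : Opens X} {f : X → ℂ} (hf : HolOn U f) (h : W ≤ U) : HolOn W f :=
  DifferentiableOn.mono hf fun _ ⟨h1, h2⟩ => ⟨h1, h h2⟩

/-- The group `𝒪ˣ(U)` of invertible holomorphic functions on `U`. -/
def holUnits (U : Opens X) : Subgroup (U → ℂˣ) where
  carrier := {f | ∃ F : X → ℂ, HolOn U F ∧ ∀ y : U, (f y : ℂ) = F y}
  one_mem' := ⟨fun _ => 1, HolOn.one U, fun _ => rfl⟩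
  mul_mem' := by
    rintro f f' ⟨F, h, e⟩ ⟨F', h', e'⟩
    exact ⟨_, h.mul h', fun y => by simp [e, e']⟩
  inv_mem' := by
    rintro f ⟨F, h, e⟩
    refine ⟨_, h.inv fun y hy => ?_, fun y => by simp [e]⟩
    rw [← e ⟨y, hy⟩]; exact (f _).ne_zero

/-- The equivariant sheaf `𝒪ˣ` on `X`. -/
def holSheaf : EquivPresheaf ISL3 X where
  sec U := holUnits U
  grp _ := inferInstance
  pull s {U W} hs :=
    { toFun := fun f => ⟨fun y => f.1 ⟨s⁻¹ • (y : X), hs y y.2⟩, by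
        obtain ⟨F, h, e⟩ := f.2
        exact ⟨_, h.pull s⁻¹ hs, fun y => e _⟩⟩
      map_one' := rfl
      map_mul' := fun _ _ => rfl }
  pull_one h f := Subtype.ext (funext fun y => congrArg f.1 (Subtype.ext (by simp)))
  pull_mul s t {U W T} h' h hh f := Subtype.ext (funext fun y => congrArg f.1 (Subtype.ext (by
    change (s * t)⁻¹ • (y : X) = t⁻¹ • s⁻¹ • (y : X)
    rw [mul_inv_rev, mul_smul])))

/-- A function, defined and nonzero on a dense open subset, that is locally a quotient of
holomorphic functions which do not vanish identically on any nonempty open set. (The values off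
a dense open subset are irrelevant.) -/
def IsMero (U : Opens X) (f : U → ℂˣ) : Prop :=
  ∀ y ∈ U, ∃ N : Opens X, y ∈ N ∧ ∃ F H : X → ℂ, HolOn N F ∧ HolOn N H ∧
    ∀ᶠ z : U in denseOpens U, (z : X) ∈ N → H z ≠ 0 ∧ (f z : ℂ) * H z = F z

/-- The group `ℳˣ(U)` of invertible meromorphic functions on `U`. Meromorphic functions are
identified when they agree on a dense open subset. -/
def merUnits (U : Opens X) : Subgroup (Germ (denseOpens U) ℂˣ) where
  carrier := {c | ∃ f : U → ℂˣ, (f : Germ (denseOpens U) ℂˣ) = c ∧ IsMero U f}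
  one_mem' := ⟨fun _ => 1, rfl, fun y hy => ⟨U, hy, fun _ => 1, fun _ => 1, HolOn.one U,
    HolOn.one U, Eventually.of_forall fun z _ => by simp⟩⟩
  mul_mem' := by
    rintro _ _ ⟨f, rfl, hf⟩ ⟨f', rfl, hf'⟩
    refine ⟨f * f', rfl, fun y hy => ?_⟩
    obtain ⟨N, hN, F, H, hF, hH, h⟩ := hf y hy
    obtain ⟨N', hN', F', H', hF', hH', h'⟩ := hf' y hy
    refine ⟨N ⊓ N', ⟨hN, hN'⟩, _, _, (hF.mono inf_le_left).mul (hF'.mono inf_le_right),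
      (hH.mono inf_le_left).mul (hH'.mono inf_le_right), ?_⟩
    filter_upwards [h, h'] with z hz hz' hzN
    obtain ⟨h1, h2⟩ := hz hzN.1
    obtain ⟨h1', h2'⟩ := hz' hzN.2
    refine ⟨mul_ne_zero h1 h1', ?_⟩
    rw [← h2, ← h2', Pi.mul_apply, Units.val_mul]; ring
  inv_mem' := by
    rintro _ ⟨f, rfl, hf⟩
    refine ⟨f⁻¹, rfl, fun y hy => ?_⟩
    obtain ⟨N, hN, F, H, hF, hH, h⟩ := hf y hy
    refine ⟨N, hN, H, F, hH, hF, ?_⟩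
    filter_upwards [h] with z hz hzN
    obtain ⟨h1, h2⟩ := hz hzN
    rw [← h2]
    exact ⟨mul_ne_zero (f z).ne_zero h1, by simp⟩

/-- The map `W → U`, `y ↦ s⁻¹ y`. -/
def shift (s : ISL3) {U W : Opens X} (hs : ∀ y ∈ W, s⁻¹ • y ∈ U) (y : W) : U :=
  ⟨s⁻¹ • (y : X), hs y y.2⟩

lemma tendsto_shift (s : ISL3) {U W : Opens X} (hs : ∀ y ∈ W, s⁻¹ • y ∈ U) :
    Tendsto (shift s hs) (denseOpens W) (denseOpens U) := by
  refine tendsto_denseOpens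
    (((continuous_const_smul s⁻¹).comp continuous_subtype_val).subtype_mk _) ?_
  intro O hO
  refine (U.isOpen.isOpenEmbedding_subtypeVal.isOpen_iff_image_isOpen).2 ?_
  have h := (isOpenMap_smul s⁻¹) _ (W.isOpen.isOpenMap_subtype_val O hO)
  convert h using 1
  ext z
  simp only [Set.mem_image, shift]
  constructor
  · rintro ⟨_, ⟨y, hy, rfl⟩, rfl⟩
    exact ⟨y, ⟨y, hy, rfl⟩, rfl⟩
  · rintro ⟨_, ⟨y, hy, rfl⟩, rfl⟩
    exact ⟨_, ⟨y, hy, rfl⟩, rfl⟩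

/-- The equivariant sheaf `ℳˣ` on `X`. -/
def merSheaf : EquivPresheaf ISL3 X where
  sec U := merUnits U
  grp _ := inferInstance
  pull s {U W} hs :=
    { toFun := fun c => ⟨c.1.compTendsto (shift s hs) (tendsto_shift s hs), by
        obtain ⟨f, hfc, hf⟩ := c.2
        refine ⟨f ∘ shift s hs, by rw [← hfc]; rfl, fun y hy => ?_⟩
        obtain ⟨N, hN, F, H, hF, hH, h⟩ := hf _ (hs y hy)
        refine ⟨⟨(fun z : X => s⁻¹ • z) ⁻¹' N, N.isOpen.preimage (continuous_const_smul s⁻¹)⟩, hN,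
          _, _, hF.pull s⁻¹ fun z hz => hz, hH.pull s⁻¹ fun z hz => hz, ?_⟩
        exact (tendsto_shift s hs).eventually h⟩
      map_one' := rfl
      map_mul' := by
        rintro ⟨c, hc⟩ ⟨d, hd⟩
        refine Subtype.ext ?_
        induction c using Germ.inductionOn with
        | h f => induction d using Germ.inductionOn with
          | h f' => rfl }
  pull_one h := by
    rintro ⟨c, hc⟩
    refine Subtype.ext ?_
    induction c using Germ.inductionOn with
    | h f =>
      refine congrArg Germ.ofFun (funext fun y => congrArg f (Subtype.ext ?_))
      change (1 : ISL3)⁻¹ • (y : X) = y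
      simp
  pull_mul s t {U W T} h' h hh := by
    rintro ⟨c, hc⟩
    refine Subtype.ext ?_
    induction c using Germ.inductionOn with
    | h f =>
      refine congrArg Germ.ofFun (funext fun y => congrArg f (Subtype.ext ?_))
      change (s * t)⁻¹ • (y : X) = t⁻¹ • s⁻¹ • (y : X)
      rw [mul_inv_rev, mul_smul]

/-- The inclusion `𝒪ˣ(U) → ℳˣ(U)`. -/
def holToMer (U : Opens X) : holUnits U →* merUnits U where
  toFun f := ⟨(f.1 : Germ (denseOpens U) ℂˣ), f.1, rfl, fun y hy => by
    obtain ⟨F, h, e⟩ := f.2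
    exact ⟨U, hy, F, fun _ => 1, h, HolOn.one U, Eventually.of_forall fun z _ => by simp [e]⟩⟩
  map_one' := rfl
  map_mul' _ _ := rfl

/-- The function underlying a section of `𝒪ˣ`. -/
def holFun {U : Opens X} (f : holSheaf.sec U) : U → ℂˣ := Subtype.val (p := (· ∈ holUnits U)) f

/-- The section `c` of `ℳˣ` over `U` is the meromorphic function `f`: they agree on a dense open
subset of `U`. -/
def IsGermOf {U : Opens X} (c : merSheaf.sec U) (f : X → ℂ) : Prop :=
  Germ.map Units.val (Subtype.val (p := (· ∈ merUnits U)) c) =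
    ((fun y : U => f y : U → ℂ) : Germ (denseOpens U) ℂ)

/-- The map of equivariant cochains induced by `𝒪ˣ → ℳˣ`. -/
def cochainHolToMer {I : Type} [MulAction ISL3 I] {𝒱 : EquivCover ISL3 X I} {n : ℕ}
    (c : EquivCochain 𝒱 holSheaf n) : EquivCochain 𝒱 merSheaf n :=
  fun p q h g a => holToMer (𝒱.inter a) (c p q h g a)

/-! ### The covering -/

/-- `(α, β)` is an oriented basis of the plane `δ(a) = 0` in `Λ^∨ ⊗ ℝ`: completed on the left by
any `η` with `η(a) > 0` it becomes an oriented basis. -/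
def IsOrientedPlaneBasis (a : Fin 3 → ℤ) (α β : Fin 3 → ℝ) : Prop :=
  ∑ i, α i * a i = 0 ∧ ∑ i, β i * a i = 0 ∧
    ∀ η : Fin 3 → ℝ, 0 < ∑ i, η i * a i → 0 < (Matrix.of ![η, α, β]).det

/-- `U_a^+`. The choice of the oriented basis does not matter (`mem_Uplus_iff_forall`). -/
def Uplus (a : Fin 3 → ℤ) : Set (Fin 3 → ℂ) :=
  {x | ∃ α β : Fin 3 → ℝ, IsOrientedPlaneBasis a α β ∧ 0 < (pairR α x * conj (pairR β x)).im}

/-- `det(a, Re x, Im x)`. -/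
def orient (a : Fin 3 → ℤ) (x : Fin 3 → ℂ) : ℝ :=
  a 0 * ((x 1).re * (x 2).im - (x 2).re * (x 1).im) +
  a 1 * ((x 2).re * (x 0).im - (x 0).re * (x 2).im) +
  a 2 * ((x 0).re * (x 1).im - (x 1).re * (x 0).im)

lemma IsOrientedPlaneBasis.exists_pos {a : Fin 3 → ℤ} (ha : a ≠ 0) {α β : Fin 3 → ℝ}
    (h : IsOrientedPlaneBasis a α β) :
    ∃ s : ℝ, 0 < s ∧ ∀ x, (pairR α x * conj (pairR β x)).im = -(s * orient a x) := by
  obtain ⟨h1, h2, h3⟩ := h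
  have hpos : (0 : ℝ) < ∑ i, (a i : ℝ) * a i := by
    obtain ⟨i, hi⟩ := Function.ne_iff.1 ha
    have : (0 : ℝ) < (a i : ℝ) * a i := mul_self_pos.2 (by exact_mod_cast hi)
    exact lt_of_lt_of_le this
      (Finset.single_le_sum (f := fun i => (a i : ℝ) * a i) (fun i _ => mul_self_nonneg _)
        (Finset.mem_univ i))
  have hd := h3 (fun i => a i) hpos
  simp only [Fin.sum_univ_three] at h1 h2 hpos
  rw [Matrix.det_fin_three] at hd
  simp only [Matrix.of_apply, Matrix.cons_val] at hd
  set D : ℝ := _ with hD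
  set n : ℝ := (a 0 : ℝ) * a 0 + a 1 * a 1 + a 2 * a 2 with hn
  refine ⟨D / n, div_pos hd hpos, fun x => ?_⟩
  rw [div_mul_eq_mul_div, ← neg_div, eq_div_iff hpos.ne']
  have e0 : (α 2 * β 0 - α 0 * β 2) * a 2 - (α 0 * β 1 - α 1 * β 0) * a 1 = 0 := by
    linear_combination β 0 * h1 - α 0 * h2
  have e1 : (α 0 * β 1 - α 1 * β 0) * a 0 - (α 1 * β 2 - α 2 * β 1) * a 2 = 0 := by
    linear_combination β 1 * h1 - α 1 * h2
  have e2 : (α 1 * β 2 - α 2 * β 1) * a 1 - (α 2 * β 0 - α 0 * β 2) * a 0 = 0 := by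
    linear_combination β 2 * h1 - α 2 * h2
  have k0 : n * (α 1 * β 2 - α 2 * β 1) = D * a 0 := by
    rw [hn, hD]; linear_combination a 1 * e2 - a 2 * e1
  have k1 : n * (α 2 * β 0 - α 0 * β 2) = D * a 1 := by
    rw [hn, hD]; linear_combination a 2 * e0 - a 0 * e2
  have k2 : n * (α 0 * β 1 - α 1 * β 0) = D * a 2 := by
    rw [hn, hD]; linear_combination a 0 * e1 - a 1 * e0
  simp only [pairR, Fin.sum_univ_three, orient, map_add, map_mul, Complex.conj_ofReal,
    Complex.add_re, Complex.add_im, Complex.mul_re, Complex.mul_im, Complex.ofReal_re,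
    Complex.ofReal_im, Complex.conj_re, Complex.conj_im]
  linear_combination
    (-((x 1).re * (x 2).im - (x 2).re * (x 1).im)) * k0 -
    ((x 2).re * (x 0).im - (x 0).re * (x 2).im) * k1 -
    ((x 0).re * (x 1).im - (x 1).re * (x 0).im) * k2

/-- Oriented bases exist. -/
lemma exists_isOrientedPlaneBasis {a : Fin 3 → ℤ} (ha : a ≠ 0) :
    ∃ α β, IsOrientedPlaneBasis a α β := by
  have key : ∀ α β : Fin 3 → ℝ, ∀ s : ℝ, 0 < s →
      α 1 * β 2 - α 2 * β 1 = s * a 0 → α 2 * β 0 - α 0 * β 2 = s * a 1 →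
      α 0 * β 1 - α 1 * β 0 = s * a 2 → IsOrientedPlaneBasis a α β := by
    intro α β s hs h0 h1 h2
    refine ⟨?_, ?_, fun η hη => ?_⟩
    · refine (mul_eq_zero.1 (?_ : s * _ = 0)).resolve_left hs.ne'
      simp only [Fin.sum_univ_three]
      linear_combination (-α 0) * h0 - α 1 * h1 - α 2 * h2
    · refine (mul_eq_zero.1 (?_ : s * _ = 0)).resolve_left hs.ne'
      simp only [Fin.sum_univ_three]
      linear_combination (-β 0) * h0 - β 1 * h1 - β 2 * h2
    · have : (Matrix.of ![η, α, β]).det = s * ∑ i, η i * a i := by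
        rw [Matrix.det_fin_three]
        simp only [Matrix.of_apply, Matrix.cons_val, Fin.sum_univ_three]
        linear_combination η 0 * h0 + η 1 * h1 + η 2 * h2
      rw [this]; exact mul_pos hs hη
  by_cases h0 : a 0 = 0
  · by_cases h1 : a 1 = 0
    · have h2 : a 2 ≠ 0 := fun h2 => ha (funext fun i => by fin_cases i <;> assumption)
      have h2' : (a 2 : ℝ) ≠ 0 := by exact_mod_cast h2
      exact ⟨![1, 0, 0], ![0, a 2, 0], key _ _ 1 one_pos (by simp [h0]) (by simp [h1]) (by simp)⟩
    · have h1' : (a 1 : ℝ) ≠ 0 := by exact_mod_cast h1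
      refine ⟨![1, 0, 0], ![0, a 2, -a 1], key _ _ 1 one_pos (by simp [h0]) (by simp) (by simp)⟩
  · have h0' : (a 0 : ℝ) ≠ 0 := by exact_mod_cast h0
    have hs : (0 : ℝ) < a 0 * a 0 := mul_self_pos.2 h0'
    refine ⟨![-a 1, a 0, 0], ![-(a 0 * a 2), 0, a 0 * a 0], key _ _ _ hs ?_ ?_ ?_⟩ <;>
      simp only [Matrix.cons_val] <;> ring

lemma mem_Uplus_iff {a : Fin 3 → ℤ} (ha : a ≠ 0) (x : Fin 3 → ℂ) :
    x ∈ Uplus a ↔ orient a x < 0 := by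
  constructor
  · rintro ⟨α, β, h, hx⟩
    obtain ⟨s, hs, e⟩ := h.exists_pos ha
    rw [e] at hx
    by_contra hn
    have := mul_nonneg hs.le (not_lt.1 hn)
    linarith
  · intro hx
    obtain ⟨α, β, h⟩ := exists_isOrientedPlaneBasis ha
    obtain ⟨s, hs, e⟩ := h.exists_pos ha
    refine ⟨α, β, h, ?_⟩
    rw [e]
    have := mul_neg_of_pos_of_neg hs hx
    linarith

lemma mem_Uplus_iff_forall {a : Fin 3 → ℤ} (ha : a ≠ 0) (x : Fin 3 → ℂ) :
    x ∈ Uplus a ↔ ∀ α β, IsOrientedPlaneBasis a α β → 0 < (pairR α x * conj (pairR β x)).im := by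
  constructor
  · intro hx α β h
    obtain ⟨s, hs, e⟩ := h.exists_pos ha
    rw [e]
    have := mul_neg_of_pos_of_neg hs ((mem_Uplus_iff ha x).1 hx)
    linarith
  · intro hx
    obtain ⟨α, β, h⟩ := exists_isOrientedPlaneBasis ha
    exact ⟨α, β, h, hx α β h⟩

lemma IsPrimitive.ne_zero {a : Fin 3 → ℤ} (ha : IsPrimitive a) : a ≠ 0 := by
  rintro rfl
  exact not_isUnit_zero (ha 0 0 (by simp))

lemma orient_smul (a : Fin 3 → ℤ) (c : ℂ) (x : Fin 3 → ℂ) :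
    orient a (c • x) = Complex.normSq c * orient a x := by
  simp only [orient, Pi.smul_apply, smul_eq_mul, Complex.mul_re, Complex.mul_im,
    Complex.normSq_apply]
  ring

lemma continuous_orient (a : Fin 3 → ℤ) : Continuous (orient a) := by
  unfold orient; fun_prop

lemma smul_mem_Uplus {a : Prim} {c : ℂ} (hc : c ≠ 0) {x : Fin 3 → ℂ} :
    c • x ∈ Uplus a.1 ↔ x ∈ Uplus a.1 := by
  rw [mem_Uplus_iff a.2.ne_zero, mem_Uplus_iff a.2.ne_zero, orient_smul]
  have := Complex.normSq_pos.2 hc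
  constructor
  · intro h; by_contra hn; have := mul_nonneg this.le (not_lt.1 hn); linarith
  · exact mul_neg_of_pos_of_neg this

/-- The image in `X` of the set of pairs `(w, x)` with `x ∈ U_a^+`. -/
def VSet (a : Prim) : Set X := {y | ∃ p : Tot, p.1.2 ∈ Uplus a.1 ∧ mk p = y}

lemma mk_mem_VSet (a : Prim) (p : Tot) : mk p ∈ VSet a ↔ p.1.2 ∈ Uplus a.1 := by
  refine ⟨?_, fun h => ⟨p, h, rfl⟩⟩
  rintro ⟨q, hq, e⟩
  obtain ⟨c, hc⟩ := Quotient.exact e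
  have : q.1.2 = (c : ℂ) • p.1.2 := by rw [← hc]; rfl
  rw [this] at hq
  exact (smul_mem_Uplus c.ne_zero).1 hq

lemma isOpen_VSet (a : Prim) : IsOpen (VSet a) := by
  refine (isQuotientMap_quot_mk (r := (MulAction.orbitRel ℂˣ Tot).r)).isOpen_preimage.1 ?_
  have : {p : Tot | orient a.1 p.1.2 < 0} = mk ⁻¹' VSet a := by
    ext p
    rw [Set.mem_preimage, mk_mem_VSet, mem_Uplus_iff a.2.ne_zero]; rfl
  change IsOpen (mk ⁻¹' VSet a)
  rw [← this]
  exact isOpen_lt ((continuous_orient _).comp (continuous_snd.comp continuous_subtype_val))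
    continuous_const

lemma isPrimitive_of_coord {a : Fin 3 → ℤ} (i : Fin 3) (h : IsUnit (a i)) : IsPrimitive a := by
  rintro n b rfl
  exact isUnit_of_mul_isUnit_left (by simpa using h)

lemma exists_mem_Uplus {x : Fin 3 → ℂ} (hx : ¬ IsRealPoint x) : ∃ a : Prim, x ∈ Uplus a.1 := by
  by_contra! hcon
  have key : ∀ a : Prim, orient a.1 x = 0 := by
    intro a
    have h1 := hcon a
    have h2 := hcon ⟨-a.1, fun n b h => a.2 n (-b) (by rw [smul_neg, ← h, neg_neg])⟩
    rw [mem_Uplus_iff a.2.ne_zero, not_lt] at h1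
    rw [mem_Uplus_iff (neg_ne_zero.2 a.2.ne_zero), not_lt] at h2
    have : orient (-a.1) x = -orient a.1 x := by simp [orient]; ring
    linarith
  have k0 := key ⟨![1, 0, 0], isPrimitive_of_coord 0 (by simp)⟩
  have k1 := key ⟨![0, 1, 0], isPrimitive_of_coord 1 (by simp)⟩
  have k2 := key ⟨![0, 0, 1], isPrimitive_of_coord 2 (by simp)⟩
  simp [orient] at k0 k1 k2
  have real : ∀ j, x j ≠ 0 → False := by
    intro j hj
    refine hx ⟨x j, fun i => (x i / x j).re, fun i => ?_⟩
    have : ((x i / x j).re : ℂ) = x i / x j := by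
      refine Complex.ext rfl ?_
      rw [Complex.ofReal_im, Complex.div_im, ← sub_div, eq_comm, div_eq_zero_iff]
      left
      fin_cases i <;> fin_cases j <;> simp <;> linarith
    rw [this]; field_simp
  by_cases h : ∃ j, x j ≠ 0
  · obtain ⟨j, hj⟩ := h; exact real j hj
  · push Not at h
    exact hx ⟨0, 0, fun i => by simp [h i]⟩

lemma orient_act (s : ISL3) (a : Prim) (p : ℂ × (Fin 3 → ℂ)) :
    orient (s • a).1 (act s p).2 = orient a.1 p.2 := by
  have hdet : (s.g.1.det : ℝ) = 1 := by rw [s.g.2]; simp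
  rw [Matrix.det_fin_three] at hdet
  push_cast at hdet
  change orient (s.g.1 *ᵥ a.1) (fun i => pair (s.g.1 i) p.2) = _
  simp only [orient, pair, Matrix.mulVec, dotProduct, Fin.sum_univ_three, Complex.add_re,
    Complex.add_im, Complex.mul_re, Complex.mul_im, Complex.intCast_re, Complex.intCast_im]
  push_cast
  linear_combination
    ((a.1 0 : ℝ) * ((p.2 1).re * (p.2 2).im - (p.2 2).re * (p.2 1).im) +
    a.1 1 * ((p.2 2).re * (p.2 0).im - (p.2 0).re * (p.2 2).im) +
    a.1 2 * ((p.2 0).re * (p.2 1).im - (p.2 1).re * (p.2 0).im)) * hdet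

/-- The equivariant covering of `X` by the sets `V_a`, `a ∈ Λ_prim`. -/
def cover : EquivCover ISL3 X Prim where
  V a := ⟨VSet a, isOpen_VSet a⟩
  covers y := by
    induction y using Quotient.inductionOn with
    | h p =>
      obtain ⟨a, ha⟩ := exists_mem_Uplus p.2
      exact ⟨a, p, ha, rfl⟩
  equivariant s a y := by
    rintro ⟨p, hp, rfl⟩
    refine ⟨s • p, ?_, rfl⟩
    rw [mem_Uplus_iff a.2.ne_zero] at hp
    rw [mem_Uplus_iff (s • a).2.ne_zero]
    exact (orient_act s a p.1).trans_lt hp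

/-! ### The functions `Γ_{a,b}` and `Δ_a` -/

/-- For linearly independent `a, b`, the primitive `γ ∈ Λ^∨` with `det(a, b, ·) = s γ`, `s > 0`
(see `gam_spec`). -/
def gam (a b : Fin 3 → ℤ) : Fin 3 → ℤ := fun i => (a ⨯₃ b) i / Finset.univ.gcd (a ⨯₃ b)

lemma gam_spec {a b : Fin 3 → ℤ} (h : a ⨯₃ b ≠ 0) : IsPrimitive (gam a b) ∧
    ∃ s : ℤ, 0 < s ∧ ∀ c, (Matrix.of ![a, b, c]).det = s * (gam a b ⬝ᵥ c) := by
  set d := Finset.univ.gcd (a ⨯₃ b) with hd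
  have hd0 : d ≠ 0 := by
    intro h0
    rw [hd, Finset.gcd_eq_zero_iff] at h0
    exact h (funext fun i => h0 i (Finset.mem_univ i))
  have hpos : 0 < d := by
    refine lt_of_le_of_ne ?_ hd0.symm
    rw [hd, ← Finset.normalize_gcd]
    exact Int.nonneg_of_normalize_eq_self (normalize_idem _)
  have hdiv : ∀ i, d * gam a b i = (a ⨯₃ b) i := fun i =>
    Int.mul_ediv_cancel' (Finset.gcd_dvd (Finset.mem_univ i))
  refine ⟨fun n c hc => ?_, d, hpos, fun c => ?_⟩
  · have : d * n ∣ d := by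
      conv_rhs => rw [hd]
      refine Finset.dvd_gcd fun i _ => ⟨c i, ?_⟩
      rw [← hdiv, hc, Pi.smul_apply, smul_eq_mul, mul_assoc]
    rw [isUnit_iff_dvd_one]
    exact (mul_dvd_mul_iff_left hd0).1 (by simpa using this)
  · have e : d * (gam a b ⬝ᵥ c) = (a ⨯₃ b) ⬝ᵥ c := by
      simp only [dotProduct, Finset.mul_sum, ← mul_assoc, hdiv]
    rw [e, Matrix.det_fin_three]
    simp [cross_apply, dotProduct, Fin.sum_univ_three]
    ring

/-- `C_{+-}(a, b) = {δ ∈ Λ^∨ | δ(a) > 0, δ(b) ≤ 0}`. -/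
def Cpm (a b : Fin 3 → ℤ) : Set (Fin 3 → ℤ) := {δ | 0 < δ ⬝ᵥ a ∧ δ ⬝ᵥ b ≤ 0}

/-- `C_{+-}(a, b)/ℤγ`, as a subset of `Λ^∨/ℤγ`. -/
def CpmQuot (γ a b : Fin 3 → ℤ) : Set ((Fin 3 → ℤ) ⧸ AddSubgroup.zmultiples γ) :=
  QuotientAddGroup.mk '' Cpm a b

lemma pair_add (δ ε : Fin 3 → ℤ) (x : Fin 3 → ℂ) : pair (δ + ε) x = pair δ x + pair ε x := by
  simp only [pair, Fin.sum_univ_three, Pi.add_apply]; push_cast; ring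

lemma pair_zsmul (n : ℤ) (ε : Fin 3 → ℤ) (x : Fin 3 → ℂ) : pair (n • ε) x = n * pair ε x := by
  simp only [pair, Fin.sum_univ_three, Pi.smul_apply, smul_eq_mul]; push_cast; ring

/-- The factor `1 - exp(± 2πi (δ(x) - w)/γ(x))`, for `ε = ±1`; it depends only on the class of
`δ` modulo `ℤγ`. -/
def gammaFactor (γ : Fin 3 → ℤ) (ε : ℤ) (w : ℂ) (x : Fin 3 → ℂ)
    (q : (Fin 3 → ℤ) ⧸ AddSubgroup.zmultiples γ) : ℂ :=
  Quotient.liftOn' q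
    (fun δ => 1 - Complex.exp (ε * (2 * Real.pi * Complex.I * (pair δ x - w) / pair γ x))) (by
      intro δ δ' h
      rw [QuotientAddGroup.leftRel_apply] at h
      obtain ⟨n, hn⟩ := h
      have e : δ' = δ + n • γ := by
        change n • γ = _ at hn
        rw [hn]; abel
      congr 1
      rcases eq_or_ne (pair γ x) 0 with h0 | h0
      · simp [h0]
      · refine Complex.exp_eq_exp_iff_exists_int.2 ⟨-(ε * n), ?_⟩
        rw [e, pair_add, pair_zsmul]
        push_cast
        field_simp
        ring)

open Classical in
/-- The function `Γ_{a,b}(w, x)`; it is `1` if `a, b` are linearly dependent, that is `b = ± a`. -/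
def Gam (a b : Prim) (w : ℂ) (x : Fin 3 → ℂ) : ℂ :=
  if a.1 ⨯₃ b.1 = 0 then 1 else
    (∏' q : CpmQuot (gam a.1 b.1) a.1 b.1, gammaFactor (gam a.1 b.1) (-1) w x q) *
    (∏' q : CpmQuot (gam a.1 b.1) b.1 a.1, gammaFactor (gam a.1 b.1) 1 w x q)⁻¹

/-- The `j`-th factor of `θ₀`. -/
def thetaFactor (z τ : ℂ) (j : ℕ) : ℂ :=
  (1 - Complex.exp (2 * Real.pi * Complex.I * ((j + 1) * τ - z))) *
    (1 - Complex.exp (2 * Real.pi * Complex.I * (j * τ + z)))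

/-- `θ₀(z, τ)`. -/
def theta0 (z τ : ℂ) : ℂ := ∏' j, thetaFactor z τ j

/-- `∏_{j=0}^{n-1} f(j)` for an integer `n`; for `n < 0` it is `∏_{j=n}^{-1} f(j)⁻¹`. -/
def zprod (n : ℤ) (f : ℤ → ℂ) : ℂ :=
  (∏ j ∈ Finset.Ico 0 n, f j) * (∏ j ∈ Finset.Ico n 0, f j)⁻¹

/-- A framing: for each `a ∈ Λ_prim` an oriented basis `(α₁, α₂, α₃)` of `Λ^∨` (the rows of a
matrix in `SL₃(ℤ)`) with `α₁(a) = 1` and `α₂(a) = α₃(a) = 0`. -/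
structure Framing where
  basis : Prim → Matrix.SpecialLinearGroup (Fin 3) ℤ
  basis_apply : ∀ a : Prim, (basis a).1 *ᵥ a.1 = ![1, 0, 0]

/-- `α_{i+1}(x)` for the basis `(α₁, α₂, α₃)` attached to `a`. -/
def Framing.coord (fr : Framing) (a : Prim) (i : Fin 3) (x : Fin 3 → ℂ) : ℂ :=
  pair ((fr.basis a).1 i) x

/-- The function `Δ_a((g, μ); w, x)`. -/
def Delta (fr : Framing) (a : Prim) (s : ISL3) (w : ℂ) (x : Fin 3 → ℂ) : ℂ :=
  zprod (s.μ ⬝ᵥ (s.g⁻¹.1 *ᵥ a.1)) fun j =>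
    theta0 ((w + j * fr.coord a 0 x) / fr.coord a 2 x) (fr.coord a 1 x / fr.coord a 2 x)

lemma Gam_smul (a b : Prim) {c : ℂ} (hc : c ≠ 0) (w : ℂ) (x : Fin 3 → ℂ) :
    Gam a b (c * w) (c • x) = Gam a b w x := by
  have : ∀ ε : ℤ, gammaFactor (gam a.1 b.1) ε (c * w) (c • x) =
      gammaFactor (gam a.1 b.1) ε w x := by
    intro ε
    funext q
    induction q using Quotient.inductionOn' with
    | h δ =>
      simp only [gammaFactor, Quotient.liftOn'_mk'']
      rw [pair_smul, pair_smul, ← mul_sub, mul_left_comm, mul_div_mul_left _ _ hc]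
  simp only [Gam, this]

lemma Delta_smul (fr : Framing) (a : Prim) (s : ISL3) {c : ℂ} (hc : c ≠ 0) (w : ℂ)
    (x : Fin 3 → ℂ) : Delta fr a s (c * w) (c • x) = Delta fr a s w x := by
  unfold Delta Framing.coord
  congr 1
  funext j
  rw [pair_smul, pair_smul, pair_smul, mul_left_comm, ← mul_add, mul_div_mul_left _ _ hc,
    mul_div_mul_left _ _ hc]

/-- `Γ_{a,b}` as a function on `X`. -/
def GamX (a b : Prim) : X → ℂ :=
  Quotient.lift (fun p : Tot => Gam a b p.1.1 p.1.2) (by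
    rintro _ q ⟨c, rfl⟩
    exact Gam_smul a b c.ne_zero q.1.1 q.1.2)

/-- `Δ_a((g, μ); ·)` as a function on `X`. -/
def DeltaX (fr : Framing) (a : Prim) (s : ISL3) : X → ℂ :=
  Quotient.lift (fun p : Tot => Delta fr a s p.1.1 p.1.2) (by
    rintro _ q ⟨c, rfl⟩
    exact Delta_smul fr a s c.ne_zero q.1.1 q.1.2)

/-! ### Bernoulli polynomials and the ring `ℚ(x)[w]` -/

/-- The multiple Bernoulli polynomial `B_{r,n}(w | ω₁, …, ω_r)`, for nonzero `ω_j`: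
`t^r e^{wt} / ∏_j (e^{ω_j t} - 1) = ∑_n B_{r,n}(w | ω) t^n/n!`. (The series
`bernoulliPowerSeries` is `t/(e^t - 1)`.) -/
def multiBernoulli {r : ℕ} (n : ℕ) (w : ℂ) (ω : Fin r → ℂ) : ℂ :=
  n.factorial * PowerSeries.coeff n (PowerSeries.rescale w (PowerSeries.exp ℂ) *
    ∏ j, PowerSeries.C (ω j)⁻¹ * PowerSeries.rescale (ω j) (bernoulliPowerSeries ℂ))

/-- For `det(a, b, c) > 0`, with `α, β, γ ∈ Λ^∨` the primitive vectors satisfying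
`α(b) = α(c) = 0 < α(a)`, `β(c) = β(a) = 0 < β(b)`, `γ(a) = γ(b) = 0 < γ(c)`, the sum of
`B_{3,3}(w + δ(x) | α(x), β(x), γ(x))` over the finite set of all `δ ∈ Λ^∨` with
`0 ≤ δ(a) < α(a)`, `0 ≤ δ(b) < β(b)`, `0 ≤ δ(c) < γ(c)`. -/
def bernoulliSum (a b c : Fin 3 → ℤ) (w : ℂ) (x : Fin 3 → ℂ) : ℂ :=
  ∑ᶠ δ ∈ {δ : Fin 3 → ℤ | (0 ≤ δ ⬝ᵥ a ∧ δ ⬝ᵥ a < gam b c ⬝ᵥ a) ∧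
      (0 ≤ δ ⬝ᵥ b ∧ δ ⬝ᵥ b < gam c a ⬝ᵥ b) ∧ (0 ≤ δ ⬝ᵥ c ∧ δ ⬝ᵥ c < gam a b ⬝ᵥ c)},
    multiBernoulli 3 (w + pair δ x) ![pair (gam b c) x, pair (gam c a) x, pair (gam a b) x]

/-- The function `P_{a,b,c}(w, x)`: `bernoulliSum` for `det(a, b, c) > 0`, extended by
`P_{a,b,c} = -P_{a,c,b}`, and `0` if `a, b, c` are linearly dependent. -/
def PBernoulli (a b c : Prim) (w : ℂ) (x : Fin 3 → ℂ) : ℂ :=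
  if 0 < (Matrix.of ![a.1, b.1, c.1]).det then bernoulliSum a.1 b.1 c.1 w x
  else if (Matrix.of ![a.1, b.1, c.1]).det < 0 then -bernoulliSum a.1 c.1 b.1 w x
  else 0

/-- An element of `ℚ(x)[w]`, `x = (x₁, x₂, x₃)`, written with a common denominator in `ℚ[x]`. -/
structure QxW where
  num : Polynomial (MvPolynomial (Fin 3) ℚ)
  den : MvPolynomial (Fin 3) ℚ
  den_ne_zero : den ≠ 0

/-- The denominator does not vanish at `x`. -/
def QxW.RegularAt (P : QxW) (x : Fin 3 → ℂ) : Prop := MvPolynomial.aeval x P.den ≠ 0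

/-- The value `P(w, x)` at a point `x` where the denominator does not vanish. -/
def QxW.eval (P : QxW) (w : ℂ) (x : Fin 3 → ℂ) : ℂ :=
  Polynomial.eval₂ (MvPolynomial.aeval (R := ℚ) x).toRingHom w P.num / MvPolynomial.aeval x P.den

end GammaGerbe

end

open GammaGerbe

/-!
Let `Γ(w | ω₁, ω₂, ω₃)` be the elliptic gamma function, in the homogeneous form
`gammaNum w ω₁ ω₂ ω₃ / gammaNum w ω₂ ω₁ (-ω₃)`, a quotient of two entire functions of `w`.

*Relation for three vectors.* If `(α, β, γ)` is dual, up to positive multiples, to `(a, b, c)`, then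
the cone `C(a, b)` modulo `ℤγ` is a finite union of translates of a copy of `ℕ × ℕ`, indexed by a
fundamental box of `ℤα + ℤβ + ℤγ` in `Λ^∨` (`IsDualTriple.coneEquiv`). So `Γ_{a,b}` is the product
over the box of the functions `Γ(w + δ(x) | α(x), β(x), γ(x))`, and this gives convergence and
meromorphy as well. The same box serves `Γ_{b,c}` and `Γ_{c,a}`, hence for `det(a, b, c) ≠ 0` the
relation is the product over the box of the modular three-term relation of the elliptic gamma
function (`tripleNum_eq_tripleDen`). In the latter the two sides are entire functions with the same
quasi-periods `ω₁`, `ω₂`, by the modular transformation of `θ₀`; they are proportional since their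
quotient is holomorphic near a fundamental parallelogram (`exists_eq_const_mul_of_quasiperiods`),
and equal since they agree at `w = (ω₁ + ω₂ + ω₃)/2`. If `a`, `b`, `c` are coplanar, then one of the
vectors lies between the two others or one of the functions is trivial, and the cone of the outer
pair decomposes into the cones of the two inner pairs (`coneNum_mul_of_between`).

*Transformation laws.* The action of `g` permutes the factors, and the translation of `w` by `μ(x)`
shifts the cone (`coneNum_add`). The rows by which the shifted cone differs from `C(a, b)` contribute
theta functions attached to bases of the plane `δ(a) = 0` (`exists_coneNum_row`). Two oriented
bases of this plane differ by an element of `SL₂(ℤ)`, and the generators `S`, `T` change `θ₀` only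
by factors `exp(πi F)` with `F ∈ ℚ(x)[w]`; therefore theta functions may be replaced by those of the
framing at the cost of such a factor (`thetaRow_ratEquiv`). This yields `exists_Gam_transform`
and `exists_Delta_transform`.

*The cocycle.* Call `[(w, x)] ∈ X` generic if `w ≠ δ(x)` for all `δ ∈ Λ^∨`. At generic points all
`Γ_{a,b}` and `Δ_a` are finite and nonzero, and the three laws say that the exponentials in `φ` have
the values of the coboundary of `(Γ, Δ)`. Each slice `x = const` has only countably many points that
are not generic, so continuity in `w` carries over to all points what holds at the generic ones:
the exponentials are invariant under scaling, hence functions on `X` (`exp_eval_smul`); they form a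
cocycle, because a coboundary does (`isCocycle_of_generic`); and their image in `ℳˣ` is the
coboundary of `(Γ, Δ)` (`totalD_eq_of_eventually`).
-/

namespace GammaGerbe

/-! ### Holomorphic dependence of infinite products on several variables -/

section SeveralVariables

variable {E : Type*} [NormedAddCommGroup E] [NormedSpace ℂ E]

/-- Cauchy's estimate for the derivative of a bounded holomorphic function on a ball. -/
lemma norm_fderiv_le_of_forall_mem_ball {g : E → ℂ} {x y : E} {r M : ℝ} (hr : 0 < r)
    (hg : DifferentiableOn ℂ g (Metric.ball x r)) (hM : ∀ z ∈ Metric.ball x r, ‖g z‖ ≤ M)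
    (hy : y ∈ Metric.ball x (r / 2)) : ‖fderiv ℂ g y‖ ≤ 4 * M / r := by
  have hM0 : 0 ≤ M := (norm_nonneg _).trans (hM x (Metric.mem_ball_self hr))
  refine ContinuousLinearMap.opNorm_le_bound _ (by positivity) fun v => ?_
  rcases eq_or_ne v 0 with rfl | hv
  · simp
  have hv' : 0 < ‖v‖ := norm_pos_iff.2 hv
  set R := r / (4 * ‖v‖) with hR
  have hRpos : 0 < R := by positivity
  have hmem : ∀ t ∈ Metric.closedBall (0 : ℂ) R, y + t • v ∈ Metric.ball x r := by
    intro t ht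
    rw [mem_closedBall_zero_iff] at ht
    rw [mem_ball_iff_norm] at hy ⊢
    have h1 : ‖t • v‖ ≤ r / 4 := by
      rw [norm_smul]
      calc ‖t‖ * ‖v‖ ≤ R * ‖v‖ := by gcongr
        _ = r / 4 := by rw [hR]; field_simp
    calc ‖y + t • v - x‖ = ‖(y - x) + t • v‖ := by congr 1; abel
      _ ≤ ‖y - x‖ + ‖t • v‖ := norm_add_le _ _
      _ < r := by linarith
  have hline : Differentiable ℂ fun t : ℂ => y + t • v := by fun_prop
  have hd : DifferentiableOn ℂ (fun t : ℂ => g (y + t • v)) (Metric.closedBall 0 R) :=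
    hg.comp hline.differentiableOn hmem
  have h0 : HasDerivAt (fun t : ℂ => g (y + t • v)) (fderiv ℂ g y v) 0 := by
    have hy0 : y + (0 : ℂ) • v = y := by simp
    have hyr : y ∈ Metric.ball x r := Metric.ball_subset_ball (by linarith) hy
    have h1 : HasFDerivAt g (fderiv ℂ g y) (y + (0 : ℂ) • v) := by
      rw [hy0]
      exact (hg.differentiableAt (Metric.isOpen_ball.mem_nhds hyr)).hasFDerivAt
    have h2 : HasDerivAt (fun t : ℂ => y + t • v) v 0 := by
      simpa using ((hasDerivAt_id (0 : ℂ)).smul_const v).const_add y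
    exact h1.comp_hasDerivAt (0 : ℂ) h2
  have h3 := Complex.norm_deriv_le_of_forall_mem_sphere_norm_le hRpos
    (hd.diffContOnCl_ball subset_rfl)
    fun t ht => hM _ (hmem t (Metric.sphere_subset_closedBall ht))
  rw [h0.deriv] at h3
  refine h3.trans (le_of_eq ?_)
  rw [hR]; field_simp

/-- Weierstrass' theorem in several variables: a uniform limit of holomorphic functions is
holomorphic. -/
lemma differentiableAt_of_tendstoUniformlyOn_ball {ι : Type*} {l : Filter ι} [l.NeBot]
    {F : ι → E → ℂ} {f : E → ℂ} {x : E} {r : ℝ} (hr : 0 < r)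
    (h : TendstoUniformlyOn F f l (Metric.ball x r))
    (hF : ∀ n, DifferentiableOn ℂ (F n) (Metric.ball x r)) : DifferentiableAt ℂ f x := by
  have hsub : Metric.ball x (r / 2) ⊆ Metric.ball x r := Metric.ball_subset_ball (by linarith)
  have hdiff : ∀ n, ∀ y ∈ Metric.ball x (r / 2), DifferentiableAt ℂ (F n) y := fun n y hy =>
    (hF n).differentiableAt (Metric.isOpen_ball.mem_nhds (hsub hy))
  have hC : UniformCauchySeqOn (fun n => fderiv ℂ (F n)) l (Metric.ball x (r / 2)) := by
    intro V hV
    obtain ⟨ε, hε, hεV⟩ := Metric.mem_uniformity_dist.1 hV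
    have := h.uniformCauchySeqOn _ (Metric.dist_mem_uniformity (ε := ε * r / 8) (by positivity))
    filter_upwards [this] with n hn y hy
    refine hεV ?_
    rw [dist_eq_norm, ← fderiv_sub (hdiff _ y hy) (hdiff _ y hy)]
    refine (norm_fderiv_le_of_forall_mem_ball (M := ε * r / 8) hr
      ((hF n.1).sub (hF n.2)) (fun z hz => ?_) hy).trans_lt ?_
    · have : dist (F n.1 z) (F n.2 z) ≤ ε * r / 8 := (hn z hz).le
      rwa [dist_eq_norm] at this
    · field_simp; linarith
  have hlim : ∀ y ∈ Metric.ball x (r / 2), ∃ L, Tendsto (fun n => fderiv ℂ (F n) y) l (nhds L) :=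
    fun y hy => CompleteSpace.complete (hC.cauchy_map hy)
  choose! g' hg' using hlim
  exact (hasFDerivAt_of_tendstoUniformlyOn Metric.isOpen_ball
    (hC.tendstoUniformlyOn_of_tendsto hg') (fun n y hy => (hdiff n y hy).hasFDerivAt)
    (fun y hy => h.tendsto_at (hsub hy)) (Metric.mem_ball_self (by linarith))).differentiableAt

lemma differentiableOn_finset_prod {ι : Type*} (s : Finset ι) {f : ι → E → ℂ} {U : Set E}
    (hf : ∀ i, DifferentiableOn ℂ (f i) U) : DifferentiableOn ℂ (fun y => ∏ i ∈ s, f i y) U := by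
  classical
  induction s using Finset.induction_on with
  | empty => simp
  | insert i s hi ih =>
    simp only [Finset.prod_insert hi]
    exact (hf i).mul ih

lemma differentiableAt_tprod_one_sub [ProperSpace E] {ι : Type*} {f : ι → E → ℂ} {x : E}
    {r : ℝ} (hr : 0 < r) {u : ι → ℝ} (hu : Summable u)
    (hf : ∀ i, DifferentiableOn ℂ (f i) (Metric.closedBall x r))
    (hb : ∀ i, ∀ y ∈ Metric.closedBall x r, ‖f i y‖ ≤ u i) :
    DifferentiableAt ℂ (fun y => ∏' i, (1 - f i y)) x := by
  have h := Summable.hasProdUniformlyOn_one_add (isCompact_closedBall x r) hu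
    (f := fun i y => -f i y) (Eventually.of_forall fun i y hy => by simpa using hb i y hy)
    (fun i => (hf i).continuousOn.neg)
  rw [hasProdUniformlyOn_iff_tendstoUniformlyOn] at h
  have h' := h.mono Metric.ball_subset_closedBall
  simp only [← sub_eq_add_neg] at h'
  refine differentiableAt_of_tendstoUniformlyOn_ball hr h' fun s => ?_
  refine differentiableOn_finset_prod s fun i => ?_
  exact (differentiableOn_const (1 : ℂ)).sub ((hf i).mono Metric.ball_subset_closedBall)

end SeveralVariables

/-! ### The `q`-Pochhammer symbols in one and two bases -/

/-- The product `∏_{n ≥ 0} (1 - z qⁿ)`. -/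
noncomputable def qPoch (z q : ℂ) : ℂ := ∏' n : ℕ, (1 - z * q ^ n)

/-- The product `∏_{j,k ≥ 0} (1 - z p^j q^k)`. -/
noncomputable def qPoch₂ (z p q : ℂ) : ℂ := ∏' n : ℕ × ℕ, (1 - z * p ^ n.1 * q ^ n.2)

lemma summable_pow_mul_pow {p q : ℝ} (hp0 : 0 ≤ p) (hp : p < 1) (hq0 : 0 ≤ q) (hq : q < 1) :
    Summable fun n : ℕ × ℕ => p ^ n.1 * q ^ n.2 :=
  (summable_geometric_of_lt_one hp0 hp).mul_of_nonneg (summable_geometric_of_lt_one hq0 hq)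
    (fun _ => pow_nonneg hp0 _) fun _ => pow_nonneg hq0 _

lemma summable_norm_qPoch {q : ℂ} (hq : ‖q‖ < 1) (z : ℂ) : Summable fun n : ℕ => ‖z * q ^ n‖ := by
  simp only [norm_mul, norm_pow]
  exact (summable_geometric_of_lt_one (norm_nonneg _) hq).mul_left _

lemma summable_norm_qPoch₂ {p q : ℂ} (hp : ‖p‖ < 1) (hq : ‖q‖ < 1) (z : ℂ) :
    Summable fun n : ℕ × ℕ => ‖z * p ^ n.1 * q ^ n.2‖ := by
  simp only [norm_mul, norm_pow, mul_assoc]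
  exact (summable_pow_mul_pow (norm_nonneg _) hp (norm_nonneg _) hq).mul_left _

lemma multipliable_one_sub {ι : Type*} {f : ι → ℂ} (hf : Summable fun i => ‖f i‖) :
    Multipliable fun i => 1 - f i := by
  simpa only [sub_eq_add_neg] using
    multipliable_one_add_of_summable (f := fun i => -f i) (by simpa using hf)

lemma tprod_one_sub_ne_zero {ι : Type*} {f : ι → ℂ} (hf : Summable fun i => ‖f i‖)
    (h : ∀ i, f i ≠ 1) : ∏' i, (1 - f i) ≠ 0 := by
  simpa only [sub_eq_add_neg] using tprod_one_add_ne_zero_of_summable (f := fun i => -f i)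
    (fun i => by rw [← sub_eq_add_neg, sub_ne_zero]; exact (h i).symm) (by simpa using hf)

lemma qPoch_ne_zero {z q : ℂ} (hq : ‖q‖ < 1) (h : ∀ n : ℕ, z * q ^ n ≠ 1) : qPoch z q ≠ 0 :=
  tprod_one_sub_ne_zero (summable_norm_qPoch hq z) h

lemma qPoch₂_ne_zero {z p q : ℂ} (hp : ‖p‖ < 1) (hq : ‖q‖ < 1)
    (h : ∀ j k : ℕ, z * p ^ j * q ^ k ≠ 1) : qPoch₂ z p q ≠ 0 :=
  tprod_one_sub_ne_zero (summable_norm_qPoch₂ hp hq z) fun n => h n.1 n.2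

lemma qPoch_eq {q : ℂ} (hq : ‖q‖ < 1) (z : ℂ) : qPoch z q = (1 - z) * qPoch (z * q) q := by
  have h : Multipliable fun n : ℕ => 1 - z * q ^ (n + 1) := by
    have := multipliable_one_sub (summable_norm_qPoch hq (z * q))
    refine this.congr fun n => by ring
  rw [qPoch, tprod_eq_zero_mul' (f := fun n : ℕ => 1 - z * q ^ n) h, qPoch]
  congr 1
  · simp
  · exact tprod_congr fun n => by ring

lemma qPoch₂_comm (z p q : ℂ) : qPoch₂ z p q = qPoch₂ z q p := by
  rw [qPoch₂, ← (Equiv.prodComm ℕ ℕ).tprod_eq]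
  exact tprod_congr fun n => by simp; ring

lemma qPoch₂_eq {p q : ℂ} (hp : ‖p‖ < 1) (hq : ‖q‖ < 1) (z : ℂ) :
    qPoch₂ z p q = qPoch z q * qPoch₂ (z * p) p q := by
  let e : ℕ ⊕ ℕ × ℕ ≃ ℕ × ℕ :=
    { toFun := Sum.elim (fun k => (0, k)) fun n => (n.1 + 1, n.2)
      invFun := fun n => match n with
        | (0, k) => Sum.inl k
        | (j + 1, k) => Sum.inr (j, k)
      left_inv := by rintro (k | ⟨j, k⟩) <;> rfl
      right_inv := by rintro ⟨_ | j, k⟩ <;> rfl }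
  rw [qPoch₂, ← e.tprod_eq]
  refine HasProd.tprod_eq (HasProd.sum ?_ ?_)
  · convert! (multipliable_one_sub (summable_norm_qPoch hq z)).hasProd using 1
    funext k; simp [e]
  · convert! (multipliable_one_sub (summable_norm_qPoch₂ hp hq (z * p))).hasProd using 1
    funext n
    simp only [e, Function.comp_apply, Equiv.coe_fn_mk, Sum.elim_inr]
    ring

/-- `qPoch` is jointly holomorphic. -/
lemma differentiableAt_qPoch {z q : ℂ} (hq : ‖q‖ < 1) :
    DifferentiableAt ℂ (fun y : ℂ × ℂ => qPoch y.1 y.2) (z, q) := by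
  obtain ⟨r, hr, hr'⟩ : ∃ r : ℝ, 0 < r ∧ ‖q‖ + r < 1 := ⟨(1 - ‖q‖) / 2, by linarith, by linarith⟩
  refine differentiableAt_tprod_one_sub (f := fun (n : ℕ) (y : ℂ × ℂ) => y.1 * y.2 ^ n) hr
    (u := fun n => (‖z‖ + r) * (‖q‖ + r) ^ n)
    ((summable_geometric_of_lt_one (by positivity) hr').mul_left _)
    (fun n => by fun_prop) fun n y hy => ?_
  rw [mem_closedBall_iff_norm] at hy
  have h1 : ‖y.1‖ ≤ ‖z‖ + r := by
    have := (norm_fst_le _).trans hy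
    calc ‖y.1‖ = ‖z + (y.1 - z)‖ := by congr 1; ring
      _ ≤ _ := (norm_add_le _ _).trans (by gcongr; exact this)
  have h2 : ‖y.2‖ ≤ ‖q‖ + r := by
    have := (norm_snd_le _).trans hy
    calc ‖y.2‖ = ‖q + (y.2 - q)‖ := by congr 1; ring
      _ ≤ _ := (norm_add_le _ _).trans (by gcongr; exact this)
  rw [norm_mul, norm_pow]
  gcongr

/-- `qPoch₂` is jointly holomorphic. -/
lemma differentiableAt_qPoch₂ {z p q : ℂ} (hp : ‖p‖ < 1) (hq : ‖q‖ < 1) :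
    DifferentiableAt ℂ (fun y : ℂ × ℂ × ℂ => qPoch₂ y.1 y.2.1 y.2.2) (z, p, q) := by
  obtain ⟨r, hr, hrp, hrq⟩ : ∃ r : ℝ, 0 < r ∧ ‖p‖ + r < 1 ∧ ‖q‖ + r < 1 := by
    refine ⟨min ((1 - ‖p‖) / 2) ((1 - ‖q‖) / 2), lt_min (by linarith) (by linarith), ?_, ?_⟩
    · have := min_le_left ((1 - ‖p‖) / 2) ((1 - ‖q‖) / 2); linarith
    · have := min_le_right ((1 - ‖p‖) / 2) ((1 - ‖q‖) / 2); linarith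
  refine differentiableAt_tprod_one_sub
    (f := fun (n : ℕ × ℕ) (y : ℂ × ℂ × ℂ) => y.1 * y.2.1 ^ n.1 * y.2.2 ^ n.2) hr
    (u := fun n => (‖z‖ + r) * ((‖p‖ + r) ^ n.1 * (‖q‖ + r) ^ n.2))
    ((summable_pow_mul_pow (by positivity) hrp (by positivity) hrq).mul_left _)
    (fun n => by fun_prop) fun n y hy => ?_
  rw [mem_closedBall_iff_norm] at hy
  have h1 : ‖y.1‖ ≤ ‖z‖ + r := by
    have := (norm_fst_le _).trans hy
    calc ‖y.1‖ = ‖z + (y.1 - z)‖ := by congr 1; ring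
      _ ≤ _ := (norm_add_le _ _).trans (by gcongr; exact this)
  have h2 : ‖y.2.1‖ ≤ ‖p‖ + r := by
    have := ((norm_fst_le _).trans (norm_snd_le _)).trans hy
    calc ‖y.2.1‖ = ‖p + (y.2.1 - p)‖ := by congr 1; ring
      _ ≤ _ := (norm_add_le _ _).trans (by gcongr; exact this)
  have h3 : ‖y.2.2‖ ≤ ‖q‖ + r := by
    have := ((norm_snd_le _).trans (norm_snd_le _)).trans hy
    calc ‖y.2.2‖ = ‖q + (y.2.2 - q)‖ := by congr 1; ring
      _ ≤ _ := (norm_add_le _ _).trans (by gcongr; exact this)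
  rw [norm_mul, norm_mul, norm_pow, norm_pow, mul_assoc]
  gcongr

lemma differentiableOn_qPoch {E : Type*} [NormedAddCommGroup E] [NormedSpace ℂ E] {U : Set E}
    {z q : E → ℂ} (hz : DifferentiableOn ℂ z U) (hq : DifferentiableOn ℂ q U)
    (h : ∀ y ∈ U, ‖q y‖ < 1) : DifferentiableOn ℂ (fun y => qPoch (z y) (q y)) U := fun y hy =>
  DifferentiableAt.comp_differentiableWithinAt (g := fun y : ℂ × ℂ => qPoch y.1 y.2) y
    (differentiableAt_qPoch (h y hy)) ((hz y hy).prodMk (hq y hy))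

lemma differentiableOn_qPoch₂ {E : Type*} [NormedAddCommGroup E] [NormedSpace ℂ E] {U : Set E}
    {z p q : E → ℂ} (hz : DifferentiableOn ℂ z U) (hp : DifferentiableOn ℂ p U)
    (hq : DifferentiableOn ℂ q U) (h : ∀ y ∈ U, ‖p y‖ < 1) (h' : ∀ y ∈ U, ‖q y‖ < 1) :
    DifferentiableOn ℂ (fun y => qPoch₂ (z y) (p y) (q y)) U := fun y hy =>
  DifferentiableAt.comp_differentiableWithinAt (g := fun y : ℂ × ℂ × ℂ => qPoch₂ y.1 y.2.1 y.2.2) y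
    (differentiableAt_qPoch₂ (h y hy) (h' y hy)) ((hz y hy).prodMk ((hp y hy).prodMk (hq y hy)))

/-! ### Entire functions with the same quasi-periods -/

lemma neBot_nhdsWithin_compl {Z : Set ℂ} (hZ : Z.Countable) (u : ℂ) : (nhdsWithin u Zᶜ).NeBot :=
  mem_closure_iff_nhdsWithin_neBot.1 (hZ.dense_compl (𝕜 := ℂ) u)

/-- Continuity at `u`: the values off a countable set determine the value at `u`. -/
lemma eq_of_eventually_notMem_countable {f g : ℂ → ℂ} {u : ℂ} {Z : Set ℂ} (hZ : Z.Countable)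
    (hf : ContinuousAt f u) (hg : ContinuousAt g u) (h : ∀ᶠ v in nhds u, v ∉ Z → f v = g v) :
    f u = g u := by
  have : (nhdsWithin u Zᶜ).NeBot := neBot_nhdsWithin_compl hZ u
  have hle : nhdsWithin u Zᶜ ≤ nhds u := nhdsWithin_le_nhds
  refine tendsto_nhds_unique (hf.tendsto.mono_left hle) ((hg.tendsto.mono_left hle).congr' ?_)
  filter_upwards [h.filter_mono hle, self_mem_nhdsWithin] with v hv hv'
  exact (hv hv').symm

lemma exists_real_coord {ω₁ ω₂ : ℂ} (hω : 0 < (ω₁ * conj ω₂).im) (w : ℂ) :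
    ∃ a b : ℝ, w = a * ω₁ + b * ω₂ := by
  refine ⟨(w * conj ω₂).im / (ω₁ * conj ω₂).im, (ω₁ * conj w).im / (ω₁ * conj ω₂).im, ?_⟩
  have h : ((ω₁ * conj ω₂).im : ℂ) ≠ 0 := by exact_mod_cast hω.ne'
  have key : w * ((ω₁ * conj ω₂).im : ℂ) =
      ((w * conj ω₂).im : ℂ) * ω₁ + ((ω₁ * conj w).im : ℂ) * ω₂ := by
    apply Complex.ext <;> simp <;> ring
  rw [Complex.ofReal_div, Complex.ofReal_div, div_mul_eq_mul_div, div_mul_eq_mul_div, ← add_div,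
    eq_div_iff h, key]

/-- Two entire functions with the same multipliers under the translations by a lattice are
proportional, provided that their quotient extends holomorphically to an open set which contains
a fundamental domain of the lattice. -/
lemma exists_eq_const_mul_of_quasiperiods {ω₁ ω₂ : ℂ} (hω : 0 < (ω₁ * conj ω₂).im) {U : Set ℂ}
    (hU : IsOpen U)
    (hcov : ∀ s t : ℝ, 0 ≤ s → s < 1 → 0 ≤ t → t < 1 → (s * ω₁ + t * ω₂ : ℂ) ∈ U)
    {f g h : ℂ → ℂ} (hf : Differentiable ℂ f) (hg : Differentiable ℂ g)
    (hh : DifferentiableOn ℂ h U) (hfg : ∀ w ∈ U, f w = h w * g w)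
    (hg0 : {w | g w = 0}.Countable)
    (h1 : ∀ w, f (w + ω₁) * g w = f w * g (w + ω₁))
    (h2 : ∀ w, f (w + ω₂) * g w = f w * g (w + ω₂)) : ∃ C, ∀ w, f w = C * g w := by
  -- the countable set of points with some lattice translate at which `g` vanishes
  set Z : Set ℂ := ⋃ k : ℤ × ℤ, (fun w => w + (k.1 * ω₁ + k.2 * ω₂)) ⁻¹' {w | g w = 0} with hZ
  have hZc : Z.Countable := Set.countable_iUnion fun k => hg0.preimage (add_left_injective _)
  have hZg : ∀ v ∉ Z, ∀ m n : ℤ, g (v + (m * ω₁ + n * ω₂)) ≠ 0 := fun v hv m n hv' =>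
    hv (Set.mem_iUnion.2 ⟨(m, n), hv'⟩)
  have hper1 : ∀ v ∉ Z, ∀ m n : ℤ,
      f (v + (m * ω₁ + n * ω₂)) / g (v + (m * ω₁ + n * ω₂)) =
        f (v + (n * ω₂)) / g (v + (n * ω₂)) := by
    intro v hv m n
    induction m using Int.induction_on with
    | zero => simp
    | succ i ih =>
      rw [← ih, div_eq_div_iff (hZg v hv _ _) (hZg v hv _ _)]
      have := h1 (v + ((i : ℤ) * ω₁ + n * ω₂))
      convert! this using 3 <;> push_cast <;> ring
    | pred i ih =>
      rw [← ih, eq_comm, div_eq_div_iff (hZg v hv _ _) (hZg v hv _ _)]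
      have := h1 (v + ((-(i : ℤ) - 1 : ℤ) * ω₁ + n * ω₂))
      convert! this using 3 <;> push_cast <;> ring
  have hper2 : ∀ v ∉ Z, ∀ n : ℤ, f (v + (n * ω₂)) / g (v + (n * ω₂)) = f v / g v := by
    intro v hv n
    have hZg' : ∀ n : ℤ, g (v + n * ω₂) ≠ 0 := fun n => by simpa using hZg v hv 0 n
    induction n using Int.induction_on with
    | zero => simp
    | succ i ih =>
      rw [← ih, div_eq_div_iff (hZg' _) (hZg' _)]
      have := h2 (v + (i : ℤ) * ω₂)
      convert! this using 3 <;> push_cast <;> ring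
    | pred i ih =>
      rw [← ih, eq_comm, div_eq_div_iff (hZg' _) (hZg' _)]
      have := h2 (v + (-(i : ℤ) - 1 : ℤ) * ω₂)
      convert! this using 3 <;> push_cast <;> ring
  have hval : ∀ v ∉ Z, v ∈ U → h v = f v / g v := fun v hv hvU => by
    have : g v ≠ 0 := by simpa using hZg v hv 0 0
    rw [hfg v hvU, mul_div_cancel_right₀ _ this]
  have hinv : ∀ u ∈ U, ∀ m n : ℤ, u + (m * ω₁ + n * ω₂) ∈ U → h u = h (u + (m * ω₁ + n * ω₂)) := by
    intro u hu m n hu'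
    have hcont : ContinuousAt (fun v : ℂ => v + (m * ω₁ + n * ω₂)) u := by fun_prop
    refine eq_of_eventually_notMem_countable hZc (hh.differentiableAt (hU.mem_nhds hu)).continuousAt
      (ContinuousAt.comp (f := fun v : ℂ => v + (m * ω₁ + n * ω₂))
        (hh.differentiableAt (hU.mem_nhds hu')).continuousAt hcont) ?_
    filter_upwards [hU.mem_nhds hu, hcont.preimage_mem_nhds (hU.mem_nhds hu')] with v hv hv' hvZ
    have hvZ' : v + (m * ω₁ + n * ω₂) ∉ Z := fun hmem => by
      obtain ⟨k, hk⟩ := Set.mem_iUnion.1 hmem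
      refine hZg v hvZ (m + k.1) (n + k.2) ?_
      have hk' : g (v + (m * ω₁ + n * ω₂) + (k.1 * ω₁ + k.2 * ω₂)) = 0 := hk
      rw [← hk']
      congr 1; push_cast; ring
    simp only [Function.comp_apply]
    rw [hval v hvZ hv, hval _ hvZ' hv', hper1 v hvZ, hper2 v hvZ]
  have hred : ∀ w : ℂ, ∃ k : ℤ × ℤ, ∃ s t : ℝ, 0 ≤ s ∧ s < 1 ∧ 0 ≤ t ∧ t < 1 ∧
      w + (k.1 * ω₁ + k.2 * ω₂) = s * ω₁ + t * ω₂ := by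
    intro w
    obtain ⟨a, b, rfl⟩ := exists_real_coord hω w
    refine ⟨(-⌊a⌋, -⌊b⌋), Int.fract a, Int.fract b, Int.fract_nonneg _, Int.fract_lt_one _,
      Int.fract_nonneg _, Int.fract_lt_one _, ?_⟩
    simp only [Int.fract]
    push_cast; ring
  choose k s t hs0 hs1 ht0 ht1 hk using hred
  have hkU : ∀ w, w + ((k w).1 * ω₁ + (k w).2 * ω₂) ∈ U := fun w => by
    rw [hk]; exact hcov _ _ (hs0 w) (hs1 w) (ht0 w) (ht1 w)
  set G : ℂ → ℂ := fun w => h (w + ((k w).1 * ω₁ + (k w).2 * ω₂)) with hG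
  have hGeq : ∀ (w : ℂ) (m n : ℤ), w + (m * ω₁ + n * ω₂) ∈ U → G w = h (w + (m * ω₁ + n * ω₂)) := by
    intro w m n hw
    have e : w + (m * ω₁ + n * ω₂) = w + ((k w).1 * ω₁ + (k w).2 * ω₂) +
        ((m - (k w).1 : ℤ) * ω₁ + (n - (k w).2 : ℤ) * ω₂) := by push_cast; ring
    rw [e] at hw ⊢
    exact hinv _ (hkU w) _ _ hw
  have hGd : Differentiable ℂ G := by
    intro w
    have hd : DifferentiableAt ℂ (fun v => h (v + ((k w).1 * ω₁ + (k w).2 * ω₂))) w :=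
      DifferentiableAt.comp w (hh.differentiableAt (hU.mem_nhds (hkU w)))
        (by fun_prop : DifferentiableAt ℂ (fun v : ℂ => v + ((k w).1 * ω₁ + (k w).2 * ω₂)) w)
    refine hd.congr_of_eventuallyEq ?_
    have hcont : ContinuousAt (fun v : ℂ => v + ((k w).1 * ω₁ + (k w).2 * ω₂)) w := by fun_prop
    filter_upwards [hcont.preimage_mem_nhds (hU.mem_nhds (hkU w))] with v hv
    exact hGeq v _ _ hv
  have hbdd : Bornology.IsBounded (Set.range G) := by
    have hK : IsCompact ((fun p : ℝ × ℝ => (p.1 * ω₁ + p.2 * ω₂ : ℂ)) ''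
        (Set.Icc 0 1 ×ˢ Set.Icc 0 1)) := (isCompact_Icc.prod isCompact_Icc).image (by fun_prop)
    refine (hK.image hGd.continuous).isBounded.subset ?_
    rintro _ ⟨w, rfl⟩
    refine ⟨_, ⟨(s w, t w), ⟨⟨hs0 w, (hs1 w).le⟩, ⟨ht0 w, (ht1 w).le⟩⟩, rfl⟩, ?_⟩
    have e : (s w * ω₁ + t w * ω₂ : ℂ) = w + ((k w).1 * ω₁ + (k w).2 * ω₂) := (hk w).symm
    simp only [e]
    rw [hGeq (w + ((k w).1 * ω₁ + (k w).2 * ω₂)) 0 0 (by simpa using hkU w)]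
    simp [hG]
  have hconst : ∀ w, G w = G 0 := fun w => hGd.apply_eq_apply_of_bounded hbdd w 0
  refine ⟨G 0, fun w => ?_⟩
  have h0U : (0 : ℂ) ∈ U := by simpa using hcov 0 0 le_rfl one_pos le_rfl one_pos
  have heq : f = fun w => G 0 * g w := by
    refine AnalyticOnNhd.eq_of_eventuallyEq (z₀ := 0)
      (hf.differentiableOn.analyticOnNhd isOpen_univ)
      ((hg.const_mul _).differentiableOn.analyticOnNhd isOpen_univ) ?_
    filter_upwards [hU.mem_nhds h0U] with v hv
    rw [hfg v hv, ← hconst v, hGeq v 0 0 (by simpa using hv)]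
    simp
  exact congrFun heq w

/-! ### The theta function and its modular transformation -/

/-- The function `z ↦ e^{2πiz}`. -/
noncomputable def expTwoPi (z : ℂ) : ℂ := Complex.exp (2 * Real.pi * Complex.I * z)

lemma expTwoPi_add (z w : ℂ) : expTwoPi (z + w) = expTwoPi z * expTwoPi w := by
  rw [expTwoPi, mul_add, Complex.exp_add]; rfl

lemma expTwoPi_neg (z : ℂ) : expTwoPi (-z) = (expTwoPi z)⁻¹ := by
  rw [expTwoPi, mul_neg, Complex.exp_neg]; rfl

lemma expTwoPi_sub (z w : ℂ) : expTwoPi (z - w) = expTwoPi z / expTwoPi w := by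
  rw [sub_eq_add_neg, expTwoPi_add, expTwoPi_neg, div_eq_mul_inv]

lemma expTwoPi_zero : expTwoPi 0 = 1 := by simp [expTwoPi]

lemma expTwoPi_ne_zero (z : ℂ) : expTwoPi z ≠ 0 := Complex.exp_ne_zero _

lemma expTwoPi_natCast_mul (n : ℕ) (z : ℂ) : expTwoPi (n * z) = expTwoPi z ^ n := by
  rw [expTwoPi, expTwoPi, ← Complex.exp_nat_mul]; congr 1; ring

lemma expTwoPi_eq_one_iff {z : ℂ} : expTwoPi z = 1 ↔ ∃ n : ℤ, z = n := by
  rw [expTwoPi, Complex.exp_eq_one_iff]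
  refine exists_congr fun n => ?_
  rw [mul_comm, mul_left_inj' Complex.two_pi_I_ne_zero]

lemma expTwoPi_int (n : ℤ) : expTwoPi n = 1 := expTwoPi_eq_one_iff.2 ⟨n, rfl⟩

lemma expTwoPi_one : expTwoPi 1 = 1 := by simpa using expTwoPi_int 1

lemma expTwoPi_half : expTwoPi (1 / 2) = -1 := by
  rw [expTwoPi, ← Complex.exp_pi_mul_I]; congr 1; ring

lemma norm_expTwoPi_lt_one {z : ℂ} (hz : 0 < z.im) : ‖expTwoPi z‖ < 1 := by
  rw [expTwoPi, Complex.norm_exp, Real.exp_lt_one_iff]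
  have : (2 * Real.pi * Complex.I * z).re = -(2 * Real.pi * z.im) := by simp
  rw [this]
  have := mul_pos Real.two_pi_pos hz
  linarith

lemma differentiable_expTwoPi : Differentiable ℂ expTwoPi := by
  unfold expTwoPi; fun_prop

lemma thetaFactor_eq (z τ : ℂ) (j : ℕ) : thetaFactor z τ j =
    (1 - expTwoPi (τ - z) * expTwoPi τ ^ j) * (1 - expTwoPi z * expTwoPi τ ^ j) := by
  rw [← expTwoPi_natCast_mul, ← expTwoPi_add, ← expTwoPi_add, thetaFactor]
  simp only [expTwoPi]
  congr 4 <;> ring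

lemma multipliable_thetaFactor {τ : ℂ} (hτ : 0 < τ.im) (z : ℂ) :
    Multipliable (thetaFactor z τ) := by
  have hq := norm_expTwoPi_lt_one hτ
  refine ((multipliable_one_sub (summable_norm_qPoch hq (expTwoPi (τ - z)))).mul
    (multipliable_one_sub (summable_norm_qPoch hq (expTwoPi z)))).congr fun j => ?_
  rw [thetaFactor_eq]

lemma theta0_eq {τ : ℂ} (hτ : 0 < τ.im) (z : ℂ) :
    theta0 z τ = qPoch (expTwoPi (τ - z)) (expTwoPi τ) * qPoch (expTwoPi z) (expTwoPi τ) := by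
  have hq := norm_expTwoPi_lt_one hτ
  rw [theta0, qPoch, qPoch, ← Multipliable.tprod_mul
    (multipliable_one_sub (summable_norm_qPoch hq _))
    (multipliable_one_sub (summable_norm_qPoch hq _))]
  exact tprod_congr fun j => thetaFactor_eq z τ j

lemma differentiableOn_theta0 {E : Type*} [NormedAddCommGroup E] [NormedSpace ℂ E] {U : Set E}
    {z τ : E → ℂ} (hz : DifferentiableOn ℂ z U) (hτ : DifferentiableOn ℂ τ U)
    (h : ∀ y ∈ U, 0 < (τ y).im) : DifferentiableOn ℂ (fun y => theta0 (z y) (τ y)) U := by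
  have he : ∀ {f : E → ℂ}, DifferentiableOn ℂ f U →
      DifferentiableOn ℂ (fun y => expTwoPi (f y)) U := fun hf =>
    differentiable_expTwoPi.comp_differentiableOn hf
  refine DifferentiableOn.congr (f := fun y =>
    qPoch (expTwoPi (τ y - z y)) (expTwoPi (τ y)) * qPoch (expTwoPi (z y)) (expTwoPi (τ y))) ?_
    fun y hy => theta0_eq (h y hy) _
  have hq : ∀ y ∈ U, ‖expTwoPi (τ y)‖ < 1 := fun y hy => norm_expTwoPi_lt_one (h y hy)
  exact (differentiableOn_qPoch (he (hτ.sub hz)) (he hτ) hq).mul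
    (differentiableOn_qPoch (he hz) (he hτ) hq)

lemma differentiable_theta0 {τ : ℂ} (hτ : 0 < τ.im) : Differentiable ℂ fun z => theta0 z τ := by
  rw [← differentiableOn_univ]
  exact differentiableOn_theta0 differentiableOn_id (differentiableOn_const τ) fun _ _ => hτ

lemma theta0_add_int (z τ : ℂ) (n : ℤ) : theta0 (z + n) τ = theta0 z τ := by
  refine tprod_congr fun j => ?_
  rw [thetaFactor_eq, thetaFactor_eq, ← sub_sub, expTwoPi_sub (τ - z), expTwoPi_add z,
    expTwoPi_int, div_one, mul_one]

lemma theta0_add_one (z τ : ℂ) : theta0 (z + 1) τ = theta0 z τ := by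
  simpa using theta0_add_int z τ 1

lemma theta0_add_tau {τ : ℂ} (hτ : 0 < τ.im) (z : ℂ) :
    theta0 (z + τ) τ = -expTwoPi (-z) * theta0 z τ := by
  have hq := norm_expTwoPi_lt_one hτ
  rw [theta0_eq hτ, theta0_eq hτ, qPoch_eq hq (expTwoPi z), sub_add_cancel_right,
    qPoch_eq hq (expTwoPi (-z)), ← expTwoPi_add, ← expTwoPi_add, neg_add_eq_sub,
    expTwoPi_neg]
  have := expTwoPi_ne_zero z
  field_simp
  ring

/-- Splitting the factor of `θ₀` that vanishes at `0`. -/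
lemma theta0_eq_one_sub_mul {τ : ℂ} (hτ : 0 < τ.im) (z : ℂ) :
    theta0 z τ = (1 - expTwoPi z) *
      (qPoch (expTwoPi (τ - z)) (expTwoPi τ) * qPoch (expTwoPi (z + τ)) (expTwoPi τ)) := by
  rw [theta0_eq hτ, qPoch_eq (norm_expTwoPi_lt_one hτ) (expTwoPi z), expTwoPi_add]
  ring

lemma qPoch_expTwoPi_ne_zero {z τ : ℂ} (hτ : 0 < τ.im)
    (h : ∀ (j : ℕ) (n : ℤ), z + j * τ ≠ n) : qPoch (expTwoPi z) (expTwoPi τ) ≠ 0 := by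
  refine qPoch_ne_zero (norm_expTwoPi_lt_one hτ) fun j hj => ?_
  rw [← expTwoPi_natCast_mul, ← expTwoPi_add, expTwoPi_eq_one_iff] at hj
  obtain ⟨n, hn⟩ := hj
  exact h j n hn

lemma theta0_ne_zero {z τ : ℂ} (hτ : 0 < τ.im) (h : ∀ m n : ℤ, z ≠ m * τ + n) :
    theta0 z τ ≠ 0 := by
  rw [theta0_eq hτ]
  refine mul_ne_zero (qPoch_expTwoPi_ne_zero hτ fun j n hn => h (j + 1) (-n) ?_)
    (qPoch_expTwoPi_ne_zero hτ fun j n hn => h (-j) n ?_)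
  · push_cast; linear_combination -hn
  · push_cast; linear_combination hn

lemma countable_theta0_zeros {τ : ℂ} (hτ : 0 < τ.im) : {z | theta0 z τ = 0}.Countable := by
  refine (Set.countable_range fun k : ℤ × ℤ => (k.1 * τ + k.2 : ℂ)).mono fun z hz => ?_
  by_contra hcon
  exact theta0_ne_zero hτ (fun m n h => hcon ⟨(m, n), h.symm⟩) hz

/-- The Bernoulli polynomial `B_{2,2}(w | ω₁, ω₂)`. -/
noncomputable def bernoulli₂ (w ω₁ ω₂ : ℂ) : ℂ :=
  (w ^ 2 - (ω₁ + ω₂) * w + (ω₁ ^ 2 + ω₂ ^ 2 + 3 * ω₁ * ω₂) / 6) / (ω₁ * ω₂)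

/-- Euler's identity `∏ (1 + qⁿ)(1 - q^{2n-1}) = 1`, with `q = h²`. -/
lemma qPoch_euler {h : ℂ} (hh : ‖h‖ < 1) :
    qPoch (-h ^ 2) (h ^ 2) * (qPoch h (h ^ 2) * qPoch (-h) (h ^ 2)) = 1 := by
  have hq : ‖h ^ 2‖ < 1 := by rw [norm_pow]; exact pow_lt_one₀ (norm_nonneg _) hh two_ne_zero
  have hqq : ‖h ^ 4‖ < 1 := by rw [norm_pow]; exact pow_lt_one₀ (norm_nonneg _) hh (by norm_num)
  have hm : ∀ (q z : ℂ), ‖q‖ < 1 → Multipliable fun n : ℕ => 1 - z * q ^ n := fun q z hq' =>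
    multipliable_one_sub (summable_norm_qPoch hq' z)
  have e1 : qPoch h (h ^ 2) * qPoch (-h) (h ^ 2) = qPoch (h ^ 2) (h ^ 4) := by
    rw [qPoch, qPoch, ← Multipliable.tprod_mul (hm _ _ hq) (hm _ _ hq)]
    exact tprod_congr fun n => by ring
  have e2 : qPoch (-h ^ 2) (h ^ 2) * qPoch (h ^ 2) (h ^ 2) = qPoch (h ^ 4) (h ^ 4) := by
    rw [qPoch, qPoch, ← Multipliable.tprod_mul (hm _ _ hq) (hm _ _ hq)]
    exact tprod_congr fun n => by ring
  have e3 : qPoch (h ^ 2) (h ^ 4) * qPoch (h ^ 4) (h ^ 4) = qPoch (h ^ 2) (h ^ 2) := by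
    have ho := (hm (h ^ 4) (h ^ 4) hqq)
    have he := (hm (h ^ 4) (h ^ 2) hqq)
    rw [qPoch, qPoch, qPoch, ← tprod_even_mul_odd (f := fun n : ℕ => 1 - h ^ 2 * (h ^ 2) ^ n)]
    · congr 1 <;> exact tprod_congr fun n => by ring
    · exact he.congr fun n => by ring
    · exact ho.congr fun n => by ring
  have h0 : qPoch (h ^ 2) (h ^ 2) ≠ 0 := by
    refine qPoch_ne_zero hq fun n hn => ?_
    have : ‖h ^ 2 * (h ^ 2) ^ n‖ < 1 := by
      rw [← pow_succ', norm_pow]; exact pow_lt_one₀ (norm_nonneg _) hq (by simp)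
    rw [hn] at this
    simp at this
  refine mul_right_cancel₀ h0 ?_
  calc _ = qPoch h (h ^ 2) * qPoch (-h) (h ^ 2) *
        (qPoch (-h ^ 2) (h ^ 2) * qPoch (h ^ 2) (h ^ 2)) := by ring
    _ = _ := by rw [e1, e2, e3, one_mul]

/-- The product of the three half-period values of `θ₀`. -/
lemma theta0_half_periods {τ : ℂ} (hτ : 0 < τ.im) :
    theta0 (1 / 2) τ * theta0 (τ / 2) τ * theta0 ((1 + τ) / 2) τ = 2 := by
  have hq := norm_expTwoPi_lt_one hτ
  have hh : ‖expTwoPi (τ / 2)‖ < 1 := norm_expTwoPi_lt_one (by simpa using hτ)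
  have hsq : expTwoPi τ = expTwoPi (τ / 2) ^ 2 := by
    rw [← expTwoPi_natCast_mul]; congr 1; push_cast; ring
  have e1 : expTwoPi (τ - 1 / 2) = -expTwoPi τ := by
    rw [expTwoPi_sub, expTwoPi_half]; ring
  have e2 : expTwoPi ((1 + τ) / 2) = -expTwoPi (τ / 2) := by
    rw [add_div, expTwoPi_add, expTwoPi_half]; ring
  have e3 : expTwoPi (τ - (1 + τ) / 2) = -expTwoPi (τ / 2) := by
    rw [show τ - (1 + τ) / 2 = τ / 2 - 1 / 2 by ring, expTwoPi_sub, expTwoPi_half]; ring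
  have e4 : τ - τ / 2 = τ / 2 := by ring
  rw [theta0_eq hτ, theta0_eq hτ, theta0_eq hτ, e1, e2, e3, e4, expTwoPi_half,
    qPoch_eq hq (-1), neg_one_mul, hsq]
  linear_combination 2 * (qPoch (-expTwoPi (τ / 2) ^ 2) (expTwoPi (τ / 2) ^ 2) *
    (qPoch (expTwoPi (τ / 2)) (expTwoPi (τ / 2) ^ 2) *
      qPoch (-expTwoPi (τ / 2)) (expTwoPi (τ / 2) ^ 2)) + 1) * qPoch_euler hh

lemma im_neg_one_div_pos {τ : ℂ} (hτ : 0 < τ.im) : 0 < (-1 / τ).im := by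
  have h0 : τ ≠ 0 := by rintro rfl; simp at hτ
  rw [neg_div, one_div, Complex.neg_im, Complex.inv_im]
  have := Complex.normSq_pos.2 h0
  rw [neg_div, neg_neg]; positivity

/-- The open parallelogram spanned by the periods `τ`, `1` and their opposites. -/
def openParallelogram (τ : ℂ) : Set ℂ :=
  {w | |w.im| < τ.im ∧ |w.re * τ.im - w.im * τ.re| < τ.im}

lemma isOpen_openParallelogram (τ : ℂ) : IsOpen (openParallelogram τ) :=
  IsOpen.inter (s := {w : ℂ | |w.im| < τ.im})
    (t := {w : ℂ | |w.re * τ.im - w.im * τ.re| < τ.im})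
    (isOpen_lt (by fun_prop) (by fun_prop)) (isOpen_lt (by fun_prop) (by fun_prop))

lemma mem_openParallelogram_iff {τ : ℂ} (hτ : 0 < τ.im) (s t : ℝ) :
    (s * τ + t : ℂ) ∈ openParallelogram τ ↔ |s| < 1 ∧ |t| < 1 := by
  have e1 : (s * τ + t : ℂ).im = s * τ.im := by simp
  have e2 : (s * τ + t : ℂ).re * τ.im - (s * τ + t : ℂ).im * τ.re = t * τ.im := by simp; ring
  rw [openParallelogram, Set.mem_ofPred_eq, e2, e1, abs_mul, abs_mul, abs_of_pos hτ,
    mul_lt_iff_lt_one_left hτ, mul_lt_iff_lt_one_left hτ]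

/-- The quotient of `1 - e^{2πiz}` by `z`. -/
noncomputable def oneSubExpDiv : ℂ → ℂ := dslope (fun z => 1 - expTwoPi z) 0

lemma mul_oneSubExpDiv (z : ℂ) : z * oneSubExpDiv z = 1 - expTwoPi z := by
  have := sub_smul_dslope (fun z => 1 - expTwoPi z) 0 z
  simpa [expTwoPi_zero, oneSubExpDiv] using this

lemma differentiable_oneSubExpDiv : Differentiable ℂ oneSubExpDiv := by
  rw [← differentiableOn_univ]
  exact (Complex.differentiableOn_dslope univ_mem).2
    ((differentiable_const 1).sub differentiable_expTwoPi).differentiableOn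

lemma oneSubExpDiv_ne_zero {z : ℂ} (h : ∀ n : ℤ, z = n → n = 0) : oneSubExpDiv z ≠ 0 := by
  rcases eq_or_ne z 0 with rfl | hz
  · have h1 : HasDerivAt (fun z => 1 - expTwoPi z) (-(2 * Real.pi * Complex.I)) 0 := by
      have h2 : HasDerivAt (fun z : ℂ => 2 * Real.pi * Complex.I * z) (2 * Real.pi * Complex.I) 0 := by
        simpa using (hasDerivAt_id (0 : ℂ)).const_mul (2 * Real.pi * Complex.I)
      simpa [expTwoPi] using h2.cexp.const_sub 1
    rw [oneSubExpDiv, dslope_same, h1.deriv]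
    exact neg_ne_zero.2 Complex.two_pi_I_ne_zero
  · intro h0
    have := mul_oneSubExpDiv z
    rw [h0, mul_zero, eq_comm, sub_eq_zero, eq_comm, expTwoPi_eq_one_iff] at this
    obtain ⟨n, hn⟩ := this
    exact hz (by rw [hn, h n hn]; simp)

/-- The two sides of the modular transformation of `θ₀` are proportional: they are entire functions
of `w` with the same quasi-periods and the same zeros. -/
lemma exists_theta0_modular_const {τ : ℂ} (hτ : 0 < τ.im) :
    ∃ C, ∀ w, theta0 (-w / τ) (-1 / τ) =
      C * (theta0 w τ * Complex.exp (Real.pi * Complex.I * bernoulli₂ w τ 1)) := by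
  have hτ' := im_neg_one_div_pos hτ
  have h0 : τ ≠ 0 := by rintro rfl; simp at hτ
  have hB : Differentiable ℂ fun w => bernoulli₂ w τ 1 := by unfold bernoulli₂; fun_prop
  have hE : Differentiable ℂ fun w => Complex.exp (Real.pi * Complex.I * bernoulli₂ w τ 1) :=
    (hB.const_mul _).cexp
  have hf : Differentiable ℂ fun w => theta0 (-w / τ) (-1 / τ) :=
    (differentiable_theta0 hτ').comp (by fun_prop : Differentiable ℂ fun w : ℂ => -w / τ)
  have hg : Differentiable ℂ fun w =>
      theta0 w τ * Complex.exp (Real.pi * Complex.I * bernoulli₂ w τ 1) :=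
    (differentiable_theta0 hτ).mul hE
  -- the two quotients of `θ₀` by its factor that vanishes at the origin
  set r₁ : ℂ → ℂ := fun w =>
    qPoch (expTwoPi (τ - w)) (expTwoPi τ) * qPoch (expTwoPi (w + τ)) (expTwoPi τ) with hr₁
  set r₂ : ℂ → ℂ := fun w =>
    qPoch (expTwoPi (-1 / τ - -w / τ)) (expTwoPi (-1 / τ)) *
      qPoch (expTwoPi (-w / τ + -1 / τ)) (expTwoPi (-1 / τ)) with hr₂
  have hq : ∀ {σ : ℂ} {z : ℂ → ℂ}, 0 < σ.im → Differentiable ℂ z →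
      Differentiable ℂ fun w => qPoch (expTwoPi (z w)) (expTwoPi σ) := by
    intro σ z hσ hz
    rw [← differentiableOn_univ]
    exact differentiableOn_qPoch (differentiable_expTwoPi.comp hz).differentiableOn
      (differentiableOn_const _) fun _ _ => norm_expTwoPi_lt_one hσ
  have hr₁d : Differentiable ℂ r₁ := (hq hτ (by fun_prop)).mul (hq hτ (by fun_prop))
  have hr₂d : Differentiable ℂ r₂ := (hq hτ' (by fun_prop)).mul (hq hτ' (by fun_prop))
  have hσ₂ : Differentiable ℂ fun w : ℂ => oneSubExpDiv (-w / τ) :=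
    differentiable_oneSubExpDiv.comp (by fun_prop : Differentiable ℂ fun w : ℂ => -w / τ)
  have hmem : ∀ {w : ℂ}, w ∈ openParallelogram τ → ∀ m n : ℤ, w = m * τ + n → m = 0 ∧ n = 0 := by
    intro w hw m n hmn
    have e : w = ((m : ℝ) : ℂ) * τ + ((n : ℝ) : ℂ) := by rw [hmn]; push_cast; ring
    rw [e, mem_openParallelogram_iff hτ] at hw
    exact ⟨Int.abs_lt_one_iff.1 (by exact_mod_cast hw.1),
      Int.abs_lt_one_iff.1 (by exact_mod_cast hw.2)⟩
  have hr₁0 : ∀ w ∈ openParallelogram τ, r₁ w ≠ 0 := fun w hw =>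
    mul_ne_zero
      (qPoch_expTwoPi_ne_zero hτ fun j n hn => by
        have := (hmem hw (j + 1) (-n) (by push_cast; linear_combination -hn)).1; omega)
      (qPoch_expTwoPi_ne_zero hτ fun j n hn => by
        have := (hmem hw (-(j + 1)) n (by push_cast; linear_combination hn)).1; omega)
  have hσ₁0 : ∀ w ∈ openParallelogram τ, oneSubExpDiv w ≠ 0 := fun w hw =>
    oneSubExpDiv_ne_zero fun n hn => (hmem hw 0 n (by simpa using hn)).2
  refine exists_eq_const_mul_of_quasiperiods (ω₁ := τ) (ω₂ := 1) (by simpa using hτ)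
    (isOpen_openParallelogram τ) ?_ hf hg
    (h := fun w => -1 / τ * oneSubExpDiv (-w / τ) * r₂ w / (oneSubExpDiv w * (r₁ w *
      Complex.exp (Real.pi * Complex.I * bernoulli₂ w τ 1)))) ?_ ?_ ?_ ?_ ?_
  · intro s t hs0 hs1 ht0 ht1
    rw [mul_one, mem_openParallelogram_iff hτ, abs_of_nonneg hs0, abs_of_nonneg ht0]
    exact ⟨hs1, ht1⟩
  · refine (((hσ₂.const_mul _).mul hr₂d).differentiableOn).div
      ((differentiable_oneSubExpDiv.mul (hr₁d.mul hE)).differentiableOn) fun w hw => ?_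
    exact mul_ne_zero (hσ₁0 w hw) (mul_ne_zero (hr₁0 w hw) (Complex.exp_ne_zero _))
  · intro w hw
    have h1 := hσ₁0 w hw
    have h2 := hr₁0 w hw
    have h3 := Complex.exp_ne_zero (Real.pi * Complex.I * bernoulli₂ w τ 1)
    change theta0 (-w / τ) (-1 / τ) = _
    rw [theta0_eq_one_sub_mul hτ', theta0_eq_one_sub_mul hτ, ← mul_oneSubExpDiv,
      ← mul_oneSubExpDiv]
    change _ * _ * r₂ w = _ * (_ * _ * r₁ w * _)
    field_simp
  · refine (countable_theta0_zeros hτ).mono fun w hw => ?_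
    exact (mul_eq_zero.1 hw).resolve_right (Complex.exp_ne_zero _)
  · -- translation by `τ`: both functions are periodic
    intro w
    have e1 : -(w + τ) / τ = -w / τ + (-1 : ℤ) := by push_cast; field_simp; ring
    have e2 : Complex.exp (Real.pi * Complex.I * bernoulli₂ (w + τ) τ 1) =
        -expTwoPi w * Complex.exp (Real.pi * Complex.I * bernoulli₂ w τ 1) := by
      have : (-1 : ℂ) = Complex.exp (-(Real.pi * Complex.I)) := by
        rw [Complex.exp_neg, Complex.exp_pi_mul_I]; norm_num
      rw [neg_eq_neg_one_mul, this, expTwoPi, ← Complex.exp_add, ← Complex.exp_add]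
      congr 1
      unfold bernoulli₂
      field_simp
      ring
    simp only [e1, theta0_add_int, theta0_add_tau hτ, e2, expTwoPi_neg]
    have := expTwoPi_ne_zero w
    field_simp
  · -- translation by `1`: both functions have the same multiplier
    intro w
    have e1 : -(w + 1) / τ = -w / τ + -1 / τ := by ring
    have e2 : Complex.exp (Real.pi * Complex.I * bernoulli₂ (w + 1) τ 1) =
        -expTwoPi (-(-w / τ)) * Complex.exp (Real.pi * Complex.I * bernoulli₂ w τ 1) := by
      have : (-1 : ℂ) = Complex.exp (-(Real.pi * Complex.I)) := by
        rw [Complex.exp_neg, Complex.exp_pi_mul_I]; norm_num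
      rw [neg_eq_neg_one_mul, this, expTwoPi, ← Complex.exp_add, ← Complex.exp_add]
      congr 1
      unfold bernoulli₂
      field_simp
      ring
    simp only [e1, theta0_add_tau hτ', theta0_add_one, e2]
    ring

/-- The modular transformation of `θ₀` for `τ ↦ -1/τ`. The constant left open by the comparison of
quasi-periods is a cube root of unity, by the values at the three half-periods; it depends
continuously on `τ`, and it is `1` at `τ = i`. -/
lemma theta0_modular {τ : ℂ} (hτ : 0 < τ.im) (w : ℂ) :
    theta0 (-w / τ) (-1 / τ) =
      theta0 w τ * Complex.exp (Real.pi * Complex.I * bernoulli₂ w τ 1) := by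
  set c : ℂ → ℂ := fun τ => theta0 (-((1 + τ) / 2) / τ) (-1 / τ) / (theta0 ((1 + τ) / 2) τ *
    Complex.exp (Real.pi * Complex.I * bernoulli₂ ((1 + τ) / 2) τ 1)) with hc
  have hden : ∀ τ : ℂ, 0 < τ.im → theta0 ((1 + τ) / 2) τ *
      Complex.exp (Real.pi * Complex.I * bernoulli₂ ((1 + τ) / 2) τ 1) ≠ 0 := by
    intro τ hτ
    refine mul_ne_zero (theta0_ne_zero hτ fun m n h => ?_) (Complex.exp_ne_zero _)
    have h1 := congrArg Complex.im h
    have h2 : (1 - 2 * m : ℝ) * τ.im = 0 := by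
      simp at h1; linarith
    rcases mul_eq_zero.1 h2 with h3 | h3
    · have : (1 - 2 * m : ℤ) = 0 := by exact_mod_cast h3
      omega
    · exact hτ.ne' h3
  have hmod : ∀ τ : ℂ, 0 < τ.im → ∀ w, theta0 (-w / τ) (-1 / τ) =
      c τ * (theta0 w τ * Complex.exp (Real.pi * Complex.I * bernoulli₂ w τ 1)) := by
    intro τ hτ w
    obtain ⟨C, hC⟩ := exists_theta0_modular_const hτ
    have : c τ = C := by rw [hc]; simp only [hC]; exact mul_div_cancel_right₀ _ (hden τ hτ)
    rw [this, hC]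
  have hcube : ∀ τ : ℂ, 0 < τ.im → c τ ^ 3 = 1 := by
    intro τ hτ
    have hτ' := im_neg_one_div_pos hτ
    have h0 : τ ≠ 0 := by rintro rfl; simp at hτ
    have p1 := hmod τ hτ (1 / 2)
    have p2 := hmod τ hτ (τ / 2)
    have p3 := hmod τ hτ ((1 + τ) / 2)
    rw [show -(1 / 2 : ℂ) / τ = -1 / τ / 2 by ring] at p1
    rw [show -(τ / 2) / τ = 1 / 2 + (-1 : ℤ) by push_cast; field_simp; norm_num, theta0_add_int] at p2
    rw [show -((1 + τ) / 2) / τ = (1 + -1 / τ) / 2 + (-1 : ℤ) by push_cast; field_simp; ring,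
      theta0_add_int] at p3
    have hexp : Complex.exp (Real.pi * Complex.I * bernoulli₂ (1 / 2) τ 1) *
        Complex.exp (Real.pi * Complex.I * bernoulli₂ (τ / 2) τ 1) *
        Complex.exp (Real.pi * Complex.I * bernoulli₂ ((1 + τ) / 2) τ 1) = 1 := by
      rw [← Complex.exp_add, ← Complex.exp_add, Complex.exp_eq_one_iff]
      refine ⟨0, ?_⟩
      unfold bernoulli₂
      field_simp
      ring
    have h1 := theta0_half_periods hτ
    have h2 := theta0_half_periods hτ'
    rw [p1, p2, p3] at h2
    generalize c τ = C at h2 ⊢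
    have h3 : C ^ 3 * 2 = 1 * 2 := by
      linear_combination h2 - C ^ 3 *
        (theta0 (1 / 2) τ * theta0 (τ / 2) τ * theta0 ((1 + τ) / 2) τ) * hexp - C ^ 3 * h1
    exact mul_right_cancel₀ two_ne_zero h3
  have hI : c Complex.I = 1 := by
    have h0 := hden Complex.I (by simp)
    have e1 : -((1 + Complex.I) / 2) / Complex.I = (1 + Complex.I) / 2 + (-1 : ℤ) := by
      rw [div_eq_iff Complex.I_ne_zero]; push_cast
      linear_combination (-1 / 2 : ℂ) * Complex.I_sq
    have e2 : -1 / Complex.I = Complex.I := by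
      rw [div_eq_iff Complex.I_ne_zero, Complex.I_mul_I]
    have e3 : bernoulli₂ ((1 + Complex.I) / 2) Complex.I 1 = 0 := by
      unfold bernoulli₂
      rw [div_eq_zero_iff]; left
      linear_combination (-1 / 12 : ℂ) * Complex.I_sq
    simp only [hc]
    rw [div_eq_one_iff_eq h0, e1, e2, e3, theta0_add_int]
    simp
  have hone : ∀ τ : ℂ, 0 < τ.im → c τ = 1 := by
    have hcont : ContinuousOn c {τ : ℂ | 0 < τ.im} := by
      have hid : DifferentiableOn ℂ (fun τ : ℂ => τ) {τ : ℂ | 0 < τ.im} := differentiableOn_id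
      have hne : ∀ τ ∈ {τ : ℂ | 0 < τ.im}, τ ≠ 0 := by rintro τ hτ rfl; simp at hτ
      have hB : DifferentiableOn ℂ (fun τ : ℂ => bernoulli₂ ((1 + τ) / 2) τ 1)
          {τ : ℂ | 0 < τ.im} := by
        unfold bernoulli₂
        refine DifferentiableOn.div (by fun_prop) (by fun_prop) fun τ hτ => ?_
        simpa using hne τ hτ
      refine DifferentiableOn.continuousOn (𝕜 := ℂ) (DifferentiableOn.div
        (differentiableOn_theta0 ?_ ?_ fun τ hτ => im_neg_one_div_pos hτ)
        ((differentiableOn_theta0 (by fun_prop) hid fun τ hτ => hτ).mul ?_) fun τ hτ => hden τ hτ)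
      · exact DifferentiableOn.div (by fun_prop) hid hne
      · exact DifferentiableOn.div (by fun_prop) hid hne
      · exact (hB.const_mul _).cexp
    have hconn : IsPreconnected {τ : ℂ | 0 < τ.im} := (convex_halfSpace_im_gt 0).isPreconnected
    have hfin : {z : ℂ | z ^ 3 = 1}.Finite := by
      have := (Polynomial.nthRoots 3 (1 : ℂ)).toFinset.finite_toSet
      refine this.subset fun z hz => ?_
      simpa [Polynomial.mem_nthRoots] using hz
    intro τ hτ
    rw [← hI]
    exact hconn.constant_of_mapsTo (T := {z : ℂ | z ^ 3 = 1}) hfin.isDiscrete hcont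
      (fun τ hτ => hcube τ hτ) hτ (by simp)
  rw [hmod τ hτ w, hone τ hτ, one_mul]

lemma im_neg_div_pos {a b : ℂ} (h : 0 < (a / b).im) : 0 < (-b / a).im := by
  have := im_neg_one_div_pos h
  rwa [div_div_eq_mul_div, neg_one_mul] at this

lemma right_ne_zero_of_im_div_pos {a b : ℂ} (h : 0 < (a / b).im) : b ≠ 0 := by
  rintro rfl; simp at h

lemma left_ne_zero_of_im_div_pos {a b : ℂ} (h : 0 < (a / b).im) : a ≠ 0 := by
  rintro rfl; simp at h

lemma im_div_pos_iff {a b : ℂ} : 0 < (a / b).im ↔ 0 < (a * conj b).im := by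
  rcases eq_or_ne b 0 with rfl | hb
  · simp
  have hn := Complex.normSq_pos.2 hb
  have e : (a / b).im = (a * conj b).im / Complex.normSq b := by
    rw [Complex.div_im]; simp; ring
  rw [e, div_pos_iff_of_pos_right hn]

/-- The modular transformation of `θ₀` in homogeneous form. -/
lemma theta0_modular_homogeneous {ω₁ ω₂ : ℂ} (h : 0 < (ω₁ / ω₂).im) (w : ℂ) :
    theta0 (-w / ω₁) (-ω₂ / ω₁) =
      theta0 (w / ω₂) (ω₁ / ω₂) * Complex.exp (Real.pi * Complex.I * bernoulli₂ w ω₁ ω₂) := by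
  have h1 := left_ne_zero_of_im_div_pos h
  have h2 := right_ne_zero_of_im_div_pos h
  have := theta0_modular h (w / ω₂)
  rw [show -(w / ω₂) / (ω₁ / ω₂) = -w / ω₁ by field_simp,
    show -1 / (ω₁ / ω₂) = -ω₂ / ω₁ by field_simp] at this
  have hB : bernoulli₂ (w / ω₂) (ω₁ / ω₂) 1 = bernoulli₂ w ω₁ ω₂ := by
    unfold bernoulli₂
    field_simp
  rw [this, hB]

/-! ### The elliptic gamma function and its three-term relation -/

/-- The product of the factors `1 - e^{-2πi((j+1)ω₁ - kω₂ - w)/ω₃}`, `j, k ≥ 0`. With `ω₃` and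
`-ω₃` it gives the numerator and, after the exchange of `ω₁` and `ω₂`, the denominator of the
elliptic gamma function in homogeneous form. -/
noncomputable def gammaNum (w ω₁ ω₂ ω₃ : ℂ) : ℂ :=
  qPoch₂ (expTwoPi ((w - ω₁) / ω₃)) (expTwoPi (-ω₁ / ω₃)) (expTwoPi (ω₂ / ω₃))

section
variable {ω₁ ω₂ ω₃ : ℂ}

lemma gammaNum_add_fst (h1 : 0 < (-ω₁ / ω₃).im) (h2 : 0 < (ω₂ / ω₃).im) (w : ℂ) :
    gammaNum (w + ω₁) ω₁ ω₂ ω₃ =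
      qPoch (expTwoPi (w / ω₃)) (expTwoPi (ω₂ / ω₃)) * gammaNum w ω₁ ω₂ ω₃ := by
  rw [gammaNum, qPoch₂_eq (norm_expTwoPi_lt_one h1) (norm_expTwoPi_lt_one h2), ← expTwoPi_add,
    gammaNum, add_sub_cancel_right, sub_eq_add_neg w, add_div]

lemma gammaNum_add_snd (h1 : 0 < (-ω₁ / ω₃).im) (h2 : 0 < (ω₂ / ω₃).im) (w : ℂ) :
    gammaNum w ω₁ ω₂ ω₃ =
      qPoch (expTwoPi ((w - ω₁) / ω₃)) (expTwoPi (-ω₁ / ω₃)) * gammaNum (w + ω₂) ω₁ ω₂ ω₃ := by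
  rw [gammaNum, qPoch₂_comm, qPoch₂_eq (norm_expTwoPi_lt_one h2) (norm_expTwoPi_lt_one h1),
    ← expTwoPi_add, qPoch₂_comm, gammaNum, ← add_div, add_sub_right_comm]

lemma gammaNum_add_trd (h3 : ω₃ ≠ 0) (w : ℂ) :
    gammaNum (w + ω₃) ω₁ ω₂ ω₃ = gammaNum w ω₁ ω₂ ω₃ := by
  rw [gammaNum, gammaNum, show (w + ω₃ - ω₁) / ω₃ = (w - ω₁) / ω₃ + 1 by field_simp; ring,
    expTwoPi_add, expTwoPi_one, mul_one]

lemma gammaNum_factor (w : ℂ) (j k : ℕ) :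
    expTwoPi ((w - ω₁) / ω₃) * expTwoPi (-ω₁ / ω₃) ^ j * expTwoPi (ω₂ / ω₃) ^ k =
      expTwoPi ((w - (j + 1) * ω₁ + k * ω₂) / ω₃) := by
  rw [← expTwoPi_natCast_mul, ← expTwoPi_natCast_mul, ← expTwoPi_add, ← expTwoPi_add]
  congr 1; ring

lemma gammaNum_ne_zero (h1 : 0 < (-ω₁ / ω₃).im) (h2 : 0 < (ω₂ / ω₃).im) {w : ℂ}
    (hw : ∀ (j k : ℕ) (n : ℤ), (w - (j + 1) * ω₁ + k * ω₂) / ω₃ ≠ n) :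
    gammaNum w ω₁ ω₂ ω₃ ≠ 0 := by
  refine qPoch₂_ne_zero (norm_expTwoPi_lt_one h1) (norm_expTwoPi_lt_one h2) fun j k h => ?_
  rw [gammaNum_factor, expTwoPi_eq_one_iff] at h
  obtain ⟨n, hn⟩ := h
  exact hw j k n hn

lemma gammaNum_ne_zero_of_im (h1 : 0 < (-ω₁ / ω₃).im) (h2 : 0 < (ω₂ / ω₃).im) {w : ℂ}
    (hw : (ω₁ / ω₃).im < (w / ω₃).im) : gammaNum w ω₁ ω₂ ω₃ ≠ 0 := by
  refine gammaNum_ne_zero h1 h2 fun j k n hn => ?_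
  have e : (w - (j + 1) * ω₁ + k * ω₂) / ω₃ =
      (w / ω₃ - ω₁ / ω₃) + (j : ℝ) * (-ω₁ / ω₃) + (k : ℝ) * (ω₂ / ω₃) := by push_cast; ring
  have := congrArg Complex.im hn
  rw [e, Complex.add_im, Complex.add_im, Complex.sub_im, Complex.im_ofReal_mul,
    Complex.im_ofReal_mul, Complex.intCast_im] at this
  have p1 := mul_nonneg (Nat.cast_nonneg (α := ℝ) j) h1.le
  have p2 := mul_nonneg (Nat.cast_nonneg (α := ℝ) k) h2.le
  linarith

lemma countable_gammaNum_zeros (h1 : 0 < (-ω₁ / ω₃).im) (h2 : 0 < (ω₂ / ω₃).im) :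
    {w | gammaNum w ω₁ ω₂ ω₃ = 0}.Countable := by
  have h3 : ω₃ ≠ 0 := right_ne_zero_of_im_div_pos h1
  refine (Set.countable_range fun k : ℕ × ℕ × ℤ =>
    ((k.1 + 1) * ω₁ - k.2.1 * ω₂ + k.2.2 * ω₃ : ℂ)).mono fun w hw => ?_
  by_contra hcon
  refine gammaNum_ne_zero h1 h2 (fun j k n h => hcon ⟨(j, k, n), ?_⟩) hw
  rw [div_eq_iff h3] at h
  simp only
  linear_combination -h

lemma differentiableOn_gammaNum {E : Type*} [NormedAddCommGroup E] [NormedSpace ℂ E] {U : Set E}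
    {w ω₁ ω₂ ω₃ : E → ℂ} (hw : DifferentiableOn ℂ w U) (hω₁ : DifferentiableOn ℂ ω₁ U)
    (hω₂ : DifferentiableOn ℂ ω₂ U) (hω₃ : DifferentiableOn ℂ ω₃ U)
    (h1 : ∀ y ∈ U, 0 < (-ω₁ y / ω₃ y).im) (h2 : ∀ y ∈ U, 0 < (ω₂ y / ω₃ y).im) :
    DifferentiableOn ℂ (fun y => gammaNum (w y) (ω₁ y) (ω₂ y) (ω₃ y)) U := by
  have he : ∀ {f : E → ℂ}, DifferentiableOn ℂ f U →
      DifferentiableOn ℂ (fun y => expTwoPi (f y / ω₃ y)) U := fun hf => by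
    simp only [div_eq_mul_inv]
    exact differentiable_expTwoPi.comp_differentiableOn
      (hf.mul (hω₃.inv fun y hy => right_ne_zero_of_im_div_pos (h1 y hy)))
  exact differentiableOn_qPoch₂ (he (hw.sub hω₁)) (he hω₁.neg) (he hω₂)
    (fun y hy => norm_expTwoPi_lt_one (h1 y hy)) fun y hy => norm_expTwoPi_lt_one (h2 y hy)

lemma differentiable_gammaNum (h1 : 0 < (-ω₁ / ω₃).im) (h2 : 0 < (ω₂ / ω₃).im) :
    Differentiable ℂ fun w => gammaNum w ω₁ ω₂ ω₃ := by
  rw [← differentiableOn_univ]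
  exact differentiableOn_gammaNum differentiableOn_id (differentiableOn_const _)
    (differentiableOn_const _) (differentiableOn_const _) (fun _ _ => h1) fun _ _ => h2

/-- The Bernoulli polynomial `B_{3,3}(w | ω₁, ω₂, ω₃)`. -/
noncomputable def bernoulli₃ (w ω₁ ω₂ ω₃ : ℂ) : ℂ :=
  (w ^ 3 - 3 / 2 * (ω₁ + ω₂ + ω₃) * w ^ 2 +
    1 / 2 * (ω₁ ^ 2 + ω₂ ^ 2 + ω₃ ^ 2 + 3 * (ω₁ * ω₂ + ω₂ * ω₃ + ω₃ * ω₁)) * w -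
    1 / 4 * (ω₁ + ω₂ + ω₃) * (ω₁ * ω₂ + ω₂ * ω₃ + ω₃ * ω₁)) / (ω₁ * ω₂ * ω₃)

lemma bernoulli₃_add_fst (h1 : ω₁ ≠ 0) (h2 : ω₂ ≠ 0) (h3 : ω₃ ≠ 0) (w : ℂ) :
    bernoulli₃ (w + ω₁) ω₁ ω₂ ω₃ = bernoulli₃ w ω₁ ω₂ ω₃ + 3 * bernoulli₂ w ω₂ ω₃ := by
  unfold bernoulli₃ bernoulli₂
  field_simp
  ring

lemma bernoulli₃_cyclic (w : ℂ) : bernoulli₃ w ω₁ ω₂ ω₃ = bernoulli₃ w ω₂ ω₃ ω₁ := by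
  unfold bernoulli₃
  congr 1 <;> ring

/-- The product of the three numerators in the three-term relation. -/
noncomputable def tripleNum (w ω₁ ω₂ ω₃ : ℂ) : ℂ :=
  gammaNum w ω₁ ω₂ ω₃ * gammaNum w ω₂ ω₃ ω₁ * gammaNum w ω₃ ω₁ ω₂

/-- The product of the three denominators and the exponential factor in the three-term relation. -/
noncomputable def tripleDen (w ω₁ ω₂ ω₃ : ℂ) : ℂ :=
  gammaNum w ω₂ ω₁ (-ω₃) * gammaNum w ω₃ ω₂ (-ω₁) * gammaNum w ω₁ ω₃ (-ω₂) *
    Complex.exp (-(Real.pi * Complex.I / 3) * bernoulli₃ w ω₁ ω₂ ω₃)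

lemma tripleNum_cyclic (w : ℂ) : tripleNum w ω₁ ω₂ ω₃ = tripleNum w ω₂ ω₃ ω₁ := by
  unfold tripleNum; ring

lemma tripleDen_cyclic (w : ℂ) : tripleDen w ω₁ ω₂ ω₃ = tripleDen w ω₂ ω₃ ω₁ := by
  unfold tripleDen; rw [bernoulli₃_cyclic]; ring

/-- Under `w ↦ w + ω₁` both sides of the three-term relation are multiplied by theta functions,
which agree up to the modular transformation. -/
lemma triple_quasiperiod (h12 : 0 < (ω₁ / ω₂).im) (h23 : 0 < (ω₂ / ω₃).im)
    (h31 : 0 < (ω₃ / ω₁).im) (w : ℂ) :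
    tripleNum (w + ω₁) ω₁ ω₂ ω₃ * tripleDen w ω₁ ω₂ ω₃ =
      tripleNum w ω₁ ω₂ ω₃ * tripleDen (w + ω₁) ω₁ ω₂ ω₃ := by
  have n1 := left_ne_zero_of_im_div_pos h12
  have n2 := left_ne_zero_of_im_div_pos h23
  have n3 := left_ne_zero_of_im_div_pos h31
  have h21 := im_neg_div_pos h12
  have h32 := im_neg_div_pos h23
  have h13 := im_neg_div_pos h31
  have a1 := gammaNum_add_fst (ω₁ := ω₁) (ω₂ := ω₂) (ω₃ := ω₃) h13 h23 w
  have a2 := gammaNum_add_trd (ω₁ := ω₂) (ω₂ := ω₃) n1 w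
  have a3 := gammaNum_add_snd (ω₁ := ω₃) (ω₂ := ω₁) (ω₃ := ω₂) h32 h12 w
  have b1 := gammaNum_add_snd (ω₁ := ω₂) (ω₂ := ω₁) (ω₃ := -ω₃) (by rwa [neg_div_neg_eq])
    (by rwa [div_neg, ← neg_div]) w
  have b2 := gammaNum_add_trd (ω₁ := ω₃) (ω₂ := ω₂) (neg_ne_zero.2 n1) (w + ω₁)
  have b3 := gammaNum_add_fst (ω₁ := ω₁) (ω₂ := ω₃) (ω₃ := -ω₂) (by rwa [neg_div_neg_eq])
    (by rwa [div_neg, ← neg_div]) w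
  rw [add_neg_cancel_right] at b2
  have hmod := theta0_modular_homogeneous h23 w
  rw [theta0_eq h32, theta0_eq h23] at hmod
  rw [show (w - ω₂) / -ω₃ = ω₂ / ω₃ - w / ω₃ by rw [div_neg]; ring, neg_div_neg_eq] at b1
  rw [show w / -ω₂ = -w / ω₂ by rw [div_neg, neg_div],
    show ω₃ / -ω₂ = -ω₃ / ω₂ by rw [div_neg, neg_div]] at b3
  rw [show (w - ω₃) / ω₂ = -ω₃ / ω₂ - -w / ω₂ by ring] at a3
  have hE : Complex.exp (-(Real.pi * Complex.I / 3) * bernoulli₃ w ω₁ ω₂ ω₃) =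
      Complex.exp (Real.pi * Complex.I * bernoulli₂ w ω₂ ω₃) *
        Complex.exp (-(Real.pi * Complex.I / 3) * bernoulli₃ (w + ω₁) ω₁ ω₂ ω₃) := by
    rw [← Complex.exp_add, bernoulli₃_add_fst n1 n2 n3]
    congr 1; ring
  simp only [tripleNum, tripleDen]
  rw [a1, a2, a3, b1, b3, hE, ← b2]
  linear_combination
    (-(gammaNum w ω₁ ω₂ ω₃ * gammaNum w ω₂ ω₃ ω₁ * gammaNum (w + ω₁) ω₃ ω₁ ω₂ *
      gammaNum (w + ω₁) ω₂ ω₁ (-ω₃) * gammaNum w ω₃ ω₂ (-ω₁) * gammaNum w ω₁ ω₃ (-ω₂) *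
      Complex.exp (-(Real.pi * Complex.I / 3) * bernoulli₃ (w + ω₁) ω₁ ω₂ ω₃))) * hmod

/-- The intersection of three open strips: it contains the open parallelogram spanned by two of the
`ωᵢ`, and the three denominators of the three-term relation have no zeros in it. -/
def hexagon (ω₁ ω₂ ω₃ : ℂ) : Set ℂ :=
  {w | ((ω₁ / ω₃).im < (w / ω₃).im ∧ (w / ω₃).im < (ω₂ / ω₃).im) ∧
    ((ω₂ / ω₁).im < (w / ω₁).im ∧ (w / ω₁).im < (ω₃ / ω₁).im) ∧
    ((ω₃ / ω₂).im < (w / ω₂).im ∧ (w / ω₂).im < (ω₁ / ω₂).im)}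

lemma isOpen_hexagon : IsOpen (hexagon ω₁ ω₂ ω₃) := by
  have h : ∀ (c : ℂ) (a b : ℝ), IsOpen {w : ℂ | a < (w / c).im ∧ (w / c).im < b} := fun c a b =>
    IsOpen.inter (s := {w : ℂ | a < (w / c).im}) (t := {w : ℂ | (w / c).im < b})
      (isOpen_lt (by fun_prop) (by fun_prop)) (isOpen_lt (by fun_prop) (by fun_prop))
  exact (h _ _ _).inter ((h _ _ _).inter (h _ _ _))

lemma tripleDen_ne_zero (h12 : 0 < (ω₁ / ω₂).im) (h23 : 0 < (ω₂ / ω₃).im)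
    (h31 : 0 < (ω₃ / ω₁).im) {w : ℂ} (hw : w ∈ hexagon ω₁ ω₂ ω₃) : tripleDen w ω₁ ω₂ ω₃ ≠ 0 := by
  have key : ∀ {a b c : ℂ}, 0 < (a / c).im → 0 < (-b / c).im → (w / c).im < (a / c).im →
      gammaNum w a b (-c) ≠ 0 := fun h1 h2 h3 =>
    gammaNum_ne_zero_of_im (by rwa [neg_div_neg_eq]) (by rwa [div_neg, ← neg_div])
      (by rw [div_neg, div_neg, Complex.neg_im, Complex.neg_im]; exact neg_lt_neg h3)
  exact mul_ne_zero (mul_ne_zero (mul_ne_zero (key h23 (im_neg_div_pos h31) hw.1.2)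
    (key h31 (im_neg_div_pos h12) hw.2.1.2)) (key h12 (im_neg_div_pos h23) hw.2.2.2))
    (Complex.exp_ne_zero _)

lemma center_mem_hexagon (h12 : 0 < (ω₁ / ω₂).im) (h23 : 0 < (ω₂ / ω₃).im)
    (h31 : 0 < (ω₃ / ω₁).im) : (ω₁ + ω₂ + ω₃) / 2 ∈ hexagon ω₁ ω₂ ω₃ := by
  have key : ∀ {a b c : ℂ}, 0 < (b / c).im → 0 < (-a / c).im →
      (a / c).im < ((a + b + c) / 2 / c).im ∧ ((a + b + c) / 2 / c).im < (b / c).im := by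
    intro a b c h1 h2
    have hc := right_ne_zero_of_im_div_pos h1
    have e : (a + b + c) / 2 / c = (2⁻¹ : ℝ) * (a / c + b / c + 1) := by
      push_cast; field_simp
    rw [neg_div, Complex.neg_im] at h2
    rw [e, Complex.im_ofReal_mul, Complex.add_im, Complex.add_im, Complex.one_im]
    constructor <;> linarith
  refine ⟨key h23 (im_neg_div_pos h31), ?_, ?_⟩
  · rw [show ω₁ + ω₂ + ω₃ = ω₂ + ω₃ + ω₁ by ring]
    exact key h31 (im_neg_div_pos h12)
  · rw [show ω₁ + ω₂ + ω₃ = ω₃ + ω₁ + ω₂ by ring]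
    exact key h12 (im_neg_div_pos h23)

/-- At the centre `B_{3,3}` vanishes, and each numerator equals one of the denominators. -/
lemma triple_center (h1 : ω₁ ≠ 0) (h2 : ω₂ ≠ 0) (h3 : ω₃ ≠ 0) :
    tripleNum ((ω₁ + ω₂ + ω₃) / 2) ω₁ ω₂ ω₃ = tripleDen ((ω₁ + ω₂ + ω₃) / 2) ω₁ ω₂ ω₃ := by
  have key : ∀ {a b c w : ℂ}, c ≠ 0 → 2 * w = a + b + c →
      gammaNum w a b c = gammaNum w b a (-c) := by
    intro a b c w hc hw
    have e : (w - a) / c = (w - b) / -c + 1 := by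
      field_simp
      linear_combination hw
    rw [gammaNum, gammaNum, qPoch₂_comm, e, expTwoPi_add, expTwoPi_one, mul_one, neg_div_neg_eq,
      show a / -c = -a / c by rw [div_neg, neg_div]]
  have hB : bernoulli₃ ((ω₁ + ω₂ + ω₃) / 2) ω₁ ω₂ ω₃ = 0 := by
    unfold bernoulli₃
    rw [div_eq_zero_iff]; left; ring
  rw [tripleNum, tripleDen, hB, mul_zero, Complex.exp_zero, mul_one, key h3 (by ring),
    key (a := ω₂) (b := ω₃) h1 (by ring), key (a := ω₃) (b := ω₁) h2 (by ring)]

/-- The modular three-term relation of Felder and Varchenko for the elliptic gamma function, as an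
identity of entire functions. -/
theorem tripleNum_eq_tripleDen (h12 : 0 < (ω₁ / ω₂).im) (h23 : 0 < (ω₂ / ω₃).im)
    (h31 : 0 < (ω₃ / ω₁).im) (w : ℂ) : tripleNum w ω₁ ω₂ ω₃ = tripleDen w ω₁ ω₂ ω₃ := by
  have n1 := left_ne_zero_of_im_div_pos h12
  have n2 := left_ne_zero_of_im_div_pos h23
  have n3 := left_ne_zero_of_im_div_pos h31
  have h21 := im_neg_div_pos h12
  have h32 := im_neg_div_pos h23
  have h13 := im_neg_div_pos h31
  have i21 : (ω₂ / ω₁).im < 0 := by rw [neg_div, Complex.neg_im] at h21; linarith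
  have i32 : (ω₃ / ω₂).im < 0 := by rw [neg_div, Complex.neg_im] at h32; linarith
  have i13 : (ω₁ / ω₃).im < 0 := by rw [neg_div, Complex.neg_im] at h13; linarith
  have hneg : ∀ {a b c : ℂ}, 0 < (a / c).im → 0 < (-b / c).im →
      0 < (-a / -c).im ∧ 0 < (b / -c).im := fun h1 h2 =>
    ⟨by rwa [neg_div_neg_eq], by rwa [div_neg, ← neg_div]⟩
  have hdiff : Differentiable ℂ fun w => tripleNum w ω₁ ω₂ ω₃ :=
    ((differentiable_gammaNum h13 h23).mul (differentiable_gammaNum h21 h31)).mul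
      (differentiable_gammaNum h32 h12)
  have hB : Differentiable ℂ fun w => bernoulli₃ w ω₁ ω₂ ω₃ := by unfold bernoulli₃; fun_prop
  have hdiff' : Differentiable ℂ fun w => tripleDen w ω₁ ω₂ ω₃ :=
    (((differentiable_gammaNum (hneg h23 h13).1 (hneg h23 h13).2).mul
      (differentiable_gammaNum (hneg h31 h21).1 (hneg h31 h21).2)).mul
      (differentiable_gammaNum (hneg h12 h32).1 (hneg h12 h32).2)).mul (hB.const_mul _).cexp
  obtain ⟨C, hC⟩ := exists_eq_const_mul_of_quasiperiods (ω₁ := ω₁) (ω₂ := ω₂)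
    (im_div_pos_iff.1 h12) isOpen_hexagon (U := hexagon ω₁ ω₂ ω₃) (by
      intro s t hs0 hs1 ht0 ht1
      have e : ∀ c : ℂ, ((s * ω₁ + t * ω₂) / c).im = s * (ω₁ / c).im + t * (ω₂ / c).im := by
        intro c
        rw [← Complex.im_ofReal_mul, ← Complex.im_ofReal_mul, ← Complex.add_im]
        congr 1; ring
      have e1 : (ω₁ / ω₁).im = 0 := by simp [n1]
      have e2 : (ω₂ / ω₂).im = 0 := by simp [n2]
      refine ⟨⟨?_, ?_⟩, ⟨?_, ?_⟩, ⟨?_, ?_⟩⟩ <;> rw [e] <;> (try rw [e1]) <;> (try rw [e2]) <;>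
        nlinarith)
    hdiff hdiff' (h := fun w => tripleNum w ω₁ ω₂ ω₃ / tripleDen w ω₁ ω₂ ω₃)
    (hdiff.differentiableOn.div hdiff'.differentiableOn
      fun w hw => tripleDen_ne_zero h12 h23 h31 hw)
    (fun w hw => (div_mul_cancel₀ _ (tripleDen_ne_zero h12 h23 h31 hw)).symm)
    ((((countable_gammaNum_zeros (hneg h23 h13).1 (hneg h23 h13).2).union
      (countable_gammaNum_zeros (hneg h31 h21).1 (hneg h31 h21).2)).union
      (countable_gammaNum_zeros (hneg h12 h32).1 (hneg h12 h32).2)).mono (by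
        intro w hw
        have hw' := (mul_eq_zero.1 (hw : tripleDen w ω₁ ω₂ ω₃ = 0)).resolve_right
          (Complex.exp_ne_zero _)
        rcases mul_eq_zero.1 hw' with h | h
        · exact Or.inl (mul_eq_zero.1 h)
        · exact Or.inr h))
    (triple_quasiperiod h12 h23 h31)
    (fun w => by
      simp only [tripleNum_cyclic (ω₁ := ω₁), tripleDen_cyclic (ω₁ := ω₁)]
      exact triple_quasiperiod h23 h31 h12 w)
  have h0 := hC ((ω₁ + ω₂ + ω₃) / 2)
  rw [triple_center n1 n2 n3] at h0
  have hne := tripleDen_ne_zero h12 h23 h31 (center_mem_hexagon h12 h23 h31)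
  have : C = 1 := mul_right_cancel₀ hne (by rw [← h0, one_mul])
  rw [hC, this, one_mul]

end

/-! ### Dual triples and fundamental boxes in the lattice -/

/-- The vectors `α, β, γ ∈ Λ^∨` are, up to positive factors, dual to the vectors `a, b, c ∈ Λ`. -/
structure IsDualTriple (a b c α β γ : Fin 3 → ℤ) : Prop where
  αa : 0 < α ⬝ᵥ a
  αb : α ⬝ᵥ b = 0
  αc : α ⬝ᵥ c = 0
  βa : β ⬝ᵥ a = 0
  βb : 0 < β ⬝ᵥ b
  βc : β ⬝ᵥ c = 0
  γa : γ ⬝ᵥ a = 0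
  γb : γ ⬝ᵥ b = 0
  γc : 0 < γ ⬝ᵥ c

section
variable {a b c α β γ : Fin 3 → ℤ}

lemma IsDualTriple.cyclic (h : IsDualTriple a b c α β γ) : IsDualTriple b c a β γ α :=
  ⟨h.βb, h.βc, h.βa, h.γb, h.γc, h.γa, h.αb, h.αc, h.αa⟩

lemma IsDualTriple.swap (h : IsDualTriple a b c α β γ) : IsDualTriple b a c β α γ :=
  ⟨h.βb, h.βa, h.βc, h.αb, h.αa, h.αc, h.γb, h.γa, h.γc⟩

lemma cross_ne_zero_of_det_ne_zero (h : (Matrix.of ![a, b, c]).det ≠ 0) : a ⨯₃ b ≠ 0 := by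
  intro h0
  refine h ?_
  have h1 := congrFun h0 0
  have h2 := congrFun h0 1
  have h3 := congrFun h0 2
  simp [cross_apply] at h1 h2 h3
  rw [Matrix.det_fin_three]
  simp only [Matrix.of_apply, Matrix.cons_val]
  linear_combination c 0 * h1 + c 1 * h2 + c 2 * h3

lemma det_cyclic : (Matrix.of ![a, b, c]).det = (Matrix.of ![b, c, a]).det := by
  rw [Matrix.det_fin_three, Matrix.det_fin_three]
  simp only [Matrix.of_apply, Matrix.cons_val]
  ring

lemma gam_dot_left (h : a ⨯₃ b ≠ 0) : gam a b ⬝ᵥ a = 0 := by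
  obtain ⟨-, s, hs, hd⟩ := gam_spec h
  have := hd a
  rw [Matrix.det_zero_of_row_eq (i := 0) (j := 2) (by decide) rfl] at this
  exact (mul_eq_zero.1 this.symm).resolve_left hs.ne'

lemma gam_dot_right (h : a ⨯₃ b ≠ 0) : gam a b ⬝ᵥ b = 0 := by
  obtain ⟨-, s, hs, hd⟩ := gam_spec h
  have := hd b
  rw [Matrix.det_zero_of_row_eq (i := 1) (j := 2) (by decide) rfl] at this
  exact (mul_eq_zero.1 this.symm).resolve_left hs.ne'

lemma gam_dot_pos (h : 0 < (Matrix.of ![a, b, c]).det) : 0 < gam a b ⬝ᵥ c := by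
  obtain ⟨-, s, hs, hd⟩ := gam_spec (cross_ne_zero_of_det_ne_zero h.ne')
  rw [hd c] at h
  exact pos_of_mul_pos_right h hs.le

lemma isDualTriple_gam (h : 0 < (Matrix.of ![a, b, c]).det) :
    IsDualTriple a b c (gam b c) (gam c a) (gam a b) := by
  have h2 : 0 < (Matrix.of ![b, c, a]).det := by rwa [← det_cyclic]
  have h3 : 0 < (Matrix.of ![c, a, b]).det := by rwa [← det_cyclic]
  have c1 := cross_ne_zero_of_det_ne_zero h.ne'
  have c2 := cross_ne_zero_of_det_ne_zero h2.ne'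
  have c3 := cross_ne_zero_of_det_ne_zero h3.ne'
  exact ⟨gam_dot_pos h2, gam_dot_left c2, gam_dot_right c2, gam_dot_right c3, gam_dot_pos h3,
    gam_dot_left c3, gam_dot_left c1, gam_dot_right c1, gam_dot_pos h⟩

lemma IsDualTriple.det_mul_det (h : IsDualTriple a b c α β γ) :
    (Matrix.of ![α, β, γ]).det * (Matrix.of ![a, b, c]).det = (α ⬝ᵥ a) * (β ⬝ᵥ b) * (γ ⬝ᵥ c) := by
  rw [← Matrix.det_transpose (Matrix.of ![a, b, c]), ← Matrix.det_mul]
  have e : Matrix.of ![α, β, γ] * (Matrix.of ![a, b, c])ᵀ =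
      Matrix.diagonal ![α ⬝ᵥ a, β ⬝ᵥ b, γ ⬝ᵥ c] := by
    ext i j
    have e' : (Matrix.of ![α, β, γ] * (Matrix.of ![a, b, c])ᵀ) i j =
        (![α, β, γ] i) ⬝ᵥ (![a, b, c] j) := rfl
    rw [e', Matrix.diagonal_apply]
    fin_cases i <;> fin_cases j <;> simp [h.αb, h.αc, h.βa, h.βc, h.γa, h.γb]
  rw [e, Matrix.det_diagonal, Fin.prod_univ_three]
  rfl

/-- The fundamental box for the sublattice of `Λ^∨` spanned by a dual triple. -/
def dualBox (a b c α β γ : Fin 3 → ℤ) : Set (Fin 3 → ℤ) :=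
  {δ | (0 ≤ δ ⬝ᵥ a ∧ δ ⬝ᵥ a < α ⬝ᵥ a) ∧ (0 ≤ δ ⬝ᵥ b ∧ δ ⬝ᵥ b < β ⬝ᵥ b) ∧
    (0 ≤ δ ⬝ᵥ c ∧ δ ⬝ᵥ c < γ ⬝ᵥ c)}

lemma dualBox_cyclic : dualBox b c a β γ α = dualBox a b c α β γ := by
  ext δ; simp only [dualBox, Set.mem_ofPred_eq]; tauto

lemma dualBox_swap : dualBox b a c β α γ = dualBox a b c α β γ := by
  ext δ; simp only [dualBox, Set.mem_ofPred_eq]; tauto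

lemma IsDualTriple.finite_dualBox (h : IsDualTriple a b c α β γ) :
    (dualBox a b c α β γ).Finite := by
  have hne : (Matrix.of ![a, b, c]).det ≠ 0 := by
    intro h0
    have := h.det_mul_det
    rw [h0, mul_zero] at this
    exact (mul_pos (mul_pos h.αa h.βb) h.γc).ne this
  have hinj : Function.Injective fun δ : Fin 3 → ℤ => Matrix.of ![a, b, c] *ᵥ δ :=
    Matrix.mulVec_injective_of_det_ne_zero hne
  refine Set.Finite.of_finite_image (f := fun δ : Fin 3 → ℤ => Matrix.of ![a, b, c] *ᵥ δ)
    ((Set.finite_Icc (0 : Fin 3 → ℤ) ![α ⬝ᵥ a, β ⬝ᵥ b, γ ⬝ᵥ c]).subset ?_) hinj.injOn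
  rintro _ ⟨δ, ⟨h1, h2, h3⟩, rfl⟩
  have e : Matrix.of ![a, b, c] *ᵥ δ = ![δ ⬝ᵥ a, δ ⬝ᵥ b, δ ⬝ᵥ c] := by
    ext i
    fin_cases i <;> exact dotProduct_comm _ _
  simp only [e]
  constructor <;> intro i <;> fin_cases i
  exacts [h1.1, h2.1, h3.1, h1.2.le, h2.2.le, h3.2.le]

/-! ### Products over subsets of `Λ^∨/ℤγ` -/

/-- The image in `Λ^∨/ℤγ` of the set of all `δ` with `δ(a) > m` and `δ(b) ≤ n`. -/
def coneQuot (γ a b : Fin 3 → ℤ) (m n : ℤ) : Set ((Fin 3 → ℤ) ⧸ AddSubgroup.zmultiples γ) :=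
  QuotientAddGroup.mk '' {δ | m < δ ⬝ᵥ a ∧ δ ⬝ᵥ b ≤ n}

lemma mk_eq_mk_iff {γ δ δ' : Fin 3 → ℤ} :
    ((δ : (Fin 3 → ℤ) ⧸ AddSubgroup.zmultiples γ) = δ') ↔ ∃ n : ℤ, δ' = δ + n • γ := by
  rw [QuotientAddGroup.eq, AddSubgroup.mem_zmultiples_iff]
  refine exists_congr fun n => ?_
  rw [eq_neg_add_iff_add_eq, eq_comm]

lemma mk_mem_image_iff {γ : Fin 3 → ℤ} {S : Set (Fin 3 → ℤ)}
    (hS : ∀ δ ∈ S, ∀ n : ℤ, δ + n • γ ∈ S) (δ : Fin 3 → ℤ) :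
    (δ : (Fin 3 → ℤ) ⧸ AddSubgroup.zmultiples γ) ∈ QuotientAddGroup.mk '' S ↔ δ ∈ S := by
  refine ⟨?_, fun h => ⟨δ, h, rfl⟩⟩
  rintro ⟨δ', h', e⟩
  obtain ⟨n, rfl⟩ := mk_eq_mk_iff.1 e
  exact hS _ h' n

lemma add_zsmul_dot (ha : γ ⬝ᵥ a = 0) (δ : Fin 3 → ℤ) (n : ℤ) : (δ + n • γ) ⬝ᵥ a = δ ⬝ᵥ a := by
  rw [add_dotProduct, smul_dotProduct, ha, smul_zero, add_zero]

lemma mk_mem_coneQuot (ha : γ ⬝ᵥ a = 0) (hb : γ ⬝ᵥ b = 0) (m n : ℤ) (δ : Fin 3 → ℤ) :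
    (δ : (Fin 3 → ℤ) ⧸ AddSubgroup.zmultiples γ) ∈ coneQuot γ a b m n ↔
      m < δ ⬝ᵥ a ∧ δ ⬝ᵥ b ≤ n := by
  refine mk_mem_image_iff (S := {δ | m < δ ⬝ᵥ a ∧ δ ⬝ᵥ b ≤ n}) ?_ δ
  rintro δ ⟨h1, h2⟩ k
  rw [Set.mem_ofPred_eq, add_zsmul_dot ha, add_zsmul_dot hb]
  exact ⟨h1, h2⟩

/-- The term `e^{± 2πi (δ(x) - w)/γ(x)}` of the factor `gammaFactor`. -/
noncomputable def gammaTerm (γ : Fin 3 → ℤ) (ε : ℤ) (w : ℂ) (x : Fin 3 → ℂ)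
    (q : (Fin 3 → ℤ) ⧸ AddSubgroup.zmultiples γ) : ℂ := 1 - gammaFactor γ ε w x q

lemma gammaFactor_eq (ε : ℤ) (w : ℂ) (x : Fin 3 → ℂ)
    (q : (Fin 3 → ℤ) ⧸ AddSubgroup.zmultiples γ) :
    gammaFactor γ ε w x q = 1 - gammaTerm γ ε w x q := by simp [gammaTerm]

lemma gammaTerm_mk (ε : ℤ) (w : ℂ) (x : Fin 3 → ℂ) (δ : Fin 3 → ℤ) :
    gammaTerm γ ε w x δ = expTwoPi (ε * (pair δ x - w) / pair γ x) := by
  change 1 - (1 - Complex.exp (ε * (2 * Real.pi * Complex.I * (pair δ x - w) / pair γ x))) = _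
  rw [sub_sub_cancel, expTwoPi]
  congr 1; ring

/-- The infinite product of the factors `1 - e^{± 2πi (δ(x) - w)/γ(x)}` over `coneQuot`. -/
noncomputable def coneProd (γ a b : Fin 3 → ℤ) (m n ε : ℤ) (w : ℂ) (x : Fin 3 → ℂ) : ℂ :=
  ∏' q : coneQuot γ a b m n, gammaFactor γ ε w x q

lemma pair_neg (δ : Fin 3 → ℤ) (x : Fin 3 → ℂ) : pair (-δ) x = -pair δ x := by
  simpa using pair_zsmul (-1) δ x

lemma pair_sub (δ ε : Fin 3 → ℤ) (x : Fin 3 → ℂ) : pair (δ - ε) x = pair δ x - pair ε x := by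
  rw [sub_eq_add_neg, pair_add, pair_neg, sub_eq_add_neg]

/-- A dual triple yields coordinates on the cone `δ(a) > 0`, `δ(b) ≤ 0` modulo `ℤγ`: its elements are
the classes of `(j + 1)α - kβ - δ`, with `δ` in the box and `j, k ∈ ℕ`. -/
noncomputable def IsDualTriple.coneEquiv (h : IsDualTriple a b c α β γ) :
    dualBox a b c α β γ × (ℕ × ℕ) ≃ coneQuot γ a b 0 0 :=
  Equiv.ofBijective (fun p => ⟨(((p.2.1 + 1 : ℤ) • α - (p.2.2 : ℤ) • β - p.1.1 : Fin 3 → ℤ) :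
      (Fin 3 → ℤ) ⧸ AddSubgroup.zmultiples γ), by
    obtain ⟨⟨δ, h1, h2, h3⟩, j, k⟩ := p
    rw [mk_mem_coneQuot h.γa h.γb]
    simp only [sub_dotProduct, smul_dotProduct, h.αb, h.βa, smul_eq_mul]
    have := mul_nonneg (Int.natCast_nonneg j) h.αa.le
    have := mul_nonneg (Int.natCast_nonneg k) h.βb.le
    constructor <;> nlinarith [h1.2, h2.1]⟩) (by
    constructor
    · rintro ⟨⟨δ, h1, h2, h3⟩, j, k⟩ ⟨⟨δ', h1', h2', h3'⟩, j', k'⟩ e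
      obtain ⟨n, hn⟩ := mk_eq_mk_iff.1 (Subtype.ext_iff.1 e)
      simp only at hn
      have da := congrArg (· ⬝ᵥ a) hn
      have db := congrArg (· ⬝ᵥ b) hn
      have dc := congrArg (· ⬝ᵥ c) hn
      simp only [sub_dotProduct, add_dotProduct, smul_dotProduct, h.αb, h.βa, h.αc, h.βc, h.γa,
        h.γb, smul_eq_mul] at da db dc
      have hj : (j : ℤ) = j' := by
        have pa := h.αa
        have l1 : ((j' : ℤ) - j) * (α ⬝ᵥ a) = δ' ⬝ᵥ a - δ ⬝ᵥ a := by linear_combination da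
        have l2 : (j' : ℤ) - j < 1 := by
          by_contra hc; push Not at hc; nlinarith [h1.1, h1'.2]
        have l3 : -1 < (j' : ℤ) - j := by
          by_contra hc; push Not at hc; nlinarith [h1.2, h1'.1]
        omega
      have hk : (k : ℤ) = k' := by
        have pb := h.βb
        have l1 : ((k : ℤ) - k') * (β ⬝ᵥ b) = δ' ⬝ᵥ b - δ ⬝ᵥ b := by linear_combination db
        have l2 : (k : ℤ) - k' < 1 := by
          by_contra hc; push Not at hc; nlinarith [h2.1, h2'.2]
        have l3 : -1 < (k : ℤ) - k' := by
          by_contra hc; push Not at hc; nlinarith [h2.2, h2'.1]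
        omega
      have hn0 : n = 0 := by
        have pc := h.γc
        have l1 : n * (γ ⬝ᵥ c) = δ ⬝ᵥ c - δ' ⬝ᵥ c := by linear_combination -dc
        have l2 : n < 1 := by
          by_contra hc; push Not at hc; nlinarith [h3.2, h3'.1]
        have l3 : -1 < n := by
          by_contra hc; push Not at hc; nlinarith [h3.1, h3'.2]
        omega
      rw [hn0, hj, hk, zero_smul, add_zero] at hn
      have hδ : δ = δ' := (sub_right_injective hn).symm
      have hj' : j = j' := by exact_mod_cast hj
      have hk' : k = k' := by exact_mod_cast hk
      subst hδ hj' hk'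
      rfl
    · rintro ⟨q, hq⟩
      induction q using QuotientAddGroup.induction_on with
      | H δ =>
      rw [mk_mem_coneQuot h.γa h.γb] at hq
      obtain ⟨ha, hb⟩ := hq
      -- division with remainder of the values at `a`, `b` and `c`
      have pa := h.αa
      have pb := h.βb
      have pc := h.γc
      set j : ℤ := (δ ⬝ᵥ a - 1) / (α ⬝ᵥ a)
      set k : ℤ := (-(δ ⬝ᵥ b)) / (β ⬝ᵥ b)
      have hj : 0 ≤ j := Int.ediv_nonneg (by omega) pa.le
      have hk : 0 ≤ k := Int.ediv_nonneg (by omega) pb.le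
      set l : ℤ := (-(δ ⬝ᵥ c)) / (γ ⬝ᵥ c)
      have ra := Int.emod_add_mul_ediv (δ ⬝ᵥ a - 1) (α ⬝ᵥ a)
      have rb := Int.emod_add_mul_ediv (-(δ ⬝ᵥ b)) (β ⬝ᵥ b)
      have rc := Int.emod_add_mul_ediv (-(δ ⬝ᵥ c)) (γ ⬝ᵥ c)
      have na := Int.emod_nonneg (δ ⬝ᵥ a - 1) pa.ne'
      have nb := Int.emod_nonneg (-(δ ⬝ᵥ b)) pb.ne'
      have nc := Int.emod_nonneg (-(δ ⬝ᵥ c)) pc.ne'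
      have la := Int.emod_lt_of_pos (δ ⬝ᵥ a - 1) pa
      have lb := Int.emod_lt_of_pos (-(δ ⬝ᵥ b)) pb
      have lc := Int.emod_lt_of_pos (-(δ ⬝ᵥ c)) pc
      have hmem : (j + 1) • α - k • β - δ - l • γ ∈ dualBox a b c α β γ := by
        simp only [dualBox, Set.mem_ofPred_eq, sub_dotProduct, smul_dotProduct, h.αb, h.βa,
          h.αc, h.βc, h.γa, h.γb, smul_eq_mul]
        refine ⟨⟨?_, ?_⟩, ⟨?_, ?_⟩, ?_, ?_⟩ <;> linarith
      refine ⟨⟨⟨_, hmem⟩, j.toNat, k.toNat⟩, Subtype.ext ?_⟩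
      simp only [Int.toNat_of_nonneg hj, Int.toNat_of_nonneg hk]
      rw [mk_eq_mk_iff]
      exact ⟨-l, by rw [neg_smul]; abel⟩)

lemma IsDualTriple.gammaTerm_coneEquiv (h : IsDualTriple a b c α β γ) {ε : ℤ} (hε : ε * ε = 1)
    (w : ℂ) (x : Fin 3 → ℂ) (p : dualBox a b c α β γ × (ℕ × ℕ)) :
    gammaTerm γ ε w x (h.coneEquiv p) =
      expTwoPi ((w + pair p.1.1 x - pair α x) / (-ε * pair γ x)) *
        expTwoPi (-pair α x / (-ε * pair γ x)) ^ p.2.1 *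
        expTwoPi (pair β x / (-ε * pair γ x)) ^ p.2.2 := by
  have e : ((h.coneEquiv p : coneQuot γ a b 0 0) : (Fin 3 → ℤ) ⧸ AddSubgroup.zmultiples γ) =
    (((p.2.1 + 1 : ℤ) • α - (p.2.2 : ℤ) • β - p.1.1 : Fin 3 → ℤ) :
      (Fin 3 → ℤ) ⧸ AddSubgroup.zmultiples γ) := rfl
  have hε0 : (ε : ℂ) ≠ 0 := by
    intro h0
    have : ε = 0 := by exact_mod_cast h0
    simp [this] at hε
  have hinv : (ε : ℂ) / pair γ x = 1 / (ε * pair γ x) := by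
    have : (ε : ℂ) * ε = 1 := by exact_mod_cast hε
    rw [← this, mul_div_mul_left _ _ hε0]
  rw [e, gammaTerm_mk, gammaNum_factor, pair_sub, pair_sub, pair_zsmul, pair_zsmul,
    mul_div_right_comm, hinv]
  congr 1
  push_cast
  rw [neg_mul, div_neg, ← neg_div]
  ring

/-- The terms of the products that define `Γ_{a,b}` are absolutely summable. -/
lemma IsDualTriple.summable_norm_gammaTerm (h : IsDualTriple a b c α β γ) {ε : ℤ} (hε : ε * ε = 1)
    {x : Fin 3 → ℂ} (hα : 0 < (-pair α x / (-ε * pair γ x)).im)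
    (hβ : 0 < (pair β x / (-ε * pair γ x)).im) (w : ℂ) :
    Summable fun q : coneQuot γ a b 0 0 => ‖gammaTerm γ ε w x q‖ := by
  have : Finite (dualBox a b c α β γ) := h.finite_dualBox
  rw [← h.coneEquiv.summable_iff]
  refine Summable.congr ((Summable.of_finite (f := fun p : dualBox a b c α β γ =>
    ‖expTwoPi ((w + pair p.1 x - pair α x) / (-ε * pair γ x))‖)).mul_of_nonneg
    (summable_pow_mul_pow (norm_nonneg _) (norm_expTwoPi_lt_one hα) (norm_nonneg _)
      (norm_expTwoPi_lt_one hβ)) (fun _ => norm_nonneg _) fun _ => by positivity) fun p => ?_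
  rw [Function.comp_apply, h.gammaTerm_coneEquiv hε, norm_mul, norm_mul, norm_pow, norm_pow,
    mul_assoc]

lemma IsDualTriple.coneProd_eq (h : IsDualTriple a b c α β γ) {ε : ℤ} (hε : ε * ε = 1)
    {x : Fin 3 → ℂ} (hα : 0 < (-pair α x / (-ε * pair γ x)).im)
    (hβ : 0 < (pair β x / (-ε * pair γ x)).im) (w : ℂ) :
    coneProd γ a b 0 0 ε w x = ∏ δ ∈ h.finite_dualBox.toFinset,
      gammaNum (w + pair δ x) (pair α x) (pair β x) (-ε * pair γ x) := by
  have : Fintype (dualBox a b c α β γ) := h.finite_dualBox.fintype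
  have hs := h.summable_norm_gammaTerm hε hα hβ w
  rw [← h.coneEquiv.summable_iff] at hs
  have hm := multipliable_one_sub hs
  rw [coneProd, ← h.coneEquiv.tprod_eq]
  simp only [gammaFactor_eq]
  rw [Multipliable.tprod_prod' hm, tprod_fintype]
  · rw [Finset.prod_subtype (p := (· ∈ dualBox a b c α β γ)) _ fun δ => Set.Finite.mem_toFinset _]
    refine Finset.prod_congr rfl fun δ _ => ?_
    refine tprod_congr fun n => ?_
    rw [h.gammaTerm_coneEquiv hε]
  · intro δ
    exact multipliable_one_sub (hs.comp_injective (Prod.mk_right_injective δ))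

end

/-! ### Orientations and the primitive normal vector -/

section
variable {a b c α β γ : Fin 3 → ℤ} {x : Fin 3 → ℂ}

lemma im_pair_mul_conj (β γ : Fin 3 → ℤ) (x : Fin 3 → ℂ) :
    (pair β x * conj (pair γ x)).im = -orient (β ⨯₃ γ) x := by
  simp only [pair, orient, cross_apply, Fin.sum_univ_three, map_add, map_mul, map_intCast,
    Complex.add_re, Complex.add_im, Complex.mul_re, Complex.mul_im, Complex.intCast_re,
    Complex.intCast_im, Complex.conj_re, Complex.conj_im, Matrix.cons_val]
  push_cast
  ring

/-- If `β`, `γ` is an oriented pair of vectors in the plane `δ(a) = 0`, then `β(x)/γ(x)` lies in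
the upper half-plane for all `x ∈ U_a^+`. -/
lemma im_pair_div_pos {η : Fin 3 → ℤ} (hβ : β ⬝ᵥ a = 0) (hγ : γ ⬝ᵥ a = 0) (hη : 0 < η ⬝ᵥ a)
    (hdet : 0 < (Matrix.of ![η, β, γ]).det) (hx : x ∈ Uplus a) :
    0 < (pair β x / pair γ x).im := by
  have ha : a ≠ 0 := by rintro rfl; simp at hη
  rw [mem_Uplus_iff ha] at hx
  rw [im_div_pos_iff, im_pair_mul_conj]
  obtain ⟨D, hD⟩ : ∃ D, D = (Matrix.of ![η, β, γ]).det := ⟨_, rfl⟩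
  rw [← hD] at hdet
  rw [Matrix.det_fin_three] at hD
  simp only [Matrix.of_apply, Matrix.cons_val] at hD
  simp only [dotProduct, Fin.sum_univ_three] at hβ hγ hη
  have k : ∀ i, (η 0 * a 0 + η 1 * a 1 + η 2 * a 2) * (β ⨯₃ γ) i = D * a i := by
    intro i
    rw [hD]
    fin_cases i <;> simp [cross_apply]
    · linear_combination (η 1 * γ 2 - η 2 * γ 1) * hβ + (η 2 * β 1 - η 1 * β 2) * hγ
    · linear_combination (η 2 * γ 0 - η 0 * γ 2) * hβ + (η 0 * β 2 - η 2 * β 0) * hγ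
    · linear_combination (η 0 * γ 1 - η 1 * γ 0) * hβ + (η 1 * β 0 - η 0 * β 1) * hγ
  have k' : ∀ i, ((η 0 * a 0 + η 1 * a 1 + η 2 * a 2 : ℤ) : ℝ) * ((β ⨯₃ γ) i : ℤ) = (D : ℝ) * a i :=
    fun i => by exact_mod_cast k i
  have e : ((η 0 * a 0 + η 1 * a 1 + η 2 * a 2 : ℤ) : ℝ) * orient (β ⨯₃ γ) x = D * orient a x := by
    simp only [orient]
    linear_combination ((x 1).re * (x 2).im - (x 2).re * (x 1).im) * k' 0 +
      ((x 2).re * (x 0).im - (x 0).re * (x 2).im) * k' 1 +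
      ((x 0).re * (x 1).im - (x 1).re * (x 0).im) * k' 2
  have hη' : (0 : ℝ) < ((η 0 * a 0 + η 1 * a 1 + η 2 * a 2 : ℤ) : ℝ) := by exact_mod_cast hη
  have hD' : (0 : ℝ) < D := by exact_mod_cast hdet
  have := mul_neg_of_pos_of_neg hD' hx
  rw [← e] at this
  exact neg_pos.2 (neg_of_mul_neg_right this hη'.le)

lemma IsDualTriple.det_dual_pos (h : IsDualTriple a b c α β γ)
    (hd : 0 < (Matrix.of ![a, b, c]).det) : 0 < (Matrix.of ![α, β, γ]).det := by
  refine pos_of_mul_pos_left ?_ hd.le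
  rw [h.det_mul_det]
  exact mul_pos (mul_pos h.αa h.βb) h.γc

lemma IsDualTriple.im_div_pos (h : IsDualTriple a b c α β γ)
    (hd : 0 < (Matrix.of ![a, b, c]).det) (hx : x ∈ Uplus a) : 0 < (pair β x / pair γ x).im :=
  im_pair_div_pos h.βa h.γa h.αa (h.det_dual_pos hd) hx

lemma IsPrimitive.gcd_eq_one {v : Fin 3 → ℤ} (hv : IsPrimitive v) : Finset.univ.gcd v = 1 := by
  have h : v = Finset.univ.gcd v • fun i => v i / Finset.univ.gcd v := by
    funext i
    exact (Int.mul_ediv_cancel' (Finset.gcd_dvd (Finset.mem_univ i))).symm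
  have hu := hv _ _ h
  rw [← normalize_eq_one, Finset.normalize_gcd] at hu
  exact hu

lemma IsPrimitive.eq_of_smul_eq {u v : Fin 3 → ℤ} (hu : IsPrimitive u) (hv : IsPrimitive v)
    {m n : ℤ} (hm : 0 < m) (hn : 0 < n) (h : m • u = n • v) : u = v := by
  have e : ∀ (k : ℤ) (w : Fin 3 → ℤ), 0 < k → IsPrimitive w → Finset.univ.gcd (k • w) = k := by
    intro k w hk hw
    have := Finset.gcd_mul_left (s := Finset.univ) (f := w) (a := k)
    rw [hw.gcd_eq_one, mul_one, Int.normalize_of_nonneg hk.le] at this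
    exact this
  have hmn : m = n := by rw [← e m u hm hu, h, e n v hn hv]
  subst hmn
  exact smul_right_injective _ hm.ne' h

/-- The vector `γ_{a,b}` is characterised by primitivity and positive proportionality to
`det(a, b, ·)`. -/
lemma gam_eq_of_det (h : a ⨯₃ b ≠ 0) {v : Fin 3 → ℤ} (hv : IsPrimitive v) {m n : ℤ} (hm : 0 < m)
    (hn : 0 < n) (hd : ∀ c, m * (Matrix.of ![a, b, c]).det = n * (v ⬝ᵥ c)) : gam a b = v := by
  obtain ⟨hp, s, hs, e⟩ := gam_spec h
  refine hp.eq_of_smul_eq hv (mul_pos hm hs) hn ?_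
  refine dotProduct_eq _ _ fun c => ?_
  rw [smul_dotProduct, smul_dotProduct, smul_eq_mul, smul_eq_mul, mul_assoc, ← e, hd]

lemma cross_swap_ne_zero (h : a ⨯₃ b ≠ 0) : b ⨯₃ a ≠ 0 := by
  rw [← cross_anticomm a b]; exact neg_ne_zero.2 h

lemma IsPrimitive.neg {v : Fin 3 → ℤ} (hv : IsPrimitive v) : IsPrimitive (-v) := fun n b h =>
  hv n (-b) (by rw [smul_neg, ← h, neg_neg])

lemma gam_swap (h : a ⨯₃ b ≠ 0) : gam b a = -gam a b := by
  obtain ⟨hp, s, hs, e⟩ := gam_spec h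
  refine gam_eq_of_det (cross_swap_ne_zero h) hp.neg one_pos hs fun c => ?_
  have : (Matrix.of ![b, a, c]).det = -(Matrix.of ![a, b, c]).det := by
    rw [Matrix.det_fin_three, Matrix.det_fin_three]
    simp only [Matrix.of_apply, Matrix.cons_val]; ring
  rw [this, e, neg_dotProduct]; ring

lemma isPrimitive_vecMul (g : Matrix.SpecialLinearGroup (Fin 3) ℤ) {v : Fin 3 → ℤ}
    (hv : IsPrimitive v) : IsPrimitive (v ᵥ* g.1) := by
  intro n b h
  have hg : g.1 * (g⁻¹).1 = 1 := by rw [← Matrix.SpecialLinearGroup.coe_mul]; simp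
  refine hv n (b ᵥ* (g⁻¹).1) ?_
  rw [← Matrix.smul_vecMul, ← h, Matrix.vecMul_vecMul, hg, Matrix.vecMul_one]

lemma coe_mul_inv (g : Matrix.SpecialLinearGroup (Fin 3) ℤ) : g.1 * (g⁻¹).1 = 1 := by
  rw [← Matrix.SpecialLinearGroup.coe_mul]; simp

lemma coe_inv_mul (g : Matrix.SpecialLinearGroup (Fin 3) ℤ) : (g⁻¹).1 * g.1 = 1 := by
  rw [← Matrix.SpecialLinearGroup.coe_mul]; simp

lemma det_mulVec (g : Matrix.SpecialLinearGroup (Fin 3) ℤ) (a b c : Fin 3 → ℤ) :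
    (Matrix.of ![g.1 *ᵥ a, g.1 *ᵥ b, g.1 *ᵥ c]).det = (Matrix.of ![a, b, c]).det := by
  have e : Matrix.of ![g.1 *ᵥ a, g.1 *ᵥ b, g.1 *ᵥ c] = Matrix.of ![a, b, c] * g.1ᵀ := by
    ext i j
    have : (Matrix.of ![a, b, c] * g.1ᵀ) i j = (![a, b, c] i) ⬝ᵥ (g.1 j) := rfl
    rw [this, dotProduct_comm]
    fin_cases i <;> rfl
  rw [e, Matrix.det_mul, Matrix.det_transpose, g.2, mul_one]

lemma det_cross_pos (h : a ⨯₃ b ≠ 0) : 0 < (Matrix.of ![a, b, a ⨯₃ b]).det := by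
  have e : (Matrix.of ![a, b, a ⨯₃ b]).det = (a ⨯₃ b) ⬝ᵥ (a ⨯₃ b) := by
    rw [Matrix.det_fin_three]
    simp [cross_apply, dotProduct, Fin.sum_univ_three]
    ring
  rw [e]
  exact lt_of_le_of_ne (Finset.sum_nonneg fun i _ => mul_self_nonneg _)
    fun h0 => h (dotProduct_self_eq_zero.1 h0.symm)

lemma cross_eq_zero_iff_det : a ⨯₃ b = 0 ↔ ∀ c, (Matrix.of ![a, b, c]).det = 0 := by
  constructor
  · intro h c
    by_contra hc
    exact cross_ne_zero_of_det_ne_zero hc h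
  · intro h
    by_contra hn
    exact (det_cross_pos hn).ne' (h _)

lemma cross_mulVec_eq_zero_iff (g : Matrix.SpecialLinearGroup (Fin 3) ℤ) :
    (g.1 *ᵥ a) ⨯₃ (g.1 *ᵥ b) = 0 ↔ a ⨯₃ b = 0 := by
  rw [cross_eq_zero_iff_det, cross_eq_zero_iff_det]
  constructor
  · intro h c; rw [← det_mulVec g]; exact h _
  · intro h c
    have := h ((g⁻¹).1 *ᵥ c)
    rwa [← det_mulVec g, Matrix.mulVec_mulVec, coe_mul_inv, Matrix.one_mulVec] at this

lemma gam_mulVec (g : Matrix.SpecialLinearGroup (Fin 3) ℤ) (h : a ⨯₃ b ≠ 0) :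
    gam (g.1 *ᵥ a) (g.1 *ᵥ b) = gam a b ᵥ* (g⁻¹).1 := by
  obtain ⟨hp, s, hs, e⟩ := gam_spec h
  refine gam_eq_of_det ((cross_mulVec_eq_zero_iff g).not.2 h) (isPrimitive_vecMul _ hp) one_pos hs
    fun c => ?_
  have hc : c = g.1 *ᵥ ((g⁻¹).1 *ᵥ c) := by
    rw [Matrix.mulVec_mulVec, coe_mul_inv, Matrix.one_mulVec]
  rw [one_mul, ← Matrix.dotProduct_mulVec, ← e]
  conv_lhs => rw [hc]
  exact det_mulVec g _ _ _

/-! ### Transport of products over cones -/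

/-- A bijection of `Λ^∨` that is compatible with two cones and with the classes modulo `γ`, `γ'`
identifies the quotients of the cones. -/
noncomputable def coneQuotEquiv {a' b' γ' : Fin 3 → ℤ} {m n m' n' : ℤ} (ha : γ ⬝ᵥ a = 0)
    (hb : γ ⬝ᵥ b = 0) (ha' : γ' ⬝ᵥ a' = 0) (hb' : γ' ⬝ᵥ b' = 0) (f : (Fin 3 → ℤ) ≃ (Fin 3 → ℤ))
    (hf : ∀ δ δ' : Fin 3 → ℤ, (∃ n : ℤ, δ' = δ + n • γ) ↔ ∃ n : ℤ, f δ' = f δ + n • γ')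
    (hcone : ∀ δ, (m < δ ⬝ᵥ a ∧ δ ⬝ᵥ b ≤ n) ↔ (m' < f δ ⬝ᵥ a' ∧ f δ ⬝ᵥ b' ≤ n')) :
    coneQuot γ a b m n ≃ coneQuot γ' a' b' m' n' :=
  (Quotient.congr f (fun δ δ' => by
      have := hf δ δ'
      rw [← mk_eq_mk_iff, ← mk_eq_mk_iff] at this
      rw [← Quotient.eq, ← Quotient.eq]
      exact this) :
    (Fin 3 → ℤ) ⧸ AddSubgroup.zmultiples γ ≃ (Fin 3 → ℤ) ⧸ AddSubgroup.zmultiples γ').subtypeEquiv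
    (fun q => by
      induction q using QuotientAddGroup.induction_on with
      | H δ =>
      change (δ : (Fin 3 → ℤ) ⧸ AddSubgroup.zmultiples γ) ∈ _ ↔
        ((f δ : Fin 3 → ℤ) : (Fin 3 → ℤ) ⧸ AddSubgroup.zmultiples γ') ∈ _
      rw [mk_mem_coneQuot ha hb, mk_mem_coneQuot ha' hb']
      exact hcone δ)

lemma coneProd_congr {a' b' γ' : Fin 3 → ℤ} {m n m' n' ε ε' : ℤ} {w w' : ℂ} {x x' : Fin 3 → ℂ}
    (ha : γ ⬝ᵥ a = 0) (hb : γ ⬝ᵥ b = 0) (ha' : γ' ⬝ᵥ a' = 0) (hb' : γ' ⬝ᵥ b' = 0)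
    (f : (Fin 3 → ℤ) ≃ (Fin 3 → ℤ))
    (hf : ∀ δ δ' : Fin 3 → ℤ, (∃ n : ℤ, δ' = δ + n • γ) ↔ ∃ n : ℤ, f δ' = f δ + n • γ')
    (hcone : ∀ δ, (m < δ ⬝ᵥ a ∧ δ ⬝ᵥ b ≤ n) ↔ (m' < f δ ⬝ᵥ a' ∧ f δ ⬝ᵥ b' ≤ n'))
    (hfac : ∀ δ : Fin 3 → ℤ, ε * (pair δ x - w) / pair γ x =
      ε' * (pair (f δ) x' - w') / pair γ' x') :
    ((Summable fun q : coneQuot γ a b m n => ‖gammaTerm γ ε w x q‖) ↔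
      Summable fun q : coneQuot γ' a' b' m' n' => ‖gammaTerm γ' ε' w' x' q‖) ∧
    coneProd γ a b m n ε w x = coneProd γ' a' b' m' n' ε' w' x' := by
  have key : ∀ q : coneQuot γ a b m n, gammaTerm γ ε w x q =
      gammaTerm γ' ε' w' x' (coneQuotEquiv ha hb ha' hb' f hf hcone q) := by
    rintro ⟨q, hq⟩
    induction q using QuotientAddGroup.induction_on with
    | H δ =>
    change gammaTerm γ ε w x δ = gammaTerm γ' ε' w' x' (f δ : Fin 3 → ℤ)
    rw [gammaTerm_mk, gammaTerm_mk, hfac]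
  constructor
  · rw [← (coneQuotEquiv ha hb ha' hb' f hf hcone).summable_iff]
    refine summable_congr fun q => ?_
    rw [key]; rfl
  · rw [coneProd, coneProd, ← (coneQuotEquiv ha hb ha' hb' f hf hcone).tprod_eq]
    refine tprod_congr fun q => ?_
    rw [gammaFactor_eq, gammaFactor_eq, key]

lemma coneProd_neg (ha : γ ⬝ᵥ a = 0) (hb : γ ⬝ᵥ b = 0) (m n ε : ℤ) (w : ℂ) (x : Fin 3 → ℂ) :
    ((Summable fun q : coneQuot γ a b m n => ‖gammaTerm γ ε w x q‖) ↔
      Summable fun q : coneQuot (-γ) a b m n => ‖gammaTerm (-γ) (-ε) w x q‖) ∧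
    coneProd γ a b m n ε w x = coneProd (-γ) a b m n (-ε) w x := by
  refine coneProd_congr ha hb (by rw [neg_dotProduct, ha, neg_zero])
    (by rw [neg_dotProduct, hb, neg_zero]) (Equiv.refl _) (fun δ δ' => ?_) (fun _ => Iff.rfl)
    fun δ => ?_
  · constructor <;> rintro ⟨n, hn⟩ <;> exact ⟨-n, by simpa using hn⟩
  · rw [pair_neg, Int.cast_neg, div_neg, neg_mul, neg_div, neg_neg]; rfl

end

section
variable {a b : Fin 3 → ℤ} {x : Fin 3 → ℂ}

/-- The product over the cone `δ(a) > m`, `δ(b) ≤ n` that enters `Γ_{a,b}` and its translates. -/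
noncomputable def coneNum (a b : Fin 3 → ℤ) (m n : ℤ) (w : ℂ) (x : Fin 3 → ℂ) : ℂ :=
  coneProd (gam a b) a b m n (-1) w x

/-- The denominator of `Γ_{a,b}` is the numerator of `Γ_{b,a}`. -/
lemma coneNum_swap (h : a ⨯₃ b ≠ 0) (m n : ℤ) (w : ℂ) (x : Fin 3 → ℂ) :
    coneNum b a n m w x = coneProd (gam a b) b a n m 1 w x := by
  rw [coneNum, gam_swap h, (coneProd_neg (gam_dot_right h) (gam_dot_left h) n m 1 w x).2]

lemma Gam_eq (a b : Prim) (h : a.1 ⨯₃ b.1 ≠ 0) (w : ℂ) (x : Fin 3 → ℂ) :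
    Gam a b w x = coneNum a.1 b.1 0 0 w x / coneNum b.1 a.1 0 0 w x := by
  rw [Gam, if_neg h, coneNum_swap h, div_eq_mul_inv]; rfl

lemma Gam_inv (a b : Prim) (w : ℂ) (x : Fin 3 → ℂ) : Gam a b w x = (Gam b a w x)⁻¹ := by
  by_cases h : a.1 ⨯₃ b.1 = 0
  · have h' : b.1 ⨯₃ a.1 = 0 := by rw [← cross_anticomm, h, neg_zero]
    rw [Gam, Gam, if_pos h, if_pos h', inv_one]
  · rw [Gam_eq a b h, Gam_eq b a (cross_swap_ne_zero h), inv_div]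

/-- Translation in `w` by `μ(x)` moves the cone. -/
lemma coneNum_add (h : a ⨯₃ b ≠ 0) (m n : ℤ) (μ : Fin 3 → ℤ) (w : ℂ) (x : Fin 3 → ℂ) :
    coneNum a b m n (w + pair μ x) x = coneNum a b (m - μ ⬝ᵥ a) (n - μ ⬝ᵥ b) w x := by
  refine (coneProd_congr (gam_dot_left h) (gam_dot_right h) (gam_dot_left h) (gam_dot_right h)
    (Equiv.subRight μ) (fun δ δ' => ?_) (fun δ => ?_) fun δ => ?_).2
  · refine exists_congr fun k => ?_
    rw [Equiv.subRight_apply, Equiv.subRight_apply, sub_eq_iff_eq_add, add_right_comm,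
      sub_add_cancel]
  · rw [Equiv.subRight_apply, sub_dotProduct, sub_dotProduct]
    constructor <;> rintro ⟨h1, h2⟩ <;> constructor <;> linarith
  · rw [Equiv.subRight_apply, pair_sub]; ring

lemma pair_matAct (δ : Fin 3 → ℤ) (g : Matrix.SpecialLinearGroup (Fin 3) ℤ) (x : Fin 3 → ℂ) :
    pair δ (matAct g x) = pair (δ ᵥ* g.1) x := pair_mul δ g.1 x

lemma vecMul_dot (δ v : Fin 3 → ℤ) (g : Matrix (Fin 3) (Fin 3) ℤ) :
    (δ ᵥ* g) ⬝ᵥ v = δ ⬝ᵥ (g *ᵥ v) := (Matrix.dotProduct_mulVec δ g v).symm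

lemma coneNum_matAct (h : a ⨯₃ b ≠ 0) (g : Matrix.SpecialLinearGroup (Fin 3) ℤ) (m n : ℤ) (w : ℂ)
    (x : Fin 3 → ℂ) :
    coneNum (g.1 *ᵥ a) (g.1 *ᵥ b) m n w (matAct g x) = coneNum a b m n w x := by
  have hg := (cross_mulVec_eq_zero_iff (a := a) (b := b) g).not.2 h
  have e1 : ∀ δ : Fin 3 → ℤ, (δ ᵥ* g.1) ᵥ* (g⁻¹).1 = δ := fun δ => by
    rw [Matrix.vecMul_vecMul, coe_mul_inv, Matrix.vecMul_one]
  have e2 : ∀ δ : Fin 3 → ℤ, (δ ᵥ* (g⁻¹).1) ᵥ* g.1 = δ := fun δ => by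
    rw [Matrix.vecMul_vecMul, coe_inv_mul, Matrix.vecMul_one]
  have eγ : gam (g.1 *ᵥ a) (g.1 *ᵥ b) ᵥ* g.1 = gam a b := by rw [gam_mulVec g h, e2]
  refine (coneProd_congr (gam_dot_left hg) (gam_dot_right hg) (gam_dot_left h) (gam_dot_right h)
    ⟨fun δ => δ ᵥ* g.1, fun δ => δ ᵥ* (g⁻¹).1, e1, e2⟩ (fun δ δ' => ?_) (fun δ => ?_) fun δ => ?_).2
  · refine exists_congr fun k => ?_
    change _ ↔ δ' ᵥ* g.1 = δ ᵥ* g.1 + k • gam a b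
    rw [← eγ, ← Matrix.smul_vecMul, ← Matrix.add_vecMul]
    exact ⟨fun e => by rw [e], fun e => by rw [← e1 δ', e, e1]⟩
  · change _ ↔ m < (δ ᵥ* g.1) ⬝ᵥ a ∧ (δ ᵥ* g.1) ⬝ᵥ b ≤ n
    rw [vecMul_dot, vecMul_dot]
  · rw [pair_matAct, pair_matAct, eγ]; rfl

lemma Gam_matAct (s : ISL3) (a b : Prim) (w : ℂ) (x : Fin 3 → ℂ) :
    Gam (s • a) (s • b) w (matAct s.g x) = Gam a b w x := by
  by_cases h : a.1 ⨯₃ b.1 = 0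
  · have h' : (s • a).1 ⨯₃ (s • b).1 = 0 := (cross_mulVec_eq_zero_iff s.g).2 h
    rw [Gam, Gam, if_pos h, if_pos h']
  · have h' : (s • a).1 ⨯₃ (s • b).1 ≠ 0 := (cross_mulVec_eq_zero_iff s.g).not.2 h
    rw [Gam_eq _ _ h', Gam_eq _ _ h]
    change coneNum (s.g.1 *ᵥ a.1) (s.g.1 *ᵥ b.1) 0 0 w (matAct s.g x) /
      coneNum (s.g.1 *ᵥ b.1) (s.g.1 *ᵥ a.1) 0 0 w (matAct s.g x) = _
    rw [coneNum_matAct h, coneNum_matAct (cross_swap_ne_zero h)]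

/-! ### Convergence on `U_a^+ ∩ U_b^+` -/

/-- A dual triple adapted to `γ_{a,b}`; the two inequalities are those that make the product over
the cone converge. -/
lemma exists_dualTriple_im_pos (h : a ⨯₃ b ≠ 0) : ∃ c α β, IsDualTriple a b c α β (gam a b) ∧
    ∀ x, x ∈ Uplus a → x ∈ Uplus b → 0 < (-pair α x / (-(-1 : ℤ) * pair (gam a b) x)).im ∧
      0 < (pair β x / (-(-1 : ℤ) * pair (gam a b) x)).im := by
  have hd := det_cross_pos h
  have ht := isDualTriple_gam hd
  refine ⟨_, _, _, ht, fun x hxa hxb => ?_⟩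
  have e : (-(-1 : ℤ) * pair (gam a b) x : ℂ) = pair (gam a b) x := by push_cast; ring
  rw [e]
  exact ⟨im_neg_div_pos (ht.cyclic.im_div_pos (by rwa [← det_cyclic]) hxb), ht.im_div_pos hd hxa⟩

lemma summable_norm_gammaTerm (h : a ⨯₃ b ≠ 0) (hxa : x ∈ Uplus a) (hxb : x ∈ Uplus b) (m n : ℤ)
    (w : ℂ) : Summable fun q : coneQuot (gam a b) a b m n => ‖gammaTerm (gam a b) (-1) w x q‖ := by
  obtain ⟨c, α, β, ht, hx⟩ := exists_dualTriple_im_pos h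
  have hs := ht.summable_norm_gammaTerm (ε := -1) (by norm_num) (hx x hxa hxb).1 (hx x hxa hxb).2 w
  -- a translation by a multiple of `α - β` moves the given cone into the cone `δ(a) > 0 ≥ δ(b)`
  set N : ℤ := |m| + |n| with hN
  set ν : Fin 3 → ℤ := N • (α - β) with hν
  have ν1 : -m ≤ ν ⬝ᵥ a := by
    have h1 := ht.αa
    have h2 : ν ⬝ᵥ a = N * (α ⬝ᵥ a) := by
      rw [hν, smul_dotProduct, sub_dotProduct, ht.βa, sub_zero, smul_eq_mul]
    have h3 : 0 ≤ N := by positivity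
    have h4 : -m ≤ N := (neg_le_abs m).trans (le_add_of_nonneg_right (abs_nonneg n))
    rw [h2]; nlinarith
  have ν2 : ν ⬝ᵥ b ≤ -n := by
    have h1 := ht.βb
    have h2 : ν ⬝ᵥ b = -(N * (β ⬝ᵥ b)) := by
      rw [hν, smul_dotProduct, sub_dotProduct, ht.αb, zero_sub, smul_eq_mul, mul_neg]
    have h3 : 0 ≤ N := by positivity
    have h4 : n ≤ N := (le_abs_self n).trans (le_add_of_nonneg_left (abs_nonneg m))
    rw [h2]; nlinarith
  have hmem : ∀ q : coneQuot (gam a b) a b m n,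
      (q : (Fin 3 → ℤ) ⧸ AddSubgroup.zmultiples (gam a b)) +
        ((ν : Fin 3 → ℤ) : (Fin 3 → ℤ) ⧸ AddSubgroup.zmultiples (gam a b)) ∈
        coneQuot (gam a b) a b 0 0 := by
    rintro ⟨q, hq⟩
    induction q using QuotientAddGroup.induction_on with
    | H δ =>
    rw [mk_mem_coneQuot ht.γa ht.γb] at hq
    change (((δ + ν : Fin 3 → ℤ)) : (Fin 3 → ℤ) ⧸ AddSubgroup.zmultiples (gam a b)) ∈ _
    rw [mk_mem_coneQuot ht.γa ht.γb, add_dotProduct, add_dotProduct]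
    exact ⟨by linarith [hq.1], by linarith [hq.2]⟩
  have hinj : Function.Injective fun q : coneQuot (gam a b) a b m n =>
      (⟨_, hmem q⟩ : coneQuot (gam a b) a b 0 0) := by
    intro q q' e
    exact Subtype.ext (add_right_cancel (Subtype.ext_iff.1 e))
  refine ((hs.comp_injective hinj).mul_left ‖expTwoPi (pair ν x / pair (gam a b) x)‖).congr
    fun q => ?_
  rw [Function.comp_apply, ← norm_mul]
  congr 1
  obtain ⟨q, hq⟩ := q
  induction q using QuotientAddGroup.induction_on with
  | H δ =>
  change _ * gammaTerm (gam a b) (-1) w x ((δ + ν : Fin 3 → ℤ)) = gammaTerm (gam a b) (-1) w x δ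
  rw [gammaTerm_mk, gammaTerm_mk, pair_add, ← expTwoPi_add]
  congr 1
  push_cast
  ring

lemma multipliable_gammaFactor (h : a ⨯₃ b ≠ 0) (hxa : x ∈ Uplus a) (hxb : x ∈ Uplus b) (m n : ℤ)
    (w : ℂ) : Multipliable fun q : coneQuot (gam a b) a b m n => gammaFactor (gam a b) (-1) w x q := by
  simp only [gammaFactor_eq]
  exact multipliable_one_sub (summable_norm_gammaTerm h hxa hxb m n w)

lemma multipliable_gammaFactor_swap (h : a ⨯₃ b ≠ 0) (hxa : x ∈ Uplus a) (hxb : x ∈ Uplus b)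
    (m n : ℤ) (w : ℂ) :
    Multipliable fun q : coneQuot (gam a b) b a n m => gammaFactor (gam a b) 1 w x q := by
  have := summable_norm_gammaTerm (cross_swap_ne_zero h) hxb hxa n m w
  simp only [gammaFactor_eq]
  refine multipliable_one_sub ?_
  rw [gam_swap h] at this
  exact (coneProd_neg (gam_dot_right h) (gam_dot_left h) n m 1 w x).1.2 this

lemma pair_gam_ne_zero (h : a ⨯₃ b ≠ 0) (hxa : x ∈ Uplus a) : pair (gam a b) x ≠ 0 :=
  right_ne_zero_of_im_div_pos ((isDualTriple_gam (det_cross_pos h)).im_div_pos (det_cross_pos h) hxa)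

end

/-! ### Adapted bases and rows of a cone -/

section
variable {a b c : Fin 3 → ℤ} {x : Fin 3 → ℂ}

/-- The countable set of all `δ(x)`, `δ ∈ Λ^∨`; for fixed `x` all zeros and poles in `w` of the
functions `Γ_{a,b}` and `Δ_a` belong to it. -/
def latticePoints (x : Fin 3 → ℂ) : Set ℂ := Set.range fun δ : Fin 3 → ℤ => pair δ x

lemma countable_latticePoints (x : Fin 3 → ℂ) : (latticePoints x).Countable :=
  Set.countable_range _

lemma add_pair_notMem_latticePoints {w : ℂ} (hw : w ∉ latticePoints x) (μ : Fin 3 → ℤ) :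
    w + pair μ x ∉ latticePoints x := by
  rintro ⟨δ, hδ⟩
  exact hw ⟨δ - μ, by simp only at hδ ⊢; rw [pair_sub, hδ]; ring⟩

lemma coneNum_ne_zero (h : a ⨯₃ b ≠ 0) (hxa : x ∈ Uplus a) (hxb : x ∈ Uplus b) (m n : ℤ) {w : ℂ}
    (hw : w ∉ latticePoints x) : coneNum a b m n w x ≠ 0 := by
  simp only [coneNum, coneProd, gammaFactor_eq]
  refine tprod_one_sub_ne_zero (summable_norm_gammaTerm h hxa hxb m n w) ?_
  rintro ⟨q, hq⟩ e
  induction q using QuotientAddGroup.induction_on with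
  | H δ =>
  rw [gammaTerm_mk, expTwoPi_eq_one_iff] at e
  obtain ⟨k, hk⟩ := e
  rw [div_eq_iff (pair_gam_ne_zero h hxa)] at hk
  refine hw ⟨δ + k • gam a b, ?_⟩
  simp only
  rw [pair_add, pair_zsmul]
  push_cast at hk
  linear_combination -hk

lemma vecMul_eq_rows (c : Fin 3 → ℤ) (M : Matrix (Fin 3) (Fin 3) ℤ) :
    c ᵥ* M = c 0 • M 0 + c 1 • M 1 + c 2 • M 2 := by
  ext j
  simp [Matrix.vecMul, dotProduct, Fin.sum_univ_three]

section
variable {M : Matrix.SpecialLinearGroup (Fin 3) ℤ} (hM : M.1 *ᵥ a = ![1, 0, 0])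
include hM

lemma row_zero_dot : M.1 0 ⬝ᵥ a = 1 := congrFun hM 0

lemma row_one_dot : M.1 1 ⬝ᵥ a = 0 := congrFun hM 1

lemma row_two_dot : M.1 2 ⬝ᵥ a = 0 := congrFun hM 2

lemma exists_row_coords (δ : Fin 3 → ℤ) :
    ∃ k l : ℤ, δ = (δ ⬝ᵥ a) • M.1 0 + k • M.1 1 + l • M.1 2 := by
  have e : (δ ᵥ* (M⁻¹).1) ᵥ* M.1 = δ := by
    rw [Matrix.vecMul_vecMul, coe_inv_mul, Matrix.vecMul_one]
  have e0 : (δ ᵥ* (M⁻¹).1) 0 = δ ⬝ᵥ a := by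
    conv_rhs => rw [← e, vecMul_dot, hM]
    simp [dotProduct, Fin.sum_univ_three]
  refine ⟨(δ ᵥ* (M⁻¹).1) 1, (δ ᵥ* (M⁻¹).1) 2, ?_⟩
  rw [← e0, ← vecMul_eq_rows, e]

lemma im_rows_div_pos (hx : x ∈ Uplus a) : 0 < (pair (M.1 1) x / pair (M.1 2) x).im := by
  refine im_pair_div_pos (η := M.1 0) (row_one_dot hM) (row_two_dot hM)
    (by rw [row_zero_dot hM]; exact one_pos) ?_ hx
  have : Matrix.of ![M.1 0, M.1 1, M.1 2] = M.1 := by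
    ext i j; fin_cases i <;> rfl
  rw [this, M.2]
  exact one_pos

end

lemma exists_dual_vector (M : Matrix.SpecialLinearGroup (Fin 3) ℤ) :
    ∃ u : Fin 3 → ℤ, M.1 1 ⬝ᵥ u = 1 ∧ M.1 2 ⬝ᵥ u = 0 := by
  have : M.1 *ᵥ ((M⁻¹).1 *ᵥ ![0, 1, 0]) = ![0, 1, 0] := by
    rw [Matrix.mulVec_mulVec, coe_mul_inv, Matrix.one_mulVec]
  exact ⟨_, congrFun this 1, congrFun this 2⟩

/-- Any primitive vector in the plane `δ(a) = 0` is the last vector of an adapted basis. -/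
lemma exists_adapted_basis {M : Matrix.SpecialLinearGroup (Fin 3) ℤ} (hM : M.1 *ᵥ a = ![1, 0, 0])
    {γ : Fin 3 → ℤ} (hγ : IsPrimitive γ) (hγa : γ ⬝ᵥ a = 0) :
    ∃ M' : Matrix.SpecialLinearGroup (Fin 3) ℤ, M'.1 *ᵥ a = ![1, 0, 0] ∧ M'.1 2 = γ := by
  obtain ⟨k, l, e⟩ := exists_row_coords hM γ
  rw [hγa, zero_smul, zero_add] at e
  have hkl : IsCoprime k l := by
    rw [Int.isCoprime_iff_gcd_eq_one]
    obtain ⟨k', hk'⟩ := Int.gcd_dvd_left k l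
    obtain ⟨l', hl'⟩ := Int.gcd_dvd_right k l
    have := hγ (Int.gcd k l) (k' • M.1 1 + l' • M.1 2) (by
      rw [smul_add, smul_smul, smul_smul, ← hk', ← hl']; exact e)
    rw [Int.isUnit_iff_natAbs_eq] at this
    simpa using this
  obtain ⟨p, q, hpq⟩ := hkl
  -- the rows `(q, -p)`, `(k, l)` have determinant `q l + p k = 1`
  let P : Matrix.SpecialLinearGroup (Fin 3) ℤ := ⟨!![1, 0, 0; 0, q, -p; 0, k, l], by
    rw [Matrix.det_fin_three]; simp; linear_combination hpq⟩
  refine ⟨P * M, ?_, ?_⟩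
  · rw [Matrix.SpecialLinearGroup.coe_mul, ← Matrix.mulVec_mulVec, hM]
    ext i; fin_cases i <;> simp [P, Matrix.mulVec, dotProduct, Fin.sum_univ_three]
  · have : (P * M).1 2 = ![0, k, l] ᵥ* M.1 := rfl
    rw [this, vecMul_eq_rows, e]
    simp

lemma row_one_dot_pos (h : a ⨯₃ b ≠ 0) {M : Matrix.SpecialLinearGroup (Fin 3) ℤ}
    (hM : M.1 *ᵥ a = ![1, 0, 0]) (hM2 : M.1 2 = gam a b) : 0 < M.1 1 ⬝ᵥ b := by
  have hv := gam_dot_pos (det_cross_pos h)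
  have hd := det_cross_pos h
  rw [← det_mulVec M, Matrix.det_fin_three, hM] at hd
  have e1 : (M.1 *ᵥ b) 2 = 0 := by
    change M.1 2 ⬝ᵥ b = 0
    rw [hM2, gam_dot_right h]
  have e2 : (M.1 *ᵥ (a ⨯₃ b)) 2 = gam a b ⬝ᵥ (a ⨯₃ b) := by rw [← hM2]; rfl
  simp only [Matrix.of_apply, Matrix.cons_val, e1, e2] at hd
  have e3 : (M.1 *ᵥ b) 1 = M.1 1 ⬝ᵥ b := rfl
  rw [e3] at hd
  simp only [one_mul, mul_zero, zero_mul, sub_zero, add_zero] at hd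
  exact pos_of_mul_pos_left hd hv.le

lemma coneProd_union_range {γ a b : Fin 3 → ℤ} {m n m' n' ε : ℤ} {w : ℂ} {x : Fin 3 → ℂ}
    {r : ℕ → (Fin 3 → ℤ) ⧸ AddSubgroup.zmultiples γ} (hr : Function.Injective r)
    (hd : Disjoint (coneQuot γ a b m' n') (Set.range r))
    (hu : coneQuot γ a b m n = coneQuot γ a b m' n' ∪ Set.range r)
    (hm : Multipliable fun q : coneQuot γ a b m' n' => gammaFactor γ ε w x q)
    (hm' : Multipliable fun j => gammaFactor γ ε w x (r j)) :
    coneProd γ a b m n ε w x = coneProd γ a b m' n' ε w x * ∏' j, gammaFactor γ ε w x (r j) := by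
  have hm'' : Multipliable fun q : Set.range r => gammaFactor γ ε w x q :=
    (Equiv.multipliable_iff (f := fun q : Set.range r => gammaFactor γ ε w x q)
      (Equiv.ofInjective r hr)).1 hm'
  rw [coneProd, coneProd, hu, Multipliable.tprod_union_disjoint (f := gammaFactor γ ε w x) hd hm hm'',
    tprod_range _ hr]

/-- Removing the row `δ(a) = m` from the cones that define (the numerator and denominator of) a
translate of `Γ_{a,b}` splits off a theta function. -/
lemma exists_coneNum_row (h : a ⨯₃ b ≠ 0) {M : Matrix.SpecialLinearGroup (Fin 3) ℤ}
    (hM : M.1 *ᵥ a = ![1, 0, 0]) (hM2 : M.1 2 = gam a b) (m n : ℤ) :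
    ∃ δ₀ : Fin 3 → ℤ, δ₀ ⬝ᵥ a = m ∧ ∀ x, x ∈ Uplus a → x ∈ Uplus b → ∀ w, ∃ A B : ℂ,
      coneNum a b (m - 1) n w x = coneNum a b m n w x * A ∧
      coneNum b a n m w x = coneNum b a n (m - 1) w x * B ∧
      A * B = theta0 ((w - pair δ₀ x) / pair (M.1 2) x) (pair (M.1 1) x / pair (M.1 2) x) := by
  have hs := row_one_dot_pos h hM hM2
  have ha0 := row_zero_dot hM
  have ha1 := row_one_dot hM
  have ha2 := row_two_dot hM
  have hb2 : M.1 2 ⬝ᵥ b = 0 := by rw [hM2, gam_dot_right h]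
  obtain ⟨u, hu1, hu2⟩ := exists_dual_vector M
  set s := M.1 1 ⬝ᵥ b with hs_def
  -- the last class `k₀` in the row with `δ(b) ≤ n`
  set k₀ := (n - m * (M.1 0 ⬝ᵥ b)) / s with hk₀
  have hk1 : k₀ * s ≤ n - m * (M.1 0 ⬝ᵥ b) := Int.ediv_mul_le _ hs.ne'
  have hk2 : n - m * (M.1 0 ⬝ᵥ b) < (k₀ + 1) * s := Int.lt_ediv_add_one_mul_self _ hs
  let δ : ℤ → Fin 3 → ℤ := fun k => m • M.1 0 + k • M.1 1
  have δa : ∀ k, δ k ⬝ᵥ a = m := fun k => by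
    simp only [δ, add_dotProduct, smul_dotProduct, ha0, ha1, smul_eq_mul]; ring
  have δb : ∀ k, δ k ⬝ᵥ b = m * (M.1 0 ⬝ᵥ b) + k * s := fun k => by
    simp only [δ, add_dotProduct, smul_dotProduct, smul_eq_mul, hs_def]
  have δu : ∀ k, δ k ⬝ᵥ u = m * (M.1 0 ⬝ᵥ u) + k := fun k => by
    simp only [δ, add_dotProduct, smul_dotProduct, smul_eq_mul, hu1, mul_one]
  have δx : ∀ k x, pair (δ k) x = m * pair (M.1 0) x + k * pair (M.1 1) x := fun k x => by
    simp only [δ, pair_add, pair_zsmul]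
  have hle : ∀ k, δ k ⬝ᵥ b ≤ n ↔ k ≤ k₀ := by
    intro k
    rw [δb]
    constructor
    · intro hk; by_contra hc; push Not at hc; nlinarith
    · intro hk; nlinarith
  -- every `δ` with `δ(a) = m` is congruent to some `δ k`
  have hrow : ∀ η : Fin 3 → ℤ, η ⬝ᵥ a = m → ∃ k l : ℤ, η = δ k + l • M.1 2 := by
    intro η hη
    obtain ⟨k, l, e⟩ := exists_row_coords hM η
    rw [hη] at e
    exact ⟨k, l, e⟩
  have hinj : ∀ {γ : Fin 3 → ℤ}, γ ⬝ᵥ u = 0 → ∀ k k' : ℤ,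
      (δ k : (Fin 3 → ℤ) ⧸ AddSubgroup.zmultiples γ) = δ k' → k = k' := by
    intro γ hγ k k' e
    obtain ⟨l, hl⟩ := mk_eq_mk_iff.1 e
    have := congrArg (· ⬝ᵥ u) hl
    simp only [add_zsmul_dot hγ, δu] at this
    linarith
  have hg := gam_swap h
  have g1 := gam_dot_left h
  have g2 := gam_dot_right h
  have h' := cross_swap_ne_zero h
  have g1' := gam_dot_left h'
  have g2' := gam_dot_right h'
  have gu : gam a b ⬝ᵥ u = 0 := by rw [← hM2, hu2]
  have gu' : gam b a ⬝ᵥ u = 0 := by rw [hg, neg_dotProduct, gu, neg_zero]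
  refine ⟨δ k₀, δa _, fun x hxa hxb w => ?_⟩
  have hτ := im_rows_div_pos hM hxa
  set τ := pair (M.1 1) x / pair (M.1 2) x with hτ_def
  set z := (w - pair (δ k₀) x) / pair (M.1 2) x with hz
  have hp0 : pair (M.1 2) x ≠ 0 := by rw [hM2]; exact pair_gam_ne_zero h hxa
  have hq := norm_expTwoPi_lt_one hτ
  have fA : ∀ j : ℕ, gammaFactor (gam a b) (-1) w x (δ (k₀ - j)) =
      1 - expTwoPi z * expTwoPi τ ^ j := by
    intro j
    rw [gammaFactor_eq, gammaTerm_mk, ← expTwoPi_natCast_mul, ← expTwoPi_add, ← hM2]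
    congr 2
    rw [hz, hτ_def, δx, δx]
    push_cast
    field_simp
    ring
  have fB : ∀ j : ℕ, gammaFactor (gam b a) (-1) w x (δ (k₀ + 1 + j)) =
      1 - expTwoPi (τ - z) * expTwoPi τ ^ j := by
    intro j
    rw [gammaFactor_eq, gammaTerm_mk, ← expTwoPi_natCast_mul, ← expTwoPi_add, hg, ← hM2, pair_neg]
    congr 2
    rw [hz, hτ_def, δx, δx]
    push_cast
    field_simp
    ring
  refine ⟨qPoch (expTwoPi z) (expTwoPi τ), qPoch (expTwoPi (τ - z)) (expTwoPi τ), ?_, ?_, ?_⟩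
  · rw [coneNum, coneProd_union_range (m := m - 1) (n := n) (m' := m) (n' := n)
      (r := fun j : ℕ => (δ (k₀ - j) : (Fin 3 → ℤ) ⧸ AddSubgroup.zmultiples (gam a b))) ?_ ?_ ?_
      (multipliable_gammaFactor h hxa hxb _ _ _) ?_]
    · simp only [fA]; rfl
    · intro j j' e
      have := hinj gu _ _ e
      omega
    · rw [Set.disjoint_right]
      rintro _ ⟨j, rfl⟩ hj
      rw [mk_mem_coneQuot g1 g2, δa] at hj
      exact lt_irrefl _ hj.1
    · ext q
      induction q using QuotientAddGroup.induction_on with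
      | H η =>
      rw [Set.mem_union, mk_mem_coneQuot g1 g2, mk_mem_coneQuot g1 g2, Set.mem_range]
      constructor
      · rintro ⟨e1, e2⟩
        rcases (show m ≤ η ⬝ᵥ a by omega).lt_or_eq with e | e
        · exact Or.inl ⟨e, e2⟩
        · right
          obtain ⟨k, l, rfl⟩ := hrow η e.symm
          rw [add_zsmul_dot hb2, hle] at e2
          refine ⟨(k₀ - k).toNat, mk_eq_mk_iff.2 ⟨l, ?_⟩⟩
          rw [Int.toNat_of_nonneg (by omega), sub_sub_cancel, hM2]
      · rintro (⟨e1, e2⟩ | ⟨j, e⟩)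
        · exact ⟨by omega, e2⟩
        · obtain ⟨l, rfl⟩ := mk_eq_mk_iff.1 e
          rw [add_zsmul_dot g1, add_zsmul_dot g2, δa, hle]
          constructor <;> omega
    · simp only [fA]; exact multipliable_one_sub (summable_norm_qPoch hq _)
  · rw [coneNum, coneProd_union_range (m := n) (n := m) (m' := n) (n' := m - 1)
      (r := fun j : ℕ => (δ (k₀ + 1 + j) : (Fin 3 → ℤ) ⧸ AddSubgroup.zmultiples (gam b a))) ?_ ?_ ?_
      (multipliable_gammaFactor h' hxb hxa _ _ _) ?_]
    · simp only [fB]; rfl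
    · intro j j' e
      have := hinj gu' _ _ e
      omega
    · rw [Set.disjoint_right]
      rintro _ ⟨j, rfl⟩ hj
      rw [mk_mem_coneQuot g1' g2', δa] at hj
      omega
    · ext q
      induction q using QuotientAddGroup.induction_on with
      | H η =>
      rw [Set.mem_union, mk_mem_coneQuot g1' g2', mk_mem_coneQuot g1' g2', Set.mem_range]
      constructor
      · rintro ⟨e1, e2⟩
        rcases e2.lt_or_eq with e | e
        · exact Or.inl ⟨e1, by omega⟩
        · right
          obtain ⟨k, l, rfl⟩ := hrow η e
          rw [add_zsmul_dot hb2, ← not_le, hle] at e1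
          refine ⟨(k - (k₀ + 1)).toNat, mk_eq_mk_iff.2 ⟨-l, ?_⟩⟩
          rw [Int.toNat_of_nonneg (by omega), add_sub_cancel, hg, hM2, neg_smul_neg]
      · rintro (⟨e1, e2⟩ | ⟨j, e⟩)
        · exact ⟨e1, by omega⟩
        · obtain ⟨l, rfl⟩ := mk_eq_mk_iff.1 e
          rw [add_zsmul_dot g1', add_zsmul_dot g2', δa, ← not_le, hle]
          constructor <;> omega
    · simp only [fB]; exact multipliable_one_sub (summable_norm_qPoch hq _)
  · rw [theta0_eq hτ, mul_comm]

/-! ### The relation for three vectors -/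

/-- Dependent primitive vectors are equal or opposite, and `U_a^+`, `U_{-a}^+` are disjoint. -/
lemma eq_of_cross_eq_zero {a b : Prim} (h : a.1 ⨯₃ b.1 = 0) (hxa : x ∈ Uplus a.1)
    (hxb : x ∈ Uplus b.1) : a = b := by
  rw [mem_Uplus_iff a.2.ne_zero] at hxa
  rw [mem_Uplus_iff b.2.ne_zero] at hxb
  have c0 := congrFun h 0
  have c1 := congrFun h 1
  have c2 := congrFun h 2
  simp [cross_apply] at c0 c1 c2
  -- a coordinate in which `a` does not vanish
  obtain ⟨i, hi⟩ := Function.ne_iff.1 a.2.ne_zero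
  have hprop : b.1 i • a.1 = a.1 i • b.1 := by
    ext j
    fin_cases i <;> fin_cases j <;> simp <;> linarith
  have ho : (b.1 i : ℝ) * orient a.1 x = a.1 i * orient b.1 x := by
    have e : ∀ j, (b.1 i : ℝ) * a.1 j = a.1 i * b.1 j := fun j => by
      exact_mod_cast congrFun hprop j
    simp only [orient]
    linear_combination ((x 1).re * (x 2).im - (x 2).re * (x 1).im) * e 0 +
      ((x 2).re * (x 0).im - (x 0).re * (x 2).im) * e 1 +
      ((x 0).re * (x 1).im - (x 1).re * (x 0).im) * e 2
  refine Subtype.ext ?_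
  rcases lt_or_gt_of_ne hi with hneg | hpos
  · have hneg' : (a.1 i : ℝ) < 0 := by exact_mod_cast hneg
    have hb : b.1 i < 0 := by
      by_contra hc
      push Not at hc
      have hc' : (0 : ℝ) ≤ b.1 i := by exact_mod_cast hc
      nlinarith [mul_pos_of_neg_of_neg hneg' hxb, mul_nonneg hc' (neg_nonneg.2 hxa.le)]
    refine a.2.eq_of_smul_eq b.2 (neg_pos.2 hb) (neg_pos.2 hneg) ?_
    rw [neg_smul, neg_smul, hprop]
  · have hpos' : (0 : ℝ) < (a.1 i : ℝ) := by exact_mod_cast hpos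
    have hb : 0 < b.1 i := by
      by_contra hc
      push Not at hc
      have hc' : (b.1 i : ℝ) ≤ 0 := by exact_mod_cast hc
      nlinarith [mul_neg_of_pos_of_neg hpos' hxb,
        mul_nonneg_of_nonpos_of_nonpos hc' hxa.le]
    exact a.2.eq_of_smul_eq b.2 hb hpos hprop

/-- If `b` lies between `a` and `c`, then the cone of `(a, c)` is the disjoint union of the cones of
`(a, b)` and `(b, c)`, and the three pairs have the same `γ`. -/
lemma coneNum_mul_of_between (hab : a ⨯₃ b ≠ 0) (hbc : b ⨯₃ c ≠ 0) (hac : a ⨯₃ c ≠ 0) {r t u : ℤ}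
    (hr : 0 < r) (ht : 0 < t) (hu : 0 < u) (e : t • b = r • a + u • c) (hxa : x ∈ Uplus a)
    (hxb : x ∈ Uplus b) (hxc : x ∈ Uplus c) (w : ℂ) :
    coneNum a c 0 0 w x = coneNum a b 0 0 w x * coneNum b c 0 0 w x := by
  have hb : ∀ i, t * b i = r * a i + u * c i := fun i => congrFun e i
  have gab : gam a b = gam a c := by
    obtain ⟨hp, s, hs, hd⟩ := gam_spec hac
    refine gam_eq_of_det hab hp ht (mul_pos hu hs) fun v => ?_
    rw [mul_assoc, ← hd, Matrix.det_fin_three, Matrix.det_fin_three]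
    simp only [Matrix.of_apply, Matrix.cons_val]
    linear_combination (a 2 * v 1 - a 1 * v 2) * hb 0 + (a 0 * v 2 - a 2 * v 0) * hb 1 +
      (a 1 * v 0 - a 0 * v 1) * hb 2
  have gbc : gam b c = gam a c := by
    obtain ⟨hp, s, hs, hd⟩ := gam_spec hac
    refine gam_eq_of_det hbc hp ht (mul_pos hr hs) fun v => ?_
    rw [mul_assoc, ← hd, Matrix.det_fin_three, Matrix.det_fin_three]
    simp only [Matrix.of_apply, Matrix.cons_val]
    linear_combination (c 1 * v 2 - c 2 * v 1) * hb 0 + (c 2 * v 0 - c 0 * v 2) * hb 1 +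
      (c 0 * v 1 - c 1 * v 0) * hb 2
  have m1 := multipliable_gammaFactor hab hxa hxb 0 0 w
  have m2 := multipliable_gammaFactor hbc hxb hxc 0 0 w
  have ga := gam_dot_left hac
  have gc := gam_dot_right hac
  have gb : gam a c ⬝ᵥ b = 0 := by rw [← gab, gam_dot_right hab]
  have hδ : ∀ δ : Fin 3 → ℤ, t * (δ ⬝ᵥ b) = r * (δ ⬝ᵥ a) + u * (δ ⬝ᵥ c) := fun δ => by
    simp only [dotProduct, Fin.sum_univ_three]
    linear_combination δ 0 * hb 0 + δ 1 * hb 1 + δ 2 * hb 2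
  simp only [coneNum]
  rw [gab] at m1 ⊢
  rw [gbc] at m2 ⊢
  have hunion : coneQuot (gam a c) a c 0 0 = coneQuot (gam a c) a b 0 0 ∪
      coneQuot (gam a c) b c 0 0 := by
    ext q
    induction q using QuotientAddGroup.induction_on with
    | H δ =>
    rw [Set.mem_union, mk_mem_coneQuot ga gc, mk_mem_coneQuot ga gb, mk_mem_coneQuot gb gc]
    have hd := hδ δ
    constructor
    · rintro ⟨h1, h2⟩
      rcases le_or_gt (δ ⬝ᵥ b) 0 with h3 | h3
      · exact Or.inl ⟨h1, h3⟩
      · exact Or.inr ⟨h3, h2⟩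
    · rintro (⟨h1, h2⟩ | ⟨h1, h2⟩)
      · refine ⟨h1, ?_⟩
        by_contra hc
        push Not at hc
        nlinarith [mul_pos hr h1, mul_pos hu hc, mul_nonneg ht.le (neg_nonneg.2 h2)]
      · refine ⟨?_, h2⟩
        by_contra hc
        push Not at hc
        nlinarith [mul_pos ht h1, mul_nonneg hr.le (neg_nonneg.2 hc),
          mul_nonneg hu.le (neg_nonneg.2 h2)]
  have hdisj : Disjoint (coneQuot (gam a c) a b 0 0) (coneQuot (gam a c) b c 0 0) := by
    rw [Set.disjoint_left]
    intro q
    induction q using QuotientAddGroup.induction_on with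
    | H δ =>
    rw [mk_mem_coneQuot ga gb, mk_mem_coneQuot gb gc]
    rintro ⟨_, h1⟩ ⟨h2, _⟩
    omega
  rw [coneProd, hunion, Multipliable.tprod_union_disjoint (f := gammaFactor (gam a c) (-1) w x) hdisj m1 m2]
  rfl

end

section
variable {a b c : Fin 3 → ℤ} {x : Fin 3 → ℂ}

lemma orient_add_smul {r s t : ℤ} (e : r • a + s • b + t • c = 0) :
    r * orient a x + s * orient b x + t * orient c x = 0 := by
  have e' : ∀ j, (r : ℝ) * a j + s * b j + t * c j = 0 := fun j => by exact_mod_cast congrFun e j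
  simp only [orient]
  linear_combination ((x 1).re * (x 2).im - (x 2).re * (x 1).im) * e' 0 +
    ((x 2).re * (x 0).im - (x 0).re * (x 2).im) * e' 1 +
    ((x 0).re * (x 1).im - (x 1).re * (x 0).im) * e' 2

lemma cross_eq_zero_of_smul_add_smul {s t : ℤ} (ht : t ≠ 0) (e : s • b + t • c = 0) :
    b ⨯₃ c = 0 := by
  have h : t • (b ⨯₃ c) = 0 := by
    have : t • c = -(s • b) := eq_neg_of_add_eq_zero_right e
    rw [← map_smul, this, map_neg, map_smul, cross_self, smul_zero, neg_zero]
  exact (smul_eq_zero.1 h).resolve_left ht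

/-- Three coplanar, pairwise independent vectors, with `U_a^+ ∩ U_b^+ ∩ U_c^+` not empty, are linked
by a relation in which all coefficients are nonzero but do not have the same sign. -/
lemma exists_between (hab : a ⨯₃ b ≠ 0) (hbc : b ⨯₃ c ≠ 0) (hac : a ⨯₃ c ≠ 0)
    (hd : (Matrix.of ![a, b, c]).det = 0) (hxa : x ∈ Uplus a) (hxb : x ∈ Uplus b)
    (hxc : x ∈ Uplus c) : ∃ r s t : ℤ, 0 < r ∧ 0 < s ∧ 0 < t ∧
      (s • b = r • a + t • c ∨ r • a = s • b + t • c ∨ t • c = r • a + s • b) := by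
  have hane : a ≠ 0 := by rintro rfl; simp at hab
  have hbne : b ≠ 0 := by rintro rfl; simp at hab
  have hcne : c ≠ 0 := by rintro rfl; simp at hac
  rw [mem_Uplus_iff hane] at hxa
  rw [mem_Uplus_iff hbne] at hxb
  rw [mem_Uplus_iff hcne] at hxc
  set v := a ⨯₃ b with hv
  -- the relation obtained from expanding `det(a, b, c) v = 0`
  obtain ⟨r, s, t, ht, e⟩ : ∃ r s t : ℤ, t ≠ 0 ∧ r • a + s • b + t • c = 0 := by
    refine ⟨(b ⨯₃ c) ⬝ᵥ v, (c ⨯₃ a) ⬝ᵥ v, v ⬝ᵥ v, dotProduct_self_eq_zero.not.2 hab, ?_⟩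
    have hd' := hd
    rw [Matrix.det_fin_three] at hd'
    simp only [Matrix.of_apply, Matrix.cons_val] at hd'
    ext i
    have : ∀ w : Fin 3 → ℤ, (((b ⨯₃ c) ⬝ᵥ w) • a + ((c ⨯₃ a) ⬝ᵥ w) • b + ((a ⨯₃ b) ⬝ᵥ w) • c) i =
        (0 : Fin 3 → ℤ) i := fun w => by
      fin_cases i <;> simp [cross_apply, dotProduct, Fin.sum_univ_three]
      · linear_combination w 0 * hd'
      · linear_combination w 1 * hd'
      · linear_combination w 2 * hd'
    exact this v
  have hr : r ≠ 0 := by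
    rintro rfl
    rw [zero_smul, zero_add] at e
    exact hbc (cross_eq_zero_of_smul_add_smul ht e)
  have hs : s ≠ 0 := by
    rintro rfl
    rw [zero_smul, add_zero] at e
    exact hac (cross_eq_zero_of_smul_add_smul ht e)
  have ho := orient_add_smul (x := x) e
  have hpos : ¬(0 < r ∧ 0 < s ∧ 0 < t) := by
    rintro ⟨h1, h2, h3⟩
    have h1' : (0 : ℝ) < r := by exact_mod_cast h1
    have h2' : (0 : ℝ) < s := by exact_mod_cast h2
    have h3' : (0 : ℝ) < t := by exact_mod_cast h3
    linarith [mul_neg_of_pos_of_neg h1' hxa, mul_neg_of_pos_of_neg h2' hxb,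
      mul_neg_of_pos_of_neg h3' hxc]
  have hneg : ¬(r < 0 ∧ s < 0 ∧ t < 0) := by
    rintro ⟨h1, h2, h3⟩
    have h1' : (r : ℝ) < 0 := by exact_mod_cast h1
    have h2' : (s : ℝ) < 0 := by exact_mod_cast h2
    have h3' : (t : ℝ) < 0 := by exact_mod_cast h3
    linarith [mul_pos_of_neg_of_neg h1' hxa, mul_pos_of_neg_of_neg h2' hxb,
      mul_pos_of_neg_of_neg h3' hxc]
  have e' : ∀ i, r * a i + s * b i + t * c i = 0 := fun i => congrFun e i
  refine ⟨|r|, |s|, |t|, abs_pos.2 hr, abs_pos.2 hs, abs_pos.2 ht, ?_⟩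
  rcases lt_or_gt_of_ne hr with h1 | h1 <;> rcases lt_or_gt_of_ne hs with h2 | h2 <;>
    rcases lt_or_gt_of_ne ht with h3 | h3 <;> simp only [abs_of_neg, abs_of_pos, h1, h2, h3]
  · exact absurd ⟨h1, h2, h3⟩ hneg
  · right; right; ext i; simp; linear_combination e' i
  · left; ext i; simp; linear_combination e' i
  · right; left; ext i; simp; linear_combination -(e' i)
  · right; left; ext i; simp; linear_combination e' i
  · left; ext i; simp; linear_combination -(e' i)
  · right; right; ext i; simp; linear_combination -(e' i)
  · exact absurd ⟨h1, h2, h3⟩ hpos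

end

section
variable {a b c : Prim} {x : Fin 3 → ℂ}

lemma Gam_mul_of_between (hab : a.1 ⨯₃ b.1 ≠ 0) (hbc : b.1 ⨯₃ c.1 ≠ 0) (hac : a.1 ⨯₃ c.1 ≠ 0)
    {r t u : ℤ} (hr : 0 < r) (ht : 0 < t) (hu : 0 < u) (e : t • b.1 = r • a.1 + u • c.1)
    (hxa : x ∈ Uplus a.1) (hxb : x ∈ Uplus b.1) (hxc : x ∈ Uplus c.1) (w : ℂ) :
    Gam a c w x = Gam a b w x * Gam b c w x := by
  rw [Gam_eq _ _ hab, Gam_eq _ _ hbc, Gam_eq _ _ hac,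
    coneNum_mul_of_between hab hbc hac hr ht hu e hxa hxb hxc,
    coneNum_mul_of_between (cross_swap_ne_zero hbc) (cross_swap_ne_zero hab)
      (cross_swap_ne_zero hac) hu ht hr (by rw [e, add_comm]) hxc hxb hxa, div_mul_div_comm,
    mul_comm (coneNum c.1 b.1 0 0 w x)]

lemma Gam_self (a : Prim) (w : ℂ) (x : Fin 3 → ℂ) : Gam a a w x = 1 := by
  rw [Gam, if_pos (cross_self _)]

lemma Gam_triple_of_det_eq_zero (hd : (Matrix.of ![a.1, b.1, c.1]).det = 0) (hxa : x ∈ Uplus a.1)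
    (hxb : x ∈ Uplus b.1) (hxc : x ∈ Uplus c.1) {w : ℂ} (h1 : Gam a b w x ≠ 0)
    (h2 : Gam b c w x ≠ 0) (h3 : Gam c a w x ≠ 0) :
    Gam a b w x * Gam b c w x * Gam c a w x = 1 := by
  by_cases hab : a.1 ⨯₃ b.1 = 0
  · obtain rfl := eq_of_cross_eq_zero hab hxa hxb
    rw [Gam_self, one_mul, Gam_inv a c, inv_mul_cancel₀ h3]
  by_cases hbc : b.1 ⨯₃ c.1 = 0
  · obtain rfl := eq_of_cross_eq_zero hbc hxb hxc
    rw [Gam_self, mul_one, Gam_inv a b, inv_mul_cancel₀ h3]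
  by_cases hac : a.1 ⨯₃ c.1 = 0
  · obtain rfl := eq_of_cross_eq_zero hac hxa hxc
    rw [Gam_self, mul_one, Gam_inv a b, inv_mul_cancel₀ h2]
  have hba := cross_swap_ne_zero hab
  have hca := cross_swap_ne_zero hac
  have hcb := cross_swap_ne_zero hbc
  obtain ⟨r, s, t, hr, hs, ht, e | e | e⟩ := exists_between hab hbc hac hd hxa hxb hxc
  · rw [← Gam_mul_of_between hab hbc hac hr hs ht e hxa hxb hxc, Gam_inv a c, inv_mul_cancel₀ h3]
  · rw [Gam_inv b c, Gam_mul_of_between hca hab hcb ht hr hs (by rw [e, add_comm]) hxc hxa hxb]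
    field_simp
  · rw [Gam_inv a b, Gam_mul_of_between hbc hca hba hs ht hr (by rw [e, add_comm]) hxb hxc hxa]
    field_simp

lemma coneNum_eq_prod_gammaNum {c α β : Fin 3 → ℤ} {a b : Fin 3 → ℤ}
    (h : IsDualTriple a b c α β (gam a b)) (hα : 0 < (-pair α x / pair (gam a b) x).im)
    (hβ : 0 < (pair β x / pair (gam a b) x).im) (w : ℂ) :
    coneNum a b 0 0 w x = ∏ δ ∈ h.finite_dualBox.toFinset,
      gammaNum (w + pair δ x) (pair α x) (pair β x) (pair (gam a b) x) := by
  have e : (-(-1 : ℤ) * pair (gam a b) x : ℂ) = pair (gam a b) x := by push_cast; ring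
  have := h.coneProd_eq (ε := -1) (by norm_num) (by rwa [e]) (by rwa [e]) w
  rwa [e] at this

lemma coneNum_swap_eq_prod_gammaNum {c α β : Fin 3 → ℤ} {a b : Fin 3 → ℤ} (hab : a ⨯₃ b ≠ 0)
    (h : IsDualTriple a b c α β (gam a b)) (hα : 0 < (pair α x / -pair (gam a b) x).im)
    (hβ : 0 < (-pair β x / -pair (gam a b) x).im) (w : ℂ) :
    coneNum b a 0 0 w x = ∏ δ ∈ h.finite_dualBox.toFinset,
      gammaNum (w + pair δ x) (pair β x) (pair α x) (-pair (gam a b) x) := by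
  have e : (-(1 : ℤ) * pair (gam a b) x : ℂ) = -pair (gam a b) x := by push_cast; ring
  have := h.swap.coneProd_eq (ε := 1) (by norm_num) (by rwa [e]) (by rwa [e]) w
  rw [e] at this
  rw [coneNum_swap hab, this]
  refine Finset.prod_congr ?_ fun _ _ => rfl
  ext δ
  rw [Set.Finite.mem_toFinset, Set.Finite.mem_toFinset, dualBox_swap]

/-- For `det(a, b, c) > 0` the relation for three vectors is the product, over a fundamental box in
`Λ^∨`, of the modular three-term relations. -/
lemma coneNum_triple {a b c : Fin 3 → ℤ} (hd : 0 < (Matrix.of ![a, b, c]).det) (hxa : x ∈ Uplus a)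
    (hxb : x ∈ Uplus b) (hxc : x ∈ Uplus c) (w : ℂ) :
    coneNum a b 0 0 w x * coneNum b c 0 0 w x * coneNum c a 0 0 w x =
      coneNum b a 0 0 w x * coneNum c b 0 0 w x * coneNum a c 0 0 w x *
        Complex.exp (-(Real.pi * Complex.I / 3) *
          ∑ δ ∈ (isDualTriple_gam hd).finite_dualBox.toFinset,
            bernoulli₃ (w + pair δ x) (pair (gam b c) x) (pair (gam c a) x) (pair (gam a b) x)) := by
  have h := isDualTriple_gam hd
  have hd2 : 0 < (Matrix.of ![b, c, a]).det := by rwa [← det_cyclic]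
  have hd3 : 0 < (Matrix.of ![c, a, b]).det := by rwa [← det_cyclic]
  have c1 := cross_ne_zero_of_det_ne_zero hd.ne'
  have c2 := cross_ne_zero_of_det_ne_zero hd2.ne'
  have c3 := cross_ne_zero_of_det_ne_zero hd3.ne'
  have h12 := h.cyclic.cyclic.im_div_pos hd3 hxc
  have h23 := h.im_div_pos hd hxa
  have h31 := h.cyclic.im_div_pos hd2 hxb
  have h21 := im_neg_div_pos h12
  have h32 := im_neg_div_pos h23
  have h13 := im_neg_div_pos h31
  have neg1 : ∀ u v : ℂ, 0 < (-u / v).im → 0 < (u / -v).im := fun u v => by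
    rw [div_neg, neg_div]; exact id
  have neg2 : ∀ u v : ℂ, 0 < (u / v).im → 0 < (-u / -v).im := fun u v => by
    rw [neg_div_neg_eq]; exact id
  have box2 : h.cyclic.finite_dualBox.toFinset = h.finite_dualBox.toFinset := by
    ext δ; rw [Set.Finite.mem_toFinset, Set.Finite.mem_toFinset, dualBox_cyclic]
  have box3 : h.cyclic.cyclic.finite_dualBox.toFinset = h.finite_dualBox.toFinset := by
    ext δ; rw [Set.Finite.mem_toFinset, Set.Finite.mem_toFinset, dualBox_cyclic, dualBox_cyclic]
  rw [coneNum_eq_prod_gammaNum h h13 h23, coneNum_eq_prod_gammaNum h.cyclic h21 h31,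
    coneNum_eq_prod_gammaNum h.cyclic.cyclic h32 h12,
    coneNum_swap_eq_prod_gammaNum c1 h (neg1 _ _ h13) (neg2 _ _ h23),
    coneNum_swap_eq_prod_gammaNum c2 h.cyclic (neg1 _ _ h21) (neg2 _ _ h31),
    coneNum_swap_eq_prod_gammaNum c3 h.cyclic.cyclic (neg1 _ _ h32) (neg2 _ _ h12), box2, box3,
    Finset.mul_sum, Complex.exp_sum, ← Finset.prod_mul_distrib, ← Finset.prod_mul_distrib,
    ← Finset.prod_mul_distrib, ← Finset.prod_mul_distrib, ← Finset.prod_mul_distrib]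
  exact Finset.prod_congr rfl fun δ _ => tripleNum_eq_tripleDen h12 h23 h31 (w + pair δ x)

lemma multiBernoulli_three {ω₁ ω₂ ω₃ : ℂ} (h1 : ω₁ ≠ 0) (h2 : ω₂ ≠ 0) (h3 : ω₃ ≠ 0) (w : ℂ) :
    multiBernoulli 3 w ![ω₁, ω₂, ω₃] = bernoulli₃ w ω₁ ω₂ ω₃ := by
  have b0 : PowerSeries.coeff 0 (bernoulliPowerSeries ℂ) = 1 := by
    simp [bernoulliPowerSeries]
  have b1 : PowerSeries.coeff 1 (bernoulliPowerSeries ℂ) = -1 / 2 := by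
    simp [bernoulliPowerSeries, bernoulli_one]
  have b2 : PowerSeries.coeff 2 (bernoulliPowerSeries ℂ) = 1 / 12 := by
    simp [bernoulliPowerSeries, bernoulli_two, Nat.factorial]; norm_num
  have b3 : PowerSeries.coeff 3 (bernoulliPowerSeries ℂ) = 0 := by
    have : bernoulli 3 = 0 := bernoulli_eq_zero_of_odd (by decide) (by norm_num)
    simp [bernoulliPowerSeries, this]
  rw [multiBernoulli, Fin.prod_univ_three]
  simp only [Matrix.cons_val]
  simp only [PowerSeries.coeff_mul, Finset.Nat.sum_antidiagonal_eq_sum_range_succ_mk,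
    Finset.sum_range_succ, Finset.range_zero, Finset.sum_empty,
    PowerSeries.coeff_rescale, PowerSeries.coeff_exp, Nat.reduceSub, b0, b1, b2, b3]
  norm_num [Nat.factorial, bernoulli₃]
  field_simp
  ring

lemma bernoulliSum_eq {a b c : Fin 3 → ℤ} (hd : 0 < (Matrix.of ![a, b, c]).det)
    (hxa : x ∈ Uplus a) (hxb : x ∈ Uplus b) (w : ℂ) :
    bernoulliSum a b c w x = ∑ δ ∈ (isDualTriple_gam hd).finite_dualBox.toFinset,
      bernoulli₃ (w + pair δ x) (pair (gam b c) x) (pair (gam c a) x) (pair (gam a b) x) := by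
  have hd2 : 0 < (Matrix.of ![b, c, a]).det := by rwa [← det_cyclic]
  have hd3 : 0 < (Matrix.of ![c, a, b]).det := by rwa [← det_cyclic]
  have n1 := pair_gam_ne_zero (cross_ne_zero_of_det_ne_zero hd.ne') hxa
  have n2 := pair_gam_ne_zero (cross_ne_zero_of_det_ne_zero hd2.ne') hxb
  have n3 : pair (gam c a) x ≠ 0 := by
    have h := pair_gam_ne_zero (cross_swap_ne_zero (cross_ne_zero_of_det_ne_zero hd3.ne')) hxa
    rwa [gam_swap (cross_ne_zero_of_det_ne_zero hd3.ne'), pair_neg, neg_ne_zero] at h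
  rw [← finsum_mem_eq_finite_toFinset_sum]
  simp only [← multiBernoulli_three n2 n3 n1]
  rfl

lemma Gam_triple (hxa : x ∈ Uplus a.1) (hxb : x ∈ Uplus b.1) (hxc : x ∈ Uplus c.1) {w : ℂ}
    (h1 : Gam a b w x ≠ 0) (h2 : Gam b c w x ≠ 0) (h3 : Gam c a w x ≠ 0) :
    Gam a b w x * Gam b c w x * Gam c a w x =
      Complex.exp (-(Real.pi * Complex.I / 3) * PBernoulli a b c w x) := by
  have key : ∀ {a b c : Prim}, 0 < (Matrix.of ![a.1, b.1, c.1]).det → x ∈ Uplus a.1 →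
      x ∈ Uplus b.1 → x ∈ Uplus c.1 → Gam a b w x ≠ 0 → Gam b c w x ≠ 0 → Gam c a w x ≠ 0 →
      Gam a b w x * Gam b c w x * Gam c a w x =
        Complex.exp (-(Real.pi * Complex.I / 3) * bernoulliSum a.1 b.1 c.1 w x) := by
    intro a b c hd hxa hxb hxc h1 h2 h3
    have hd2 : 0 < (Matrix.of ![b.1, c.1, a.1]).det := by rwa [← det_cyclic]
    have hd3 : 0 < (Matrix.of ![c.1, a.1, b.1]).det := by rwa [← det_cyclic]
    have e := coneNum_triple hd hxa hxb hxc w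
    rw [← bernoulliSum_eq hd hxa hxb] at e
    rw [Gam_eq _ _ (cross_ne_zero_of_det_ne_zero hd.ne')] at h1 ⊢
    rw [Gam_eq _ _ (cross_ne_zero_of_det_ne_zero hd2.ne')] at h2 ⊢
    rw [Gam_eq _ _ (cross_ne_zero_of_det_ne_zero hd3.ne')] at h3 ⊢
    have d1 := (div_ne_zero_iff.1 h1).2
    have d2 := (div_ne_zero_iff.1 h2).2
    have d3 := (div_ne_zero_iff.1 h3).2
    rw [div_mul_div_comm, div_mul_div_comm, e]
    field_simp
  rcases lt_trichotomy (Matrix.of ![a.1, b.1, c.1]).det 0 with hd | hd | hd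
  · have hd' : 0 < (Matrix.of ![a.1, c.1, b.1]).det := by
      have : (Matrix.of ![a.1, c.1, b.1]).det = -(Matrix.of ![a.1, b.1, c.1]).det := by
        rw [Matrix.det_fin_three, Matrix.det_fin_three]
        simp only [Matrix.of_apply, Matrix.cons_val]; ring
      rw [this]; exact neg_pos.2 hd
    rw [PBernoulli, if_neg hd.not_gt, if_pos hd, mul_neg, Complex.exp_neg, Gam_inv a b, Gam_inv b c,
      Gam_inv c a]
    rw [Gam_inv a b, ne_eq, inv_eq_zero] at h1
    rw [Gam_inv b c, ne_eq, inv_eq_zero] at h2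
    rw [Gam_inv c a, ne_eq, inv_eq_zero] at h3
    rw [← key hd' hxa hxc hxb h3 h2 h1, mul_inv, mul_inv]
    ring
  · rw [PBernoulli, if_neg hd.not_gt, if_neg hd.not_lt, mul_zero, Complex.exp_zero]
    exact Gam_triple_of_det_eq_zero hd hxa hxb hxc h1 h2 h3
  · rw [PBernoulli, if_pos hd]
    exact key hd hxa hxb hxc h1 h2 h3

end

/-! ### Functions in `ℚ(x)[w]` -/

/-- The function `F(w, x)` is given by an element of `ℚ(x)[w]` without poles on `S`. -/
def IsQxW (S : Set (Fin 3 → ℂ)) (F : ℂ → (Fin 3 → ℂ) → ℂ) : Prop :=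
  ∃ P : QxW, ∀ x ∈ S, P.RegularAt x ∧ ∀ w, P.eval w x = F w x

section
variable {S : Set (Fin 3 → ℂ)} {F G : ℂ → (Fin 3 → ℂ) → ℂ}

lemma IsQxW.congr (hF : IsQxW S F) (h : ∀ x ∈ S, ∀ w, F w x = G w x) : IsQxW S G := by
  obtain ⟨P, hP⟩ := hF
  exact ⟨P, fun x hx => ⟨(hP x hx).1, fun w => ((hP x hx).2 w).trans (h x hx w)⟩⟩

lemma isQxW_of_eq_empty (hS : S = ∅) : IsQxW S F :=
  ⟨⟨0, 1, one_ne_zero⟩, by simp [hS]⟩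

lemma isQxW_const (q : ℚ) : IsQxW S fun _ _ => (q : ℂ) := by
  refine ⟨⟨Polynomial.C (MvPolynomial.C q), 1, one_ne_zero⟩, fun x _ => ⟨?_, fun w => ?_⟩⟩
  · simp [QxW.RegularAt]
  · simp [QxW.eval]

lemma isQxW_w : IsQxW S fun w _ => w := by
  refine ⟨⟨Polynomial.X, 1, one_ne_zero⟩, fun x _ => ⟨?_, fun w => ?_⟩⟩
  · simp [QxW.RegularAt]
  · simp [QxW.eval]

/-- The linear form `δ(x)` as a polynomial. -/
noncomputable def linearForm (δ : Fin 3 → ℤ) : MvPolynomial (Fin 3) ℚ :=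
  ∑ i, MvPolynomial.C (δ i : ℚ) * MvPolynomial.X i

lemma aeval_linearForm (δ : Fin 3 → ℤ) (x : Fin 3 → ℂ) :
    MvPolynomial.aeval x (linearForm δ) = pair δ x := by
  simp [linearForm, pair]

lemma isQxW_pair (δ : Fin 3 → ℤ) : IsQxW S fun _ x => pair δ x := by
  refine ⟨⟨Polynomial.C (linearForm δ), 1, one_ne_zero⟩, fun x _ => ⟨?_, fun w => ?_⟩⟩
  · simp [QxW.RegularAt]
  · simp [QxW.eval, aeval_linearForm]

lemma isQxW_pair_inv {δ : Fin 3 → ℤ} (h : ∀ x ∈ S, pair δ x ≠ 0) :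
    IsQxW S fun _ x => (pair δ x)⁻¹ := by
  by_cases h0 : linearForm δ = 0
  · refine isQxW_of_eq_empty (Set.eq_empty_iff_forall_notMem.2 fun x hx => h x hx ?_)
    rw [← aeval_linearForm, h0, map_zero]
  · refine ⟨⟨1, linearForm δ, h0⟩, fun x hx => ⟨?_, fun w => ?_⟩⟩
    · rw [QxW.RegularAt, aeval_linearForm]; exact h x hx
    · simp [QxW.eval, aeval_linearForm]

lemma IsQxW.add (hF : IsQxW S F) (hG : IsQxW S G) : IsQxW S fun w x => F w x + G w x := by
  obtain ⟨P, hP⟩ := hF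
  obtain ⟨Q, hQ⟩ := hG
  refine ⟨⟨Polynomial.C Q.den * P.num + Polynomial.C P.den * Q.num, P.den * Q.den,
    mul_ne_zero P.den_ne_zero Q.den_ne_zero⟩, fun x hx => ⟨?_, fun w => ?_⟩⟩
  · rw [QxW.RegularAt, map_mul]; exact mul_ne_zero (hP x hx).1 (hQ x hx).1
  · beta_reduce
    have h1 : MvPolynomial.aeval x P.den ≠ 0 := (hP x hx).1
    have h2 : MvPolynomial.aeval x Q.den ≠ 0 := (hQ x hx).1
    rw [← (hP x hx).2 w, ← (hQ x hx).2 w]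
    simp only [QxW.eval, Polynomial.eval₂_add, Polynomial.eval₂_mul, Polynomial.eval₂_C, map_mul,
      AlgHom.toRingHom_eq_coe, RingHom.coe_coe]
    field_simp

lemma IsQxW.mul (hF : IsQxW S F) (hG : IsQxW S G) : IsQxW S fun w x => F w x * G w x := by
  obtain ⟨P, hP⟩ := hF
  obtain ⟨Q, hQ⟩ := hG
  refine ⟨⟨P.num * Q.num, P.den * Q.den, mul_ne_zero P.den_ne_zero Q.den_ne_zero⟩,
    fun x hx => ⟨?_, fun w => ?_⟩⟩
  · rw [QxW.RegularAt, map_mul]; exact mul_ne_zero (hP x hx).1 (hQ x hx).1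
  · beta_reduce
    rw [← (hP x hx).2 w, ← (hQ x hx).2 w]
    simp only [QxW.eval, Polynomial.eval₂_mul, map_mul]
    rw [div_mul_div_comm]

lemma IsQxW.neg (hF : IsQxW S F) : IsQxW S fun w x => -F w x :=
  ((isQxW_const (-1)).mul hF).congr fun x _ w => by push_cast; ring

lemma IsQxW.sub (hF : IsQxW S F) (hG : IsQxW S G) : IsQxW S fun w x => F w x - G w x :=
  (hF.add hG.neg).congr fun x _ w => by ring

lemma IsQxW.sum {ι : Type*} (s : Finset ι) {F : ι → ℂ → (Fin 3 → ℂ) → ℂ}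
    (hF : ∀ i, IsQxW S (F i)) : IsQxW S fun w x => ∑ i ∈ s, F i w x := by
  classical
  induction s using Finset.induction_on with
  | empty => exact (isQxW_const 0).congr fun x _ w => by simp
  | insert i s hi ih => exact ((hF i).add ih).congr fun x _ w => by rw [Finset.sum_insert hi]

lemma isQxW_bernoulli₂ {u : ℂ → (Fin 3 → ℂ) → ℂ} (hu : IsQxW S u) {β γ : Fin 3 → ℤ}
    (hβ : ∀ x ∈ S, pair β x ≠ 0) (hγ : ∀ x ∈ S, pair γ x ≠ 0) :
    IsQxW S fun w x => bernoulli₂ (u w x) (pair β x) (pair γ x) := by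
  have b := isQxW_pair (S := S) β
  have c := isQxW_pair (S := S) γ
  refine ((((hu.mul hu).sub ((b.add c).mul hu)).add
    ((((b.mul b).add (c.mul c)).add ((isQxW_const 3).mul (b.mul c))).mul (isQxW_const (1 / 6)))).mul
    ((isQxW_pair_inv hβ).mul (isQxW_pair_inv hγ))).congr fun x hx w => ?_
  simp only [bernoulli₂]
  push_cast
  rw [div_eq_mul_inv _ (pair β x * pair γ x), mul_inv]
  ring

lemma isQxW_bernoulli₃ {u : ℂ → (Fin 3 → ℂ) → ℂ} (hu : IsQxW S u) {α β γ : Fin 3 → ℤ}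
    (hα : ∀ x ∈ S, pair α x ≠ 0) (hβ : ∀ x ∈ S, pair β x ≠ 0) (hγ : ∀ x ∈ S, pair γ x ≠ 0) :
    IsQxW S fun w x => bernoulli₃ (u w x) (pair α x) (pair β x) (pair γ x) := by
  have a := isQxW_pair (S := S) α
  have b := isQxW_pair (S := S) β
  have c := isQxW_pair (S := S) γ
  have s1 := (a.add b).add c
  have s2 := ((a.mul b).add (b.mul c)).add (c.mul a)
  have q := ((a.mul a).add (b.mul b)).add (c.mul c)
  refine ((((hu.mul (hu.mul hu)).sub ((isQxW_const (3 / 2)).mul (s1.mul (hu.mul hu)))).add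
    ((isQxW_const (1 / 2)).mul ((q.add ((isQxW_const 3).mul s2)).mul hu))).sub
    ((isQxW_const (1 / 4)).mul (s1.mul s2)) |>.mul
    ((isQxW_pair_inv hα).mul ((isQxW_pair_inv hβ).mul (isQxW_pair_inv hγ)))).congr fun x hx w => ?_
  simp only [bernoulli₃]
  push_cast
  rw [div_eq_mul_inv _ (pair α x * pair β x * pair γ x), mul_inv, mul_inv]
  ring

lemma isQxW_bernoulliSum {a b c : Fin 3 → ℤ} (hd : 0 < (Matrix.of ![a, b, c]).det)
    (hS : ∀ x ∈ S, x ∈ Uplus a ∧ x ∈ Uplus b ∧ x ∈ Uplus c) : IsQxW S (bernoulliSum a b c) := by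
  have hd2 : 0 < (Matrix.of ![b, c, a]).det := by rwa [← det_cyclic]
  have hd3 : 0 < (Matrix.of ![c, a, b]).det := by rwa [← det_cyclic]
  have n1 := fun x hx => pair_gam_ne_zero (cross_ne_zero_of_det_ne_zero hd.ne') (hS x hx).1
  have n2 := fun x hx => pair_gam_ne_zero (cross_ne_zero_of_det_ne_zero hd2.ne') (hS x hx).2.1
  have n3 := fun x hx => pair_gam_ne_zero (cross_ne_zero_of_det_ne_zero hd3.ne') (hS x hx).2.2
  refine (IsQxW.sum (isDualTriple_gam hd).finite_dualBox.toFinset fun δ =>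
    isQxW_bernoulli₃ (isQxW_w.add (isQxW_pair δ)) n2 n3 n1).congr fun x hx w => ?_
  rw [bernoulliSum_eq hd (hS x hx).1 (hS x hx).2.1]

lemma isQxW_PBernoulli (a b c : Prim) :
    IsQxW (Uplus a.1 ∩ Uplus b.1 ∩ Uplus c.1) (PBernoulli a b c) := by
  rcases lt_trichotomy (Matrix.of ![a.1, b.1, c.1]).det 0 with hd | hd | hd
  · have hd' : 0 < (Matrix.of ![a.1, c.1, b.1]).det := by
      have : (Matrix.of ![a.1, c.1, b.1]).det = -(Matrix.of ![a.1, b.1, c.1]).det := by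
        rw [Matrix.det_fin_three, Matrix.det_fin_three]
        simp only [Matrix.of_apply, Matrix.cons_val]; ring
      rw [this]; exact neg_pos.2 hd
    refine (isQxW_bernoulliSum hd' fun x hx => ⟨hx.1.1, hx.2, hx.1.2⟩).neg.congr fun x _ w => ?_
    rw [PBernoulli, if_neg hd.not_gt, if_pos hd]
  · refine (isQxW_const 0).congr fun x _ w => ?_
    rw [PBernoulli, if_neg hd.not_gt, if_neg hd.not_lt, Rat.cast_zero]
  · refine (isQxW_bernoulliSum hd fun x hx => ⟨hx.1.1, hx.1.2, hx.2⟩).congr fun x _ w => ?_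
    rw [PBernoulli, if_pos hd]

/-! ### Equality up to the exponential of a function in `ℚ(x)[w]` -/

/-- The functions `f`, `g` agree up to a factor `exp(πi F)`, with `F ∈ ℚ(x)[w]` regular on `S`, away
from the countable set `latticePoints x`. -/
def RatEquiv (S : Set (Fin 3 → ℂ)) (f g : ℂ → (Fin 3 → ℂ) → ℂ) : Prop :=
  ∃ F, IsQxW S F ∧ ∀ x ∈ S, ∀ w, w ∉ latticePoints x →
    f w x = Complex.exp (Real.pi * Complex.I * F w x) * g w x

variable {f g f' g' k : ℂ → (Fin 3 → ℂ) → ℂ}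

lemma RatEquiv.of_eq (h : ∀ x ∈ S, ∀ w, w ∉ latticePoints x → f w x = g w x) :
    RatEquiv S f g :=
  ⟨_, isQxW_const 0, fun x hx w hw => by simp [h x hx w hw]⟩

lemma RatEquiv.refl (S) (f : ℂ → (Fin 3 → ℂ) → ℂ) : RatEquiv S f f := .of_eq fun _ _ _ _ => rfl

lemma RatEquiv.symm (h : RatEquiv S f g) : RatEquiv S g f := by
  obtain ⟨F, hF, e⟩ := h
  refine ⟨_, hF.neg, fun x hx w hw => ?_⟩
  rw [e x hx w hw, ← mul_assoc, ← Complex.exp_add]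
  simp

lemma RatEquiv.trans (h : RatEquiv S f g) (h' : RatEquiv S g k) : RatEquiv S f k := by
  obtain ⟨F, hF, e⟩ := h
  obtain ⟨F', hF', e'⟩ := h'
  refine ⟨_, hF.add hF', fun x hx w hw => ?_⟩
  rw [e x hx w hw, e' x hx w hw, mul_add, Complex.exp_add]
  ring

lemma RatEquiv.mul (h : RatEquiv S f g) (h' : RatEquiv S f' g') :
    RatEquiv S (fun w x => f w x * f' w x) fun w x => g w x * g' w x := by
  obtain ⟨F, hF, e⟩ := h
  obtain ⟨F', hF', e'⟩ := h'
  refine ⟨_, hF.add hF', fun x hx w hw => ?_⟩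
  beta_reduce
  rw [e x hx w hw, e' x hx w hw, mul_add, Complex.exp_add]
  ring

lemma RatEquiv.inv (h : RatEquiv S f g) :
    RatEquiv S (fun w x => (f w x)⁻¹) fun w x => (g w x)⁻¹ := by
  obtain ⟨F, hF, e⟩ := h
  refine ⟨_, hF.neg, fun x hx w hw => ?_⟩
  beta_reduce
  rw [e x hx w hw, mul_inv, ← Complex.exp_neg, mul_neg]

lemma RatEquiv.mono {T : Set (Fin 3 → ℂ)} (h : RatEquiv S f g) (hT : T ⊆ S) : RatEquiv T f g := by
  obtain ⟨F, ⟨P, hP⟩, e⟩ := h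
  exact ⟨F, ⟨P, fun x hx => hP x (hT hx)⟩, fun x hx => e x (hT hx)⟩

lemma RatEquiv.prod {ι : Type*} (s : Finset ι) {f g : ι → ℂ → (Fin 3 → ℂ) → ℂ}
    (h : ∀ i, RatEquiv S (f i) (g i)) :
    RatEquiv S (fun w x => ∏ i ∈ s, f i w x) fun w x => ∏ i ∈ s, g i w x := by
  classical
  induction s using Finset.induction_on with
  | empty => exact .of_eq fun x _ w _ => by simp
  | insert i s hi ih =>
    simp only [Finset.prod_insert hi]
    exact (h i).mul ih

lemma RatEquiv.zprod (n : ℤ) {f g : ℤ → ℂ → (Fin 3 → ℂ) → ℂ} (h : ∀ j, RatEquiv S (f j) (g j)) :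
    RatEquiv S (fun w x => zprod n fun j => f j w x) fun w x => zprod n fun j => g j w x :=
  (RatEquiv.prod (Finset.Ico 0 n) h).mul (RatEquiv.prod (Finset.Ico n 0) h).inv

end

/-! ### Theta functions of oriented bases of the plane `δ(a) = 0` -/

/-- The function `θ₀((w + δ(x))/γ(x), β(x)/γ(x))`. -/
noncomputable def thetaRow (δ β γ : Fin 3 → ℤ) (w : ℂ) (x : Fin 3 → ℂ) : ℂ :=
  theta0 ((w + pair δ x) / pair γ x) (pair β x / pair γ x)

section
variable {S : Set (Fin 3 → ℂ)} {δ β γ : Fin 3 → ℤ} {x : Fin 3 → ℂ}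

lemma thetaRow_ne_zero (δ : Fin 3 → ℤ) (h : 0 < (pair β x / pair γ x).im) {w : ℂ}
    (hw : w ∉ latticePoints x) : thetaRow δ β γ w x ≠ 0 := by
  have h0 := right_ne_zero_of_im_div_pos h
  refine theta0_ne_zero h fun m n e => hw ⟨m • β + n • γ - δ, ?_⟩
  rw [div_eq_iff h0, add_mul, mul_assoc, div_mul_cancel₀ _ h0] at e
  simp only
  rw [pair_sub, pair_add, pair_zsmul, pair_zsmul, ← e]
  ring

lemma theta0_neg {τ : ℂ} (hτ : 0 < τ.im) (z : ℂ) :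
    theta0 (-z) τ = -expTwoPi (-z) * theta0 z τ := by
  rw [← theta0_add_tau hτ, theta0_eq hτ, theta0_eq hτ, sub_neg_eq_add, add_comm z τ,
    sub_add_cancel_left, mul_comm]

lemma theta0_tau_add_one (z τ : ℂ) : theta0 z (τ + 1) = theta0 z τ := by
  refine tprod_congr fun j => ?_
  rw [thetaFactor_eq, thetaFactor_eq, expTwoPi_add, expTwoPi_one, mul_one, add_sub_right_comm,
    expTwoPi_add, expTwoPi_one, mul_one]

lemma neg_expTwoPi_neg (z : ℂ) :
    -expTwoPi (-z) = Complex.exp (Real.pi * Complex.I * (1 - 2 * z)) := by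
  rw [mul_sub, mul_one, Complex.exp_sub, Complex.exp_pi_mul_I, expTwoPi_neg, expTwoPi,
    neg_div, one_div]
  congr 3; ring

lemma thetaRow_add_left (h : ∀ x ∈ S, 0 < (pair β x / pair γ x).im) (δ : Fin 3 → ℤ) :
    RatEquiv S (thetaRow (δ + β) β γ) (thetaRow δ β γ) := by
  have h0 := fun x hx => right_ne_zero_of_im_div_pos (h x hx)
  refine ⟨_, (isQxW_const 1).sub ((isQxW_const 2).mul ((isQxW_w.add (isQxW_pair δ)).mul
    (isQxW_pair_inv h0))), fun x hx w _ => ?_⟩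
  rw [thetaRow, pair_add, ← add_assoc, add_div, theta0_add_tau (h x hx), neg_expTwoPi_neg]
  push_cast
  rfl

lemma thetaRow_add_zsmul_left (h : ∀ x ∈ S, 0 < (pair β x / pair γ x).im) (k : ℤ)
    (δ : Fin 3 → ℤ) : RatEquiv S (thetaRow (δ + k • β) β γ) (thetaRow δ β γ) := by
  induction k using Int.induction_on with
  | zero => rw [zero_smul, add_zero]; exact .refl _ _
  | succ k ih =>
    rw [add_smul, one_smul, ← add_assoc]
    exact (thetaRow_add_left h _).trans ih
  | pred k ih =>
    refine .trans ?_ ih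
    have := (thetaRow_add_left h (δ + (-k - 1 : ℤ) • β)).symm
    rwa [add_assoc, ← add_one_zsmul, sub_add_cancel] at this

lemma thetaRow_add_zsmul_right (h : ∀ x ∈ S, 0 < (pair β x / pair γ x).im) (l : ℤ)
    (δ : Fin 3 → ℤ) : RatEquiv S (thetaRow (δ + l • γ) β γ) (thetaRow δ β γ) := by
  refine .of_eq fun x hx w _ => ?_
  have h0 := right_ne_zero_of_im_div_pos (h x hx)
  rw [thetaRow, pair_add, pair_zsmul, ← add_assoc, add_div, mul_div_cancel_right₀ _ h0,
    theta0_add_int, thetaRow]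

lemma thetaRow_modular (h : ∀ x ∈ S, 0 < (pair β x / pair γ x).im) (δ : Fin 3 → ℤ) :
    RatEquiv S (thetaRow δ (-γ) β) (thetaRow δ β γ) := by
  have h0 := fun x hx => right_ne_zero_of_im_div_pos (h x hx)
  have h1 := fun x hx => left_ne_zero_of_im_div_pos (h x hx)
  have u : IsQxW S fun w x => w + pair δ x := isQxW_w.add (isQxW_pair δ)
  refine ⟨_, ((isQxW_const 1).sub ((isQxW_const 2).mul (u.mul (isQxW_pair_inv h0)))).add
    (isQxW_bernoulli₂ u.neg h1 h0), fun x hx w _ => ?_⟩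
  have e := theta0_modular_homogeneous (h x hx) (-(w + pair δ x))
  rw [neg_neg, neg_div (pair γ x) (w + pair δ x), theta0_neg (h x hx), neg_expTwoPi_neg] at e
  rw [thetaRow, pair_neg, e, mul_add, Complex.exp_add]
  push_cast
  rw [thetaRow, div_eq_mul_inv (w + pair δ x)]
  ring

lemma im_div_pos_of_SL2 (A : Matrix.SpecialLinearGroup (Fin 2) ℤ)
    (h : 0 < (pair β x / pair γ x).im) :
    0 < (pair (A.1 0 0 • β + A.1 0 1 • γ) x / pair (A.1 1 0 • β + A.1 1 1 • γ) x).im := by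
  rw [im_div_pos_iff] at h ⊢
  have hdet : (A.1 0 0 * A.1 1 1 - A.1 0 1 * A.1 1 0 : ℝ) = 1 := by
    have := A.2
    rw [Matrix.det_fin_two] at this
    exact_mod_cast this
  have : (pair (A.1 0 0 • β + A.1 0 1 • γ) x * conj (pair (A.1 1 0 • β + A.1 1 1 • γ) x)).im =
      (A.1 0 0 * A.1 1 1 - A.1 0 1 * A.1 1 0 : ℝ) * (pair β x * conj (pair γ x)).im := by
    simp only [pair_add, pair_zsmul, map_add, map_mul, map_intCast, Complex.add_re,
      Complex.add_im, Complex.mul_re, Complex.mul_im, Complex.intCast_re, Complex.intCast_im,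
      Complex.conj_re, Complex.conj_im]
    ring
  rw [this, hdet, one_mul]
  exact h

/-- Change of the oriented basis: the group `SL₂(ℤ)` is generated by the two transformations
`(β, γ) ↦ (-γ, β)` and `(β, γ) ↦ (β + γ, γ)`. -/
lemma thetaRow_SL2 (A : Matrix.SpecialLinearGroup (Fin 2) ℤ) :
    ∀ β γ : Fin 3 → ℤ, (∀ x ∈ S, 0 < (pair β x / pair γ x).im) → ∀ δ,
      RatEquiv S (thetaRow δ (A.1 0 0 • β + A.1 0 1 • γ) (A.1 1 0 • β + A.1 1 1 • γ))
        (thetaRow δ β γ) := by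
  have hA : A ∈ Subgroup.closure {ModularGroup.S, ModularGroup.T} := by
    rw [SpecialLinearGroup.SL2Z_generators]; trivial
  have comp : ∀ (A B : Matrix.SpecialLinearGroup (Fin 2) ℤ) (i : Fin 2) (β γ : Fin 3 → ℤ),
      (A * B).1 i 0 • β + (A * B).1 i 1 • γ =
        A.1 i 0 • (B.1 0 0 • β + B.1 0 1 • γ) + A.1 i 1 • (B.1 1 0 • β + B.1 1 1 • γ) := by
    intro A B i β γ
    rw [Matrix.SpecialLinearGroup.coe_mul, Matrix.mul_apply, Matrix.mul_apply, Fin.sum_univ_two,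
      Fin.sum_univ_two]
    module
  induction hA using Subgroup.closure_induction with
  | mem B hB =>
    intro β γ h δ
    rcases hB with rfl | rfl
    · simpa [ModularGroup.S] using thetaRow_modular h δ
    · refine .of_eq fun x hx w _ => ?_
      have h0 := right_ne_zero_of_im_div_pos (h x hx)
      simp only [ModularGroup.T, Matrix.of_apply, Matrix.cons_val, one_smul, zero_smul, zero_add]
      rw [thetaRow, pair_add, add_div (pair β x), div_self h0, theta0_tau_add_one, thetaRow]
  | one => intro β γ h δ; simpa using RatEquiv.refl S (thetaRow δ β γ)
  | mul A B _ _ hA hB =>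
    intro β γ h δ
    rw [comp, comp]
    exact (hA _ _ (fun x hx => im_div_pos_of_SL2 B (h x hx)) δ).trans (hB _ _ h δ)
  | inv A _ hA =>
    intro β γ h δ
    have := hA _ _ (fun x hx => im_div_pos_of_SL2 A⁻¹ (h x hx)) δ
    rw [← comp, ← comp, mul_inv_cancel] at this
    simpa using this.symm

end

section
variable {a : Fin 3 → ℤ}

/-- The theta functions attached to two bases adapted to `a` agree up to exponentials; so do their
translates by `δ(x)`, `δ'(x)` if `δ(a) = δ'(a)`. -/
lemma thetaRow_ratEquiv {M M' : Matrix.SpecialLinearGroup (Fin 3) ℤ} (hM : M.1 *ᵥ a = ![1, 0, 0])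
    (hM' : M'.1 *ᵥ a = ![1, 0, 0]) {δ δ' : Fin 3 → ℤ} (hδ : δ ⬝ᵥ a = δ' ⬝ᵥ a) :
    RatEquiv (Uplus a) (thetaRow δ (M'.1 1) (M'.1 2)) (thetaRow δ' (M.1 1) (M.1 2)) := by
  have him := fun x (hx : x ∈ Uplus a) => im_rows_div_pos hM hx
  obtain ⟨k₀, l₀, e₀⟩ := exists_row_coords hM (M'.1 0)
  obtain ⟨k₁, l₁, e₁⟩ := exists_row_coords hM (M'.1 1)
  obtain ⟨k₂, l₂, e₂⟩ := exists_row_coords hM (M'.1 2)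
  rw [row_zero_dot hM', one_smul] at e₀
  rw [row_one_dot hM', zero_smul, zero_add] at e₁
  rw [row_two_dot hM', zero_smul, zero_add] at e₂
  have hdet : (!![k₁, l₁; k₂, l₂] : Matrix (Fin 2) (Fin 2) ℤ).det = 1 := by
    have e : M'.1 = !![1, k₀, l₀; 0, k₁, l₁; 0, k₂, l₂] * M.1 := by
      refine funext fun i => ?_
      have : (!![1, k₀, l₀; 0, k₁, l₁; 0, k₂, l₂] * M.1) i =
          (!![1, k₀, l₀; 0, k₁, l₁; 0, k₂, l₂] : Matrix (Fin 3) (Fin 3) ℤ) i ᵥ* M.1 := rfl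
      rw [this, vecMul_eq_rows]
      fin_cases i
      · simpa using e₀
      · simpa using e₁
      · simpa using e₂
    have hd := M'.2
    rw [e, Matrix.det_mul, M.2, mul_one, Matrix.det_fin_three] at hd
    rw [Matrix.det_fin_two_of, ← hd]
    simp
  have hSL := thetaRow_SL2 ⟨_, hdet⟩ (M.1 1) (M.1 2) him δ
  simp only [Matrix.of_apply, Matrix.cons_val', Matrix.cons_val] at hSL
  rw [e₁, e₂]
  refine hSL.trans ?_
  obtain ⟨k, l, e⟩ := exists_row_coords hM (δ - δ')
  rw [sub_dotProduct, hδ, sub_self, zero_smul, zero_add, sub_eq_iff_eq_add', ← add_assoc] at e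
  rw [e]
  exact (thetaRow_add_zsmul_right him l _).trans (thetaRow_add_zsmul_left him k _)

end

/-! ### The transformation laws -/

lemma zprod_add_one {n : ℤ} {f : ℤ → ℂ} (h : f n ≠ 0) : zprod (n + 1) f = zprod n f * f n := by
  unfold zprod
  rcases le_or_gt 0 n with hn | hn
  · have e1 : Finset.Ico 0 (n + 1) = insert n (Finset.Ico 0 n) := by ext; simp; omega
    have e2 : Finset.Ico (n + 1) 0 = ∅ := by simp; omega
    have e3 : Finset.Ico n 0 = ∅ := by simp; omega
    rw [e1, e2, e3, Finset.prod_insert (by simp)]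
    simp [mul_comm]
  · have e1 : Finset.Ico n 0 = insert n (Finset.Ico (n + 1) 0) := by ext; simp; omega
    have e2 : Finset.Ico 0 (n + 1) = ∅ := by simp; omega
    have e3 : Finset.Ico 0 n = ∅ := by simp; omega
    rw [e1, e2, e3, Finset.prod_insert (by simp)]
    field_simp

lemma zprod_add (m n : ℤ) {f : ℤ → ℂ} (h : ∀ j, f j ≠ 0) :
    zprod (m + n) f = zprod m f * zprod n fun j => f (j + m) := by
  induction n using Int.induction_on with
  | zero => simp [zprod]
  | succ k ih =>
    rw [← add_assoc, zprod_add_one (h _), zprod_add_one (n := k) (f := fun j => f (j + m)) (h _), ih,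
      mul_assoc, add_comm m]
  | pred k ih =>
    have e1 := zprod_add_one (n := m + (-k - 1)) (h _)
    have e2 := zprod_add_one (n := -k - 1) (f := fun j => f (j + m)) (h _)
    rw [show m + (-(k : ℤ) - 1) + 1 = m + -k by ring, ih] at e1
    rw [sub_add_cancel] at e2
    rw [e2, add_comm m (-(k : ℤ) - 1), ← mul_assoc] at e1
    rw [add_comm m]
    exact (mul_right_cancel₀ (h _) e1).symm

lemma zprod_ne_zero (n : ℤ) {f : ℤ → ℂ} (h : ∀ j, f j ≠ 0) : zprod n f ≠ 0 :=
  mul_ne_zero (Finset.prod_ne_zero_iff.2 fun j _ => h j)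
    (inv_ne_zero (Finset.prod_ne_zero_iff.2 fun j _ => h j))

section
variable (fr : Framing) {a b : Prim} {x : Fin 3 → ℂ}

/-- The `j`-th theta function in the product that defines `Δ_a`. -/
noncomputable def Framing.theta (a : Prim) (j : ℤ) : ℂ → (Fin 3 → ℂ) → ℂ :=
  thetaRow (j • (fr.basis a).1 0) ((fr.basis a).1 1) ((fr.basis a).1 2)

lemma Delta_eq (a : Prim) (s : ISL3) (w : ℂ) (x : Fin 3 → ℂ) :
    Delta fr a s w x = zprod ((s.μ ᵥ* s.g⁻¹.1) ⬝ᵥ a.1) fun j => fr.theta a j w x := by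
  simp only [Delta, Framing.theta, thetaRow, pair_zsmul, vecMul_dot]
  rfl

lemma Framing.im_pos (hx : x ∈ Uplus a.1) :
    0 < (pair ((fr.basis a).1 1) x / pair ((fr.basis a).1 2) x).im :=
  im_rows_div_pos (fr.basis_apply a) hx

lemma Framing.theta_ne_zero (hx : x ∈ Uplus a.1) (j : ℤ) {w : ℂ} (hw : w ∉ latticePoints x) :
    fr.theta a j w x ≠ 0 := thetaRow_ne_zero _ (fr.im_pos hx) hw

lemma Delta_ne_zero (s : ISL3) (hx : x ∈ Uplus a.1) {w : ℂ} (hw : w ∉ latticePoints x) :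
    Delta fr a s w x ≠ 0 := by
  rw [Delta_eq]
  exact zprod_ne_zero _ fun j => fr.theta_ne_zero hx j hw

/-- The function `Γ_{a,b}` for the cones `δ(a) > m`, `δ(b) ≤ n` and `δ(b) > n`, `δ(a) ≤ m`. -/
noncomputable def coneGam (a b : Fin 3 → ℤ) (m n : ℤ) (w : ℂ) (x : Fin 3 → ℂ) : ℂ :=
  coneNum a b m n w x / coneNum b a n m w x

/-- Lowering the threshold `m` by one adds the row `δ(a) = m` to the cones, hence one theta function. -/
lemma coneGam_pred_ratEquiv (h : a.1 ⨯₃ b.1 ≠ 0) (m n : ℤ) :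
    RatEquiv (Uplus a.1 ∩ Uplus b.1) (coneGam a.1 b.1 (m - 1) n)
      fun w x => coneGam a.1 b.1 m n w x * fr.theta a (-m) w x := by
  obtain ⟨M, hM, hM2⟩ := exists_adapted_basis (fr.basis_apply a) (gam_spec h).1 (gam_dot_left h)
  obtain ⟨δ₀, hδ, hrow⟩ := exists_coneNum_row h hM hM2 m n
  have hθ : RatEquiv (Uplus a.1) (thetaRow (-δ₀) (M.1 1) (M.1 2)) (fr.theta a (-m)) := by
    refine thetaRow_ratEquiv (fr.basis_apply a) hM ?_
    rw [neg_dotProduct, hδ, smul_dotProduct, row_zero_dot (fr.basis_apply a), smul_eq_mul, mul_one]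
  refine .trans (.of_eq fun x hx w hw => ?_)
    ((RatEquiv.refl _ (coneGam a.1 b.1 m n)).mul (hθ.mono Set.inter_subset_left))
  obtain ⟨A, B, h1, h2, h3⟩ := hrow x hx.1 hx.2 w
  have d1 := coneNum_ne_zero (cross_swap_ne_zero h) hx.2 hx.1 n m hw
  have d2 := coneNum_ne_zero (cross_swap_ne_zero h) hx.2 hx.1 n (m - 1) hw
  have hB : B ≠ 0 := by rintro rfl; exact d1 (by rw [h2, mul_zero])
  simp only [coneGam]
  rw [thetaRow, pair_neg, ← sub_eq_add_neg, ← h3, h1, h2]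
  field_simp

lemma coneGam_neg_left_ratEquiv (h : a.1 ⨯₃ b.1 ≠ 0) (k n : ℤ) :
    RatEquiv (Uplus a.1 ∩ Uplus b.1) (coneGam a.1 b.1 (-k) n)
      fun w x => coneGam a.1 b.1 0 n w x * zprod k fun j => fr.theta a j w x := by
  have step : ∀ k : ℤ, RatEquiv (Uplus a.1 ∩ Uplus b.1) (coneGam a.1 b.1 (-(k + 1)) n)
      fun w x => coneGam a.1 b.1 (-k) n w x * fr.theta a k w x := fun k => by
    have := coneGam_pred_ratEquiv fr h (-k) n
    rwa [neg_neg, ← neg_add'] at this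
  induction k using Int.induction_on with
  | zero => exact .of_eq fun x _ w _ => by simp [zprod]
  | succ k ih =>
    refine (step k).trans (.trans (ih.mul (.refl _ (fr.theta a k))) (.of_eq fun x hx w hw => ?_))
    rw [zprod_add_one (fr.theta_ne_zero hx.1 _ hw), mul_assoc]
  | pred k ih =>
    have e := step (-k - 1)
    rw [sub_add_cancel] at e
    -- solve for the smaller threshold, then use the induction hypothesis
    refine .trans (.of_eq fun x hx w hw => (mul_inv_cancel_right₀
      (fr.theta_ne_zero hx.1 (-k - 1) hw) _).symm)
      (.trans ((e.symm.trans ih).mul (RatEquiv.refl _ (fr.theta a (-k - 1))).inv)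
        (.of_eq fun x hx w hw => ?_))
    have e2 := zprod_add_one (n := -k - 1) (f := fun j => fr.theta a j w x)
      (fr.theta_ne_zero hx.1 _ hw)
    rw [sub_add_cancel] at e2
    rw [e2, ← mul_assoc, mul_inv_cancel_right₀ (fr.theta_ne_zero hx.1 _ hw)]

lemma coneGam_swap (a b : Fin 3 → ℤ) (m n : ℤ) (w : ℂ) (x : Fin 3 → ℂ) :
    coneGam a b m n w x = (coneGam b a n m w x)⁻¹ := by rw [coneGam, coneGam, inv_div]

lemma coneGam_neg_ratEquiv (h : a.1 ⨯₃ b.1 ≠ 0) (k l : ℤ) :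
    RatEquiv (Uplus a.1 ∩ Uplus b.1) (coneGam a.1 b.1 (-k) (-l)) fun w x =>
      Gam a b w x * ((zprod k fun j => fr.theta a j w x) / zprod l fun j => fr.theta b j w x) := by
  refine (coneGam_neg_left_ratEquiv fr h k (-l)).trans ?_
  have h' := ((coneGam_neg_left_ratEquiv fr (cross_swap_ne_zero h) l 0).inv).mono
    (Set.inter_comm (Uplus a.1) (Uplus b.1)).subset
  refine .trans (.mul (.trans (.of_eq fun x _ w _ => coneGam_swap a.1 b.1 0 (-l) w x) h')
    (.refl _ _)) (.of_eq fun x _ w _ => ?_)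
  rw [mul_inv, ← coneGam_swap a.1 b.1, Gam_eq a b h, coneGam]
  ring

/-- The action of `g` permutes the factors of the product, so that only the translation of `w`
remains. -/
lemma Gam_inv_smul (s : ISL3) (a b : Prim) (w : ℂ) (x : Fin 3 → ℂ) :
    Gam (s⁻¹ • a) (s⁻¹ • b) (w + pair s.μ (matAct s.g⁻¹ x)) (matAct s.g⁻¹ x) =
      Gam a b (w + pair (s.μ ᵥ* s.g⁻¹.1) x) x := by
  rw [pair_matAct]
  exact Gam_matAct s⁻¹ a b _ x

lemma Gam_ratEquiv (a b : Prim) (s : ISL3) :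
    RatEquiv (Uplus a.1 ∩ Uplus b.1)
      (fun w x => Gam (s⁻¹ • a) (s⁻¹ • b) (w + pair s.μ (matAct s.g⁻¹ x)) (matAct s.g⁻¹ x))
      fun w x => Gam a b w x * (Delta fr a s w x / Delta fr b s w x) := by
  simp only [Gam_inv_smul, Delta_eq]
  by_cases h : a.1 ⨯₃ b.1 = 0
  · refine .of_eq fun x hx w hw => ?_
    obtain rfl := eq_of_cross_eq_zero h hx.1 hx.2
    rw [Gam_self, Gam_self, div_self (zprod_ne_zero _ fun j => fr.theta_ne_zero hx.1 j hw), mul_one]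
  · refine .trans (.of_eq fun x _ w _ => ?_) (coneGam_neg_ratEquiv fr h _ _)
    rw [Gam_eq a b h, coneNum_add h, coneNum_add (cross_swap_ne_zero h), zero_sub, zero_sub, coneGam]

lemma Delta_ratEquiv (a : Prim) (s t : ISL3) :
    RatEquiv (Uplus a.1) (Delta fr a (s * t)) fun w x => Delta fr a s w x *
      Delta fr (s⁻¹ • a) t (w + pair s.μ (matAct s.g⁻¹ x)) (matAct s.g⁻¹ x) := by
  have e1 : ((s * t).μ ᵥ* (s * t).g⁻¹.1) ⬝ᵥ a.1 =
      (s.μ ᵥ* s.g⁻¹.1) ⬝ᵥ a.1 + (t.μ ᵥ* t.g⁻¹.1) ⬝ᵥ (s⁻¹ • a).1 := by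
    change ((t.μ + s.μ ᵥ* t.g.1) ᵥ* (s.g * t.g)⁻¹.1) ⬝ᵥ a.1 =
      _ + (t.μ ᵥ* t.g⁻¹.1) ⬝ᵥ (s.g⁻¹.1 *ᵥ a.1)
    rw [mul_inv_rev, Matrix.SpecialLinearGroup.coe_mul, Matrix.add_vecMul, add_dotProduct,
      Matrix.vecMul_vecMul, ← mul_assoc, coe_mul_inv, one_mul, ← vecMul_dot _ _ s.g⁻¹.1,
      Matrix.vecMul_vecMul, add_comm]
  -- the basis attached to `g⁻¹ a` is moved by `g` to a basis adapted to `a`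
  have hM : ((fr.basis (s⁻¹ • a)) * s.g⁻¹).1 *ᵥ a.1 = ![1, 0, 0] := by
    rw [Matrix.SpecialLinearGroup.coe_mul, ← Matrix.mulVec_mulVec]
    exact fr.basis_apply (s⁻¹ • a)
  have hrow : ∀ i x, pair ((fr.basis (s⁻¹ • a)).1 i) (matAct s.g⁻¹ x) =
      pair (((fr.basis (s⁻¹ • a)) * s.g⁻¹).1 i) x := fun i x => by rw [pair_matAct]; rfl
  have e2 : ∀ j w x, fr.theta (s⁻¹ • a) j (w + pair s.μ (matAct s.g⁻¹ x)) (matAct s.g⁻¹ x) =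
      thetaRow (s.μ ᵥ* s.g⁻¹.1 + j • ((fr.basis (s⁻¹ • a)) * s.g⁻¹).1 0)
        (((fr.basis (s⁻¹ • a)) * s.g⁻¹).1 1) (((fr.basis (s⁻¹ • a)) * s.g⁻¹).1 2) w x := by
    intro j w x
    rw [Framing.theta, thetaRow, thetaRow, pair_zsmul, hrow, hrow, hrow, pair_add, pair_zsmul,
      pair_matAct, add_assoc]
  refine .trans (g := fun w x => Delta fr a s w x *
      zprod ((t.μ ᵥ* t.g⁻¹.1) ⬝ᵥ (s⁻¹ • a).1)
        fun j => fr.theta a (j + (s.μ ᵥ* s.g⁻¹.1) ⬝ᵥ a.1) w x)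
    (.of_eq fun x hx w hw => ?_) (.mul (.refl _ _) ?_)
  · rw [Delta_eq, e1, Delta_eq, zprod_add _ _ fun j => fr.theta_ne_zero hx j hw]
  simp only [Delta_eq, e2]
  refine .zprod _ fun j => (thetaRow_ratEquiv (fr.basis_apply a) hM ?_).symm
  rw [add_dotProduct, smul_dotProduct, smul_dotProduct, row_zero_dot hM,
    row_zero_dot (fr.basis_apply a), smul_eq_mul, smul_eq_mul, mul_one, mul_one, add_comm]

/-! ### Continuity in `w` -/

lemma differentiable_coneNum {a b : Fin 3 → ℤ} (h : a ⨯₃ b ≠ 0) (hxa : x ∈ Uplus a)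
    (hxb : x ∈ Uplus b) : Differentiable ℂ fun w => coneNum a b 0 0 w x := by
  have hd := det_cross_pos h
  have ht := isDualTriple_gam hd
  have hα := im_neg_div_pos (ht.cyclic.im_div_pos (by rwa [← det_cyclic]) hxb)
  have hβ := ht.im_div_pos hd hxa
  rw [← differentiableOn_univ]
  simp only [coneNum_eq_prod_gammaNum ht hα hβ]
  exact differentiableOn_finset_prod _ fun δ => ((differentiable_gammaNum hα hβ).comp
    (differentiable_id.add_const (pair δ x))).differentiableOn

lemma continuousAt_Gam (hxa : x ∈ Uplus a.1) (hxb : x ∈ Uplus b.1) {w : ℂ}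
    (hw : Gam a b w x ≠ 0) : ContinuousAt (fun w => Gam a b w x) w := by
  by_cases h : a.1 ⨯₃ b.1 = 0
  · simp only [Gam, if_pos h]; exact continuousAt_const
  · rw [Gam_eq a b h] at hw
    simp only [Gam_eq a b h]
    exact (differentiable_coneNum h hxa hxb).continuous.continuousAt.div
      (differentiable_coneNum (cross_swap_ne_zero h) hxb hxa).continuous.continuousAt
      (div_ne_zero_iff.1 hw).2

lemma continuousAt_Delta (s : ISL3) (hx : x ∈ Uplus a.1) {w : ℂ} (hw : Delta fr a s w x ≠ 0) :
    ContinuousAt (fun w => Delta fr a s w x) w := by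
  have hθ : ∀ j, Continuous fun w => fr.theta a j w x := fun j =>
    (differentiable_theta0 (fr.im_pos hx)).continuous.comp
      ((continuous_id.add continuous_const).div_const _)
  simp only [Delta_eq, zprod] at hw ⊢
  refine ContinuousAt.mul ?_ (ContinuousAt.inv₀ ?_ (inv_eq_zero.not.1 (mul_ne_zero_iff.1 hw).2))
  · exact (continuous_finsetProd _ fun j _ => hθ j).continuousAt
  · exact (continuous_finsetProd _ fun j _ => hθ j).continuousAt

lemma continuous_eval (P : QxW) (x : Fin 3 → ℂ) : Continuous fun w => P.eval w x :=
  (Polynomial.continuous_eval₂ _ _).div_const _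

end

section
variable (fr : Framing) {a b : Prim} {x : Fin 3 → ℂ}

lemma Gam_ne_zero (hxa : x ∈ Uplus a.1) (hxb : x ∈ Uplus b.1) {w : ℂ} (hw : w ∉ latticePoints x) :
    Gam a b w x ≠ 0 := by
  by_cases h : a.1 ⨯₃ b.1 = 0
  · rw [Gam, if_pos h]; exact one_ne_zero
  · rw [Gam_eq a b h]
    exact div_ne_zero (coneNum_ne_zero h hxa hxb 0 0 hw)
      (coneNum_ne_zero (cross_swap_ne_zero h) hxb hxa 0 0 hw)

/-- The transformation law of `Γ_{a,b}`. -/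
lemma exists_Gam_transform (a b : Prim) (s : ISL3) :
    ∃ P : QxW, ∀ x, x ∈ Uplus a.1 → x ∈ Uplus b.1 → P.RegularAt x ∧ ∀ w, Gam a b w x ≠ 0 →
      Gam (s⁻¹ • a) (s⁻¹ • b) (w + pair s.μ (matAct s.g⁻¹ x)) (matAct s.g⁻¹ x) ≠ 0 →
      Delta fr a s w x ≠ 0 → Delta fr b s w x ≠ 0 →
      Gam (s⁻¹ • a) (s⁻¹ • b) (w + pair s.μ (matAct s.g⁻¹ x)) (matAct s.g⁻¹ x) / Gam a b w x =
        Complex.exp (Real.pi * Complex.I * P.eval w x) *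
          (Delta fr a s w x / Delta fr b s w x) := by
  obtain ⟨F, ⟨P, hP⟩, e⟩ := Gam_ratEquiv fr a b s
  refine ⟨P, fun x hxa hxb => ⟨(hP x ⟨hxa, hxb⟩).1, fun w h1 h2 h3 h4 => ?_⟩⟩
  rw [Gam_inv_smul] at h2
  have c2 : ContinuousAt (fun w => Gam (s⁻¹ • a) (s⁻¹ • b) (w + pair s.μ (matAct s.g⁻¹ x))
      (matAct s.g⁻¹ x)) w := by
    simp only [Gam_inv_smul]
    exact ContinuousAt.comp (g := fun w => Gam a b w x) (continuousAt_Gam hxa hxb h2)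
      (continuous_id.add continuous_const).continuousAt
  have key : ∀ v, v ∉ latticePoints x →
      Gam (s⁻¹ • a) (s⁻¹ • b) (v + pair s.μ (matAct s.g⁻¹ x)) (matAct s.g⁻¹ x) / Gam a b v x =
        Complex.exp (Real.pi * Complex.I * P.eval v x) *
          (Delta fr a s v x / Delta fr b s v x) := fun v hv => by
    have h0 := Gam_ne_zero hxa hxb hv
    have ev := e x ⟨hxa, hxb⟩ v hv
    beta_reduce at ev
    rw [ev, (hP x ⟨hxa, hxb⟩).2]
    field_simp
  exact eq_of_eventually_notMem_countable (countable_latticePoints x)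
    (f := fun v => Gam (s⁻¹ • a) (s⁻¹ • b) (v + pair s.μ (matAct s.g⁻¹ x)) (matAct s.g⁻¹ x) /
      Gam a b v x)
    (g := fun v => Complex.exp (Real.pi * Complex.I * P.eval v x) *
      (Delta fr a s v x / Delta fr b s v x))
    (c2.div (continuousAt_Gam hxa hxb h1) h1)
    (((continuous_const.mul (continuous_eval P x)).cexp.continuousAt).mul
      ((continuousAt_Delta fr s hxa h3).div (continuousAt_Delta fr s hxb h4) h4))
    (Eventually.of_forall key)

/-- The transformation law of `Δ_a`. -/
lemma exists_Delta_transform (a : Prim) (s t : ISL3) :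
    ∃ P : QxW, ∀ x, x ∈ Uplus a.1 → P.RegularAt x ∧ ∀ w,
      Delta fr a (s * t) w x ≠ 0 → Delta fr a s w x ≠ 0 →
      Delta fr (s⁻¹ • a) t (w + pair s.μ (matAct s.g⁻¹ x)) (matAct s.g⁻¹ x) ≠ 0 →
      Delta fr a (s * t) w x =
        Complex.exp (2 * Real.pi * Complex.I * P.eval w x) * Delta fr a s w x *
          Delta fr (s⁻¹ • a) t (w + pair s.μ (matAct s.g⁻¹ x)) (matAct s.g⁻¹ x) := by
  obtain ⟨F, hF, e⟩ := Delta_ratEquiv fr a s t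
  obtain ⟨P, hP⟩ := (isQxW_const (1 / 2)).mul hF
  refine ⟨P, fun x hx => ⟨(hP x hx).1, fun w h1 h2 h3 => ?_⟩⟩
  have hx' : matAct s.g⁻¹ x ∈ Uplus (s⁻¹ • a).1 := by
    rw [mem_Uplus_iff a.2.ne_zero] at hx
    rw [mem_Uplus_iff (s⁻¹ • a).2.ne_zero]
    exact (orient_act s⁻¹ a (0, x)).trans_lt hx
  have key : ∀ v, v ∉ latticePoints x → Delta fr a (s * t) v x =
      Complex.exp (2 * Real.pi * Complex.I * P.eval v x) * Delta fr a s v x *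
        Delta fr (s⁻¹ • a) t (v + pair s.μ (matAct s.g⁻¹ x)) (matAct s.g⁻¹ x) := fun v hv => by
    rw [e x hx v hv, (hP x hx).2, mul_assoc (Complex.exp _)]
    push_cast
    congr 2
    ring
  have c3 : ContinuousAt (fun v => Delta fr (s⁻¹ • a) t (v + pair s.μ (matAct s.g⁻¹ x))
      (matAct s.g⁻¹ x)) w :=
    ContinuousAt.comp (g := fun w => Delta fr (s⁻¹ • a) t w (matAct s.g⁻¹ x))
      (continuousAt_Delta fr t hx' h3) (continuous_id.add continuous_const).continuousAt
  exact eq_of_eventually_notMem_countable (countable_latticePoints x)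
    (f := fun v => Delta fr a (s * t) v x)
    (g := fun v => Complex.exp (2 * Real.pi * Complex.I * P.eval v x) * Delta fr a s v x *
        Delta fr (s⁻¹ • a) t (v + pair s.μ (matAct s.g⁻¹ x)) (matAct s.g⁻¹ x))
    (continuousAt_Delta fr (s * t) hx h1)
    ((((continuous_const.mul (continuous_eval P x)).cexp.continuousAt).mul
      (continuousAt_Delta fr s hx h2)).mul c3)
    (Eventually.of_forall key)

end

/-! ### Functions on `X` -/

/-- The points `[(w, x)]` of `X` with `w ≠ δ(x)` for all `δ ∈ Λ^∨`; away from them the zeros and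
poles of all `Γ_{a,b}` and `Δ_a` are found. -/
def genericPoints : Set X := {y | ∃ p : Tot, mk p = y ∧ p.1.1 ∉ latticePoints p.1.2}

lemma mul_mem_latticePoints {c : ℂ} (hc : c ≠ 0) {w : ℂ} {x : Fin 3 → ℂ} :
    c * w ∈ latticePoints (c • x) ↔ w ∈ latticePoints x := by
  simp only [latticePoints, Set.mem_range, pair_smul, mul_right_inj' hc]

lemma mk_mem_genericPoints (p : Tot) :
    mk p ∈ genericPoints ↔ p.1.1 ∉ latticePoints p.1.2 := by
  refine ⟨?_, fun h => ⟨p, rfl, h⟩⟩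
  rintro ⟨q, e, hq⟩
  obtain ⟨c, rfl⟩ := Quotient.exact e
  exact fun h => hq ((mul_mem_latticePoints c.ne_zero).2 h)

lemma latticePoints_matAct (g : Matrix.SpecialLinearGroup (Fin 3) ℤ) (x : Fin 3 → ℂ) :
    latticePoints (matAct g x) = latticePoints x := by
  ext w
  constructor
  · rintro ⟨δ, rfl⟩
    exact ⟨δ ᵥ* g.1, (pair_matAct δ g x).symm⟩
  · rintro ⟨δ, rfl⟩
    refine ⟨δ ᵥ* (g⁻¹).1, ?_⟩
    simp only
    rw [pair_matAct, Matrix.vecMul_vecMul, coe_inv_mul, Matrix.vecMul_one]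

lemma smul_mem_genericPoints (s : ISL3) {y : X} (hy : y ∈ genericPoints) :
    s • y ∈ genericPoints := by
  obtain ⟨p, rfl, hp⟩ := hy
  rw [smul_mk, mk_mem_genericPoints]
  change p.1.1 - pair s.μ p.1.2 ∉ latticePoints (matAct s.g p.1.2)
  rw [latticePoints_matAct, sub_eq_add_neg, ← pair_neg]
  exact add_pair_notMem_latticePoints hp _

/-- The point `(w + t, x)`. -/
def Tot.translate (p : Tot) (t : ℂ) : Tot := ⟨(p.1.1 + t, p.1.2), p.2⟩

lemma Tot.translate_zero (p : Tot) : p.translate 0 = p :=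
  Subtype.ext (Prod.ext (add_zero _) rfl)

lemma Tot.continuous_translate (p : Tot) : Continuous p.translate :=
  ((continuous_const.add continuous_id).prodMk continuous_const).subtype_mk _

lemma countable_translate_notMem_genericPoints (p : Tot) :
    {t | mk (p.translate t) ∉ genericPoints}.Countable := by
  have : {t | mk (p.translate t) ∉ genericPoints} ⊆
      (fun v => v - p.1.1) '' latticePoints p.1.2 := by
    intro t ht
    rw [Set.mem_ofPred_eq, mk_mem_genericPoints, not_not] at ht
    exact ⟨_, ht, add_sub_cancel_left _ _⟩
  exact ((countable_latticePoints _).image _).mono this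

/-- A property that defines an open subset of `U` and holds at the generic points of `U` holds on a
dense open subset. -/
lemma eventually_denseOpens {U : Opens X} {P : U → Prop} (ho : IsOpen {z | P z})
    (h : ∀ z : U, (z : X) ∈ genericPoints → P z) : ∀ᶠ z in denseOpens U, P z := by
  refine ⟨{z | P z}, ho, ?_, Set.Subset.rfl⟩
  rw [dense_iff_inter_open]
  rintro N hN ⟨⟨y, hyU⟩, hy⟩
  obtain ⟨p, rfl⟩ : ∃ p, mk p = y := Quotient.exists_rep y
  obtain ⟨N', hN', rfl⟩ := isOpen_induced_iff.1 hN
  have hO : IsOpen ((fun t => mk (p.translate t)) ⁻¹' (N' ∩ U)) :=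
    (hN'.inter U.isOpen).preimage (continuous_mk.comp p.continuous_translate)
  have h0 : (0 : ℂ) ∈ (fun t => mk (p.translate t)) ⁻¹' (N' ∩ U) := by
    rw [Set.mem_preimage, Tot.translate_zero]
    exact ⟨hy, hyU⟩
  obtain ⟨t, ht, ht'⟩ := ((countable_translate_notMem_genericPoints p).dense_compl
    (𝕜 := ℂ)).inter_open_nonempty _ hO ⟨0, h0⟩
  rw [Set.mem_compl_iff, Set.mem_ofPred_eq, not_not] at ht'
  exact ⟨⟨_, ht.2⟩, ht.1, h _ ht'⟩

lemma HolOn.continuousOn {U : Opens X} {F : X → ℂ} (hF : HolOn U F) :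
    ContinuousOn (fun p : Tot => F (mk p)) (mk ⁻¹' U) := by
  have h : ContinuousOn (fun p : Tot => lift F p.1) (mk ⁻¹' U) :=
    (DifferentiableOn.continuousOn hF).comp continuous_subtype_val.continuousOn
      fun p hp => ⟨p.2, hp⟩
  exact h.congr fun p _ => (lift_mk F p.2).symm

lemma HolOn.isOpen_ne_zero {U : Opens X} {F : X → ℂ} (hF : HolOn U F) :
    IsOpen {z : U | F z ≠ 0} := by
  have h : IsOpen ((U : Set X) ∩ {y | F y ≠ 0}) := by
    refine (isQuotientMap_quot_mk (r := (MulAction.orbitRel ℂˣ Tot).r)).isOpen_preimage.1 ?_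
    exact hF.continuousOn.isOpen_inter_preimage (U.isOpen.preimage continuous_mk)
      (isOpen_compl_singleton (x := (0 : ℂ)))
  have e : {z : U | F z ≠ 0} = Subtype.val ⁻¹' ((U : Set X) ∩ {y | F y ≠ 0}) := by
    ext z; simp
  rw [e]
  exact h.preimage continuous_subtype_val

lemma HolOn.eventually_ne_zero {U : Opens X} {F : X → ℂ} (hF : HolOn U F)
    (h : ∀ y ∈ U, y ∈ genericPoints → F y ≠ 0) : ∀ᶠ z : U in denseOpens U, F z ≠ 0 :=
  eventually_denseOpens hF.isOpen_ne_zero fun z hz => h z z.2 hz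

/-- Two holomorphic functions on `U` that agree at the generic points of `U` are equal. -/
lemma HolOn.eq_of_generic {U : Opens X} {F G : X → ℂ} (hF : HolOn U F) (hG : HolOn U G)
    (h : ∀ y ∈ U, y ∈ genericPoints → F y = G y) {y : X} (hy : y ∈ U) : F y = G y := by
  obtain ⟨p, rfl⟩ : ∃ p, mk p = y := Quotient.exists_rep y
  have hO : (fun t => mk (p.translate t)) ⁻¹' U ∈ nhds (0 : ℂ) := by
    refine (U.isOpen.preimage (continuous_mk.comp p.continuous_translate)).mem_nhds ?_
    rw [Set.mem_preimage, Function.comp_apply, Tot.translate_zero]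
    exact hy
  have hc : ∀ {F : X → ℂ}, HolOn U F →
      ContinuousAt (fun t => F (mk (p.translate t))) 0 := by
    intro F hF
    refine ContinuousAt.comp (f := p.translate) (g := fun p => F (mk p)) ?_
      p.continuous_translate.continuousAt
    refine hF.continuousOn.continuousAt
      ((U.isOpen.preimage continuous_mk).mem_nhds ?_)
    rw [Tot.translate_zero]; exact hy
  have := eq_of_eventually_notMem_countable (countable_translate_notMem_genericPoints p) (hc hF)
    (hc hG) (by
      filter_upwards [hO] with t ht ht'
      exact h _ ht (not_not.1 ht'))
  simpa only [Tot.translate_zero] using this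

/-- The function on `X` given by a function of `(w, x)` that is invariant under scaling. It takes the
value at a chosen representative, so that the invariance is needed only in the lemmas. -/
noncomputable def descend (f : ℂ → (Fin 3 → ℂ) → ℂ) (y : X) : ℂ :=
  f (Quotient.out y).1.1 (Quotient.out y).1.2

lemma descend_mk {f : ℂ → (Fin 3 → ℂ) → ℂ} {p : Tot}
    (hf : ∀ c : ℂ, c ≠ 0 → f (c * p.1.1) (c • p.1.2) = f p.1.1 p.1.2) :
    descend f (mk p) = f p.1.1 p.1.2 := by
  obtain ⟨c, hc⟩ := Quotient.exact (Quotient.out_eq (mk p) : mk (Quotient.out (mk p)) = mk p)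
  change f (Quotient.out (mk p)).1.1 (Quotient.out (mk p)).1.2 = _
  rw [← hc]
  exact hf c c.ne_zero

lemma holOn_descend {U : Opens X} {f : ℂ → (Fin 3 → ℂ) → ℂ}
    (hf : ∀ p : Tot, mk p ∈ U → ∀ c : ℂ, c ≠ 0 → f (c * p.1.1) (c • p.1.2) = f p.1.1 p.1.2)
    (hd : DifferentiableOn ℂ (fun p : ℂ × (Fin 3 → ℂ) => f p.1 p.2) (cone U)) :
    HolOn U (descend f) := by
  refine DifferentiableOn.congr hd ?_
  rintro p ⟨hp, hpU⟩
  rw [lift_mk _ hp, descend_mk (hf ⟨p, hp⟩ hpU)]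

lemma differentiable_pair (δ : Fin 3 → ℤ) : Differentiable ℂ (pair δ) := by
  unfold pair; fun_prop

lemma differentiable_aeval (P : MvPolynomial (Fin 3) ℚ) :
    Differentiable ℂ fun x : Fin 3 → ℂ => MvPolynomial.aeval x P := by
  induction P using MvPolynomial.induction_on with
  | C q => simp
  | add p q hp hq => simp only [map_add]; exact hp.add hq
  | mul_X p i hp =>
    simp only [map_mul, MvPolynomial.aeval_X]
    exact hp.mul (differentiable_apply i)

lemma differentiableOn_eval (P : QxW) {S : Set (ℂ × (Fin 3 → ℂ))}
    (hS : ∀ p ∈ S, P.RegularAt p.2) :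
    DifferentiableOn ℂ (fun p : ℂ × (Fin 3 → ℂ) => P.eval p.1 p.2) S := by
  simp only [QxW.eval, div_eq_mul_inv]
  refine DifferentiableOn.mul ?_ (DifferentiableOn.inv
    ((differentiable_aeval P.den).comp differentiable_snd).differentiableOn hS)
  simp only [Polynomial.eval₂_eq_sum_range]
  refine (Differentiable.fun_sum fun i _ => ?_).differentiableOn
  exact ((differentiable_aeval _).comp differentiable_snd).mul (differentiable_fst.pow i)

/-! ### Exponentials of elements of `ℚ(x)[w]` as holomorphic functions on `X` -/

/-- The function `exp(c P)` on `X`, evaluated at chosen representatives; see `expEval_mk` for the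
independence of the choice. -/
noncomputable def expEval (c : ℂ) (P : QxW) : X → ℂ := descend fun w x => Complex.exp (c * P.eval w x)

lemma expEval_ne_zero (c : ℂ) (P : QxW) (y : X) : expEval c P y ≠ 0 := Complex.exp_ne_zero _

section
variable {U : Opens X} {c : ℂ} {P : QxW} {G : X → ℂ}

/-- If `exp(c P)` agrees at generic points with a function on `X`, then it is invariant under
scaling, although `P` need not be. -/
lemma exp_eval_smul (hG : ∀ p : Tot, mk p ∈ U → mk p ∈ genericPoints →
    Complex.exp (c * P.eval p.1.1 p.1.2) = G (mk p)) (p : Tot) (hp : mk p ∈ U) (l : ℂ)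
    (hl : l ≠ 0) :
    Complex.exp (c * P.eval (l * p.1.1) (l • p.1.2)) = Complex.exp (c * P.eval p.1.1 p.1.2) := by
  have hO : (fun t => mk (p.translate t)) ⁻¹' U ∈ nhds (0 : ℂ) := by
    refine (U.isOpen.preimage (continuous_mk.comp p.continuous_translate)).mem_nhds ?_
    rw [Set.mem_preimage, Function.comp_apply, Tot.translate_zero]
    exact hp
  have h1 : Continuous fun t => Complex.exp (c * P.eval (l * (p.1.1 + t)) (l • p.1.2)) :=
    (continuous_const.mul ((continuous_eval P _).comp
      (continuous_const.mul (continuous_const.add continuous_id)))).cexp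
  have h2 : Continuous fun t => Complex.exp (c * P.eval (p.1.1 + t) p.1.2) :=
    (continuous_const.mul ((continuous_eval P _).comp (continuous_const.add continuous_id))).cexp
  have := eq_of_eventually_notMem_countable (countable_translate_notMem_genericPoints p)
    h1.continuousAt h2.continuousAt (u := 0) (by
      filter_upwards [hO] with t ht ht'
      have ht' := not_not.1 ht'
      have e : mk (Units.mk0 l hl • p.translate t) = mk (p.translate t) :=
        Quotient.sound ⟨Units.mk0 l hl, rfl⟩
      have g1 := hG (Units.mk0 l hl • p.translate t) (by rw [e]; exact ht) (by rw [e]; exact ht')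
      rw [e, ← hG _ ht ht'] at g1
      exact g1)
  simpa only [add_zero] using this

variable (hG : ∀ p : Tot, mk p ∈ U → mk p ∈ genericPoints →
    Complex.exp (c * P.eval p.1.1 p.1.2) = G (mk p))
include hG

lemma expEval_mk (p : Tot) (hp : mk p ∈ U) :
    expEval c P (mk p) = Complex.exp (c * P.eval p.1.1 p.1.2) :=
  descend_mk fun l hl => exp_eval_smul hG p hp l hl

lemma expEval_eq_of_generic {y : X} (hy : y ∈ U) (hg : y ∈ genericPoints) : expEval c P y = G y := by
  obtain ⟨p, rfl⟩ : ∃ p, mk p = y := Quotient.exists_rep y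
  rw [expEval_mk hG p hy, hG p hy hg]

lemma holOn_expEval (hP : ∀ p : Tot, mk p ∈ U → P.RegularAt p.1.2) : HolOn U (expEval c P) := by
  refine holOn_descend (exp_eval_smul hG) ?_
  refine DifferentiableOn.cexp (DifferentiableOn.const_mul (differentiableOn_eval P ?_) c)
  rintro p ⟨h, hp⟩
  exact hP ⟨p, h⟩ hp

end

/-! ### Sections of the sheaves `𝒪ˣ` and `ℳˣ` -/

section
variable {U W : Opens X}

/-- The section of `𝒪ˣ` given by a holomorphic function without zeros. -/
noncomputable def holSection (F : X → ℂ) (hF : HolOn U F) (h0 : ∀ y, F y ≠ 0) : holSheaf.sec U :=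
  (⟨fun y => Units.mk0 (F y) (h0 y), F, hF, fun _ => rfl⟩ : holUnits U)

/-- The value of a section of `𝒪ˣ` at a point. -/
noncomputable def holEval (y : U) : holSheaf.sec U →* ℂˣ where
  toFun f := holFun f y
  map_one' := rfl
  map_mul' _ _ := rfl

lemma holEval_pull (s : ISL3) (hs : ∀ y ∈ W, s⁻¹ • y ∈ U) (f : holSheaf.sec U) (y : W) :
    holEval y (holSheaf.pull s hs f) = holEval ⟨s⁻¹ • (y : X), hs y y.2⟩ f := rfl

lemma holEval_res (h : W ≤ U) (f : holSheaf.sec U) (y : W) :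
    holEval y (holSheaf.res h f) = holEval ⟨y, h y.2⟩ f := by
  rw [EquivPresheaf.res, holEval_pull]
  have e : (⟨(1 : ISL3)⁻¹ • (y : X), by simpa using h y.2⟩ : U) = ⟨y, h y.2⟩ :=
    Subtype.ext (by simp)
  exact congrArg (fun z => holEval z f) e

/-- A section of `𝒪ˣ` with value `1` at all generic points is `1`. -/
lemma holSheaf_eq_one {f : holSheaf.sec U}
    (h : ∀ y : U, (y : X) ∈ genericPoints → (holEval y f : ℂ) = 1) : f = 1 := by
  obtain ⟨F, hF, e⟩ := (f : holUnits U).2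
  refine Subtype.ext (funext fun y => Units.ext ?_)
  have e' : ∀ y : U, (holEval y f : ℂ) = F y := e
  change (holEval y f : ℂ) = 1
  rw [e']
  exact hF.eq_of_generic (HolOn.one U) (fun z hz hg => (e' ⟨z, hz⟩).symm.trans (h ⟨z, hz⟩ hg)) y.2

lemma IsGermOf.eq {c c' : merSheaf.sec U} {f f' : X → ℂ} (h : IsGermOf c f) (h' : IsGermOf c' f')
    (e : ∀ᶠ z : U in denseOpens U, f z = f' z) : c = c' := by
  obtain ⟨c, hc⟩ := c
  obtain ⟨c', hc'⟩ := c'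
  refine Subtype.ext ?_
  change c = c'
  change Germ.map Units.val c = _ at h
  change Germ.map Units.val c' = _ at h'
  induction c using Germ.inductionOn with
  | h u =>
  induction c' using Germ.inductionOn with
  | h u' =>
  have h1 : ∀ᶠ z : U in denseOpens U, (u z : ℂ) = f z := Germ.coe_eq.1 h
  have h2 : ∀ᶠ z : U in denseOpens U, (u' z : ℂ) = f' z := Germ.coe_eq.1 h'
  refine Germ.coe_eq.2 ?_
  filter_upwards [h1, h2, e] with z h1 h2 e
  exact Units.ext (by rw [h1, e, h2])

lemma IsGermOf.mul {c c' : merSheaf.sec U} {f f' : X → ℂ} (h : IsGermOf c f) (h' : IsGermOf c' f') :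
    IsGermOf (c * c') fun y => f y * f' y := by
  obtain ⟨c, hc⟩ := c
  obtain ⟨c', hc'⟩ := c'
  change Germ.map Units.val c = _ at h
  change Germ.map Units.val c' = _ at h'
  change Germ.map Units.val (c * c') = _
  induction c using Germ.inductionOn with
  | h u =>
  induction c' using Germ.inductionOn with
  | h u' =>
  have h1 : ∀ᶠ z : U in denseOpens U, (u z : ℂ) = f z := Germ.coe_eq.1 h
  have h2 : ∀ᶠ z : U in denseOpens U, (u' z : ℂ) = f' z := Germ.coe_eq.1 h'
  refine Germ.coe_eq.2 ?_
  filter_upwards [h1, h2] with z h1 h2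
  change (u z : ℂ) * u' z = _
  rw [h1, h2]

lemma isGermOf_one : IsGermOf (1 : merSheaf.sec U) fun _ => 1 := rfl

lemma IsGermOf.zpow {c : merSheaf.sec U} {f : X → ℂ} (h : IsGermOf c f) (n : ℤ) :
    IsGermOf (c ^ n) fun y => f y ^ n := by
  obtain ⟨c, hc⟩ := c
  change Germ.map Units.val c = _ at h
  change Germ.map Units.val (((⟨c, hc⟩ : merUnits U) ^ n : merUnits U) :
    Germ (denseOpens U) ℂˣ) = _
  rw [Subgroup.coe_zpow]
  change Germ.map Units.val (c ^ n) = _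
  induction c using Germ.inductionOn with
  | h u =>
  have h1 : ∀ᶠ z : U in denseOpens U, (u z : ℂ) = f z := Germ.coe_eq.1 h
  refine Germ.coe_eq.2 ?_
  filter_upwards [h1] with z h1
  change ((u z ^ n : ℂˣ) : ℂ) = _
  rw [Units.val_zpow_eq_zpow_val, h1]

lemma IsGermOf.prod {ι : Type*} (s : Finset ι) {c : ι → merSheaf.sec U} {f : ι → X → ℂ}
    (h : ∀ i, IsGermOf (c i) (f i)) : IsGermOf (∏ i ∈ s, c i) fun y => ∏ i ∈ s, f i y := by
  classical
  induction s using Finset.induction_on with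
  | empty => exact isGermOf_one
  | insert i s hi ih =>
    simp only [Finset.prod_insert hi]
    exact (h i).mul ih

lemma IsGermOf.pull {s : ISL3} (hs : ∀ y ∈ W, s⁻¹ • y ∈ U) {c : merSheaf.sec U} {f : X → ℂ}
    (h : IsGermOf c f) : IsGermOf (merSheaf.pull s hs c) fun y => f (s⁻¹ • y) := by
  obtain ⟨c, hc⟩ := c
  change Germ.map Units.val c = _ at h
  change Germ.map Units.val (c.compTendsto (shift s hs) (tendsto_shift s hs)) = _
  induction c using Germ.inductionOn with
  | h u =>
  have h1 : ∀ᶠ z : U in denseOpens U, (u z : ℂ) = f z := Germ.coe_eq.1 h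
  exact Germ.coe_eq.2 ((tendsto_shift s hs).eventually h1)

lemma IsGermOf.res (hW : W ≤ U) {c : merSheaf.sec U} {f : X → ℂ} (h : IsGermOf c f) :
    IsGermOf (merSheaf.res hW c) f := by
  have := h.pull (s := 1) (W := W) (fun y hy => by simpa using hW hy)
  have e : (fun y => f ((1 : ISL3)⁻¹ • y)) = f := funext fun y => by rw [inv_one, one_smul]
  rw [e] at this
  exact this

/-- A quotient of holomorphic functions, which vanish at no generic point, as a section of `ℳˣ`. -/
lemma exists_isGermOf_div {F H : X → ℂ} (hF : HolOn U F) (hH : HolOn U H)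
    (hF0 : ∀ y ∈ U, y ∈ genericPoints → F y ≠ 0) (hH0 : ∀ y ∈ U, y ∈ genericPoints → H y ≠ 0) :
    ∃ c : merSheaf.sec U, IsGermOf c fun y => F y / H y := by
  classical
  let u : U → ℂˣ := fun z => if h : F z / H z ≠ 0 then Units.mk0 _ h else 1
  have hu : ∀ᶠ z : U in denseOpens U, F z ≠ 0 ∧ H z ≠ 0 ∧ (u z : ℂ) = F z / H z := by
    filter_upwards [hF.eventually_ne_zero hF0, hH.eventually_ne_zero hH0] with z h1 h2
    refine ⟨h1, h2, ?_⟩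
    have h : F z / H z ≠ 0 := div_ne_zero h1 h2
    simp only [u, dif_pos h, Units.val_mk0]
  refine ⟨(⟨(u : Germ (denseOpens U) ℂˣ), u, rfl, fun y hy => ⟨U, hy, F, H, hF, hH, ?_⟩⟩ :
    merUnits U), Germ.coe_eq.2 (hu.mono fun z hz => hz.2.2)⟩
  filter_upwards [hu] with z hz _
  refine ⟨hz.2.1, ?_⟩
  rw [hz.2.2, div_mul_cancel₀ _ hz.2.1]

end

/-! ### `Γ_{a,b}` and `Δ_a` as meromorphic functions on `X` -/

section
variable (fr : Framing) {U : Opens X} {a b : Prim}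

lemma coneNum_smul {a b : Fin 3 → ℤ} (h : a ⨯₃ b ≠ 0) (m n : ℤ) {l : ℂ} (hl : l ≠ 0) (w : ℂ)
    (x : Fin 3 → ℂ) : coneNum a b m n (l * w) (l • x) = coneNum a b m n w x := by
  refine (coneProd_congr (gam_dot_left h) (gam_dot_right h) (gam_dot_left h) (gam_dot_right h)
    (Equiv.refl _) (fun _ _ => Iff.rfl) (fun _ => Iff.rfl) fun δ => ?_).2
  rw [pair_smul, pair_smul, ← mul_sub, mul_left_comm, mul_div_mul_left _ _ hl]
  rfl

lemma holOn_coneNum {a b : Prim} (h : a.1 ⨯₃ b.1 ≠ 0) (hU : ∀ y ∈ U, y ∈ VSet a ∧ y ∈ VSet b) :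
    HolOn U (descend (coneNum a.1 b.1 0 0)) := by
  refine holOn_descend (fun p _ l hl => coneNum_smul h 0 0 hl _ _) ?_
  have hd := det_cross_pos h
  have ht := isDualTriple_gam hd
  have hx : ∀ p ∈ cone U, p.2 ∈ Uplus a.1 ∧ p.2 ∈ Uplus b.1 := by
    rintro p ⟨hp, hpU⟩
    exact ⟨(mk_mem_VSet a ⟨p, hp⟩).1 (hU _ hpU).1, (mk_mem_VSet b ⟨p, hp⟩).1 (hU _ hpU).2⟩
  have hα := fun p hp => im_neg_div_pos (ht.cyclic.im_div_pos (by rwa [← det_cyclic]) (hx p hp).2)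
  have hβ := fun p hp => ht.im_div_pos hd (hx p hp).1
  refine DifferentiableOn.congr ?_ fun p hp => coneNum_eq_prod_gammaNum ht (hα p hp) (hβ p hp) p.1
  have hpair : ∀ δ, DifferentiableOn ℂ (fun p : ℂ × (Fin 3 → ℂ) => pair δ p.2) (cone U) := fun δ =>
    ((differentiable_pair δ).comp differentiable_snd).differentiableOn
  exact differentiableOn_finset_prod _ fun δ => differentiableOn_gammaNum
    (differentiable_fst.differentiableOn.add (hpair δ)) (hpair _) (hpair _) (hpair _) hα hβ

lemma descend_coneNum_ne_zero {a b : Prim} (h : a.1 ⨯₃ b.1 ≠ 0) {y : X} (ha : y ∈ VSet a)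
    (hb : y ∈ VSet b) (hy : y ∈ genericPoints) : descend (coneNum a.1 b.1 0 0) y ≠ 0 := by
  obtain ⟨p, rfl⟩ : ∃ p, mk p = y := Quotient.exists_rep y
  rw [descend_mk fun l hl => coneNum_smul h 0 0 hl _ _]
  exact coneNum_ne_zero h ((mk_mem_VSet a p).1 ha) ((mk_mem_VSet b p).1 hb) 0 0
    ((mk_mem_genericPoints p).1 hy)

lemma GamX_ne_zero {y : X} (ha : y ∈ VSet a) (hb : y ∈ VSet b) (hy : y ∈ genericPoints) :
    GamX a b y ≠ 0 := by
  obtain ⟨p, rfl⟩ : ∃ p, mk p = y := Quotient.exists_rep y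
  exact Gam_ne_zero ((mk_mem_VSet a p).1 ha) ((mk_mem_VSet b p).1 hb)
    ((mk_mem_genericPoints p).1 hy)

/-- `Γ_{a,b}` is a quotient of holomorphic functions. -/
lemma exists_GamX_eq_div (hU : ∀ y ∈ U, y ∈ VSet a ∧ y ∈ VSet b) : ∃ F H : X → ℂ, HolOn U F ∧
    HolOn U H ∧ (∀ y ∈ U, y ∈ genericPoints → F y ≠ 0) ∧ (∀ y ∈ U, y ∈ genericPoints → H y ≠ 0) ∧
    ∀ y, GamX a b y = F y / H y := by
  by_cases h : a.1 ⨯₃ b.1 = 0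
  · refine ⟨_, _, HolOn.one U, HolOn.one U, by simp, by simp, fun y => ?_⟩
    obtain ⟨p, rfl⟩ : ∃ p, mk p = y := Quotient.exists_rep y
    change Gam a b p.1.1 p.1.2 = _
    rw [Gam, if_pos h, div_one]
  · have h' := cross_swap_ne_zero h
    refine ⟨_, _, holOn_coneNum h hU, holOn_coneNum h' fun y hy => (hU y hy).symm,
      fun y hy => descend_coneNum_ne_zero h (hU y hy).1 (hU y hy).2,
      fun y hy => descend_coneNum_ne_zero h' (hU y hy).2 (hU y hy).1, fun y => ?_⟩
    obtain ⟨p, rfl⟩ : ∃ p, mk p = y := Quotient.exists_rep y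
    rw [descend_mk fun l hl => coneNum_smul h 0 0 hl _ _,
      descend_mk fun l hl => coneNum_smul h' 0 0 hl _ _]
    exact Gam_eq a b h p.1.1 p.1.2

lemma thetaRow_smul (δ β γ : Fin 3 → ℤ) {l : ℂ} (hl : l ≠ 0) (w : ℂ) (x : Fin 3 → ℂ) :
    thetaRow δ β γ (l * w) (l • x) = thetaRow δ β γ w x := by
  rw [thetaRow, pair_smul, pair_smul, pair_smul, ← mul_add, mul_div_mul_left _ _ hl,
    mul_div_mul_left _ _ hl, thetaRow]

lemma holOn_thetaProd (hU : ∀ y ∈ U, y ∈ VSet a) (s : Finset ℤ) :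
    HolOn U (descend fun w x => ∏ j ∈ s, fr.theta a j w x) := by
  refine holOn_descend (fun p _ l hl => Finset.prod_congr rfl fun j _ =>
    thetaRow_smul _ _ _ hl _ _) ?_
  have him : ∀ p ∈ cone U, 0 < (pair ((fr.basis a).1 1) p.2 / pair ((fr.basis a).1 2) p.2).im := by
    rintro p ⟨hp, hpU⟩
    exact fr.im_pos ((mk_mem_VSet a ⟨p, hp⟩).1 (hU _ hpU))
  have hpair : ∀ δ, DifferentiableOn ℂ (fun p : ℂ × (Fin 3 → ℂ) => pair δ p.2) (cone U) := fun δ =>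
    ((differentiable_pair δ).comp differentiable_snd).differentiableOn
  have hinv : DifferentiableOn ℂ (fun p : ℂ × (Fin 3 → ℂ) => (pair ((fr.basis a).1 2) p.2)⁻¹)
      (cone U) := (hpair _).inv fun p hp => right_ne_zero_of_im_div_pos (him p hp)
  refine differentiableOn_finset_prod s fun j => differentiableOn_theta0 ?_ ?_ him
  · simp only [div_eq_mul_inv]
    exact (differentiable_fst.differentiableOn.add (hpair _)).mul hinv
  · simp only [div_eq_mul_inv]
    exact (hpair _).mul hinv

lemma descend_thetaProd_ne_zero {y : X} (ha : y ∈ VSet a) (hy : y ∈ genericPoints)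
    (s : Finset ℤ) : descend (fun w x => ∏ j ∈ s, fr.theta a j w x) y ≠ 0 := by
  obtain ⟨p, rfl⟩ : ∃ p, mk p = y := Quotient.exists_rep y
  rw [descend_mk fun l hl => Finset.prod_congr rfl fun j _ => thetaRow_smul _ _ _ hl _ _]
  exact Finset.prod_ne_zero_iff.2 fun j _ =>
    fr.theta_ne_zero ((mk_mem_VSet a p).1 ha) j ((mk_mem_genericPoints p).1 hy)

lemma DeltaX_ne_zero (s : ISL3) {y : X} (ha : y ∈ VSet a) (hy : y ∈ genericPoints) :
    DeltaX fr a s y ≠ 0 := by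
  obtain ⟨p, rfl⟩ : ∃ p, mk p = y := Quotient.exists_rep y
  exact Delta_ne_zero fr s ((mk_mem_VSet a p).1 ha) ((mk_mem_genericPoints p).1 hy)

/-- `Δ_a` is a quotient of holomorphic functions. -/
lemma exists_DeltaX_eq_div (s : ISL3) (hU : ∀ y ∈ U, y ∈ VSet a) : ∃ F H : X → ℂ, HolOn U F ∧
    HolOn U H ∧ (∀ y ∈ U, y ∈ genericPoints → F y ≠ 0) ∧ (∀ y ∈ U, y ∈ genericPoints → H y ≠ 0) ∧
    ∀ y, DeltaX fr a s y = F y / H y := by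
  refine ⟨_, _, holOn_thetaProd fr hU (Finset.Ico 0 ((s.μ ᵥ* s.g⁻¹.1) ⬝ᵥ a.1)),
    holOn_thetaProd fr hU (Finset.Ico ((s.μ ᵥ* s.g⁻¹.1) ⬝ᵥ a.1) 0),
    fun y hy hg => descend_thetaProd_ne_zero fr (hU y hy) hg _,
    fun y hy hg => descend_thetaProd_ne_zero fr (hU y hy) hg _, fun y => ?_⟩
  obtain ⟨p, rfl⟩ : ∃ p, mk p = y := Quotient.exists_rep y
  rw [descend_mk fun l hl => Finset.prod_congr rfl fun j _ => thetaRow_smul _ _ _ hl _ _,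
    descend_mk fun l hl => Finset.prod_congr rfl fun j _ => thetaRow_smul _ _ _ hl _ _]
  exact Delta_eq fr a s p.1.1 p.1.2

lemma exists_isGermOf_GamX (hU : ∀ y ∈ U, y ∈ VSet a ∧ y ∈ VSet b) :
    ∃ c : merSheaf.sec U, IsGermOf c (GamX a b) := by
  obtain ⟨F, H, hF, hH, hF0, hH0, e⟩ := exists_GamX_eq_div hU
  rw [funext e]
  exact exists_isGermOf_div hF hH hF0 hH0

lemma exists_isGermOf_DeltaX (s : ISL3) (hU : ∀ y ∈ U, y ∈ VSet a) :
    ∃ c : merSheaf.sec U, IsGermOf c (DeltaX fr a s) := by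
  obtain ⟨F, H, hF, hH, hF0, hH0, e⟩ := exists_DeltaX_eq_div fr s hU
  rw [funext e]
  exact exists_isGermOf_div hF hH hF0 hH0

lemma eventually_GamX_ne_zero (hU : ∀ y ∈ U, y ∈ VSet a ∧ y ∈ VSet b) :
    ∀ᶠ z : U in denseOpens U, GamX a b z ≠ 0 := by
  obtain ⟨F, H, hF, hH, hF0, hH0, e⟩ := exists_GamX_eq_div hU
  filter_upwards [hF.eventually_ne_zero hF0, hH.eventually_ne_zero hH0] with z h1 h2
  rw [e]
  exact div_ne_zero h1 h2

lemma eventually_DeltaX_ne_zero (s : ISL3) (hU : ∀ y ∈ U, y ∈ VSet a) :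
    ∀ᶠ z : U in denseOpens U, DeltaX fr a s z ≠ 0 := by
  obtain ⟨F, H, hF, hH, hF0, hH0, e⟩ := exists_DeltaX_eq_div fr s hU
  filter_upwards [hF.eventually_ne_zero hF0, hH.eventually_ne_zero hH0] with z h1 h2
  rw [e]
  exact div_ne_zero h1 h2

end

/-! ### The coboundary of `(Γ_{a,b}, Δ_a)` as a family of functions on `X` -/

/-- The Čech coboundary of `Γ`, of bidegree `(0, 2)`. -/
noncomputable def cobGam (a b c : Prim) (y : X) : ℂ :=
  GamX b c y * (GamX a c y)⁻¹ * GamX a b y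

/-- The component of bidegree `(1, 1)` of the coboundary of `(Γ, Δ)`. -/
noncomputable def cobMixed (fr : Framing) (s : ISL3) (a b : Prim) (y : X) : ℂ :=
  (DeltaX fr b s y * (DeltaX fr a s y)⁻¹ *
    (GamX (s⁻¹ • a) (s⁻¹ • b) (s⁻¹ • y) * (GamX a b y)⁻¹))⁻¹

/-- The group coboundary of `Δ`, of bidegree `(2, 0)`. -/
noncomputable def cobDelta (fr : Framing) (s t : ISL3) (a : Prim) (y : X) : ℂ :=
  DeltaX fr (s⁻¹ • a) t (s⁻¹ • y) * ((DeltaX fr a (s * t) y)⁻¹ * DeltaX fr a s y)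

lemma inv_smul_val (s : ISL3) (p : Tot) :
    (s⁻¹ • p).1 = (p.1.1 + pair s.μ (matAct s.g⁻¹ p.1.2), matAct s.g⁻¹ p.1.2) := by
  refine Prod.ext ?_ rfl
  change p.1.1 - pair (-(s.μ ᵥ* (s.g⁻¹).1)) p.1.2 = _
  rw [pair_neg, sub_neg_eq_add, ← pair_mul]
  rfl

lemma GamX_inv_smul_mk (a b : Prim) (s : ISL3) (p : Tot) : GamX a b (s⁻¹ • mk p) =
    Gam a b (p.1.1 + pair s.μ (matAct s.g⁻¹ p.1.2)) (matAct s.g⁻¹ p.1.2) := by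
  change Gam a b (s⁻¹ • p).1.1 (s⁻¹ • p).1.2 = _
  rw [inv_smul_val]

lemma DeltaX_inv_smul_mk (fr : Framing) (a : Prim) (s t : ISL3) (p : Tot) :
    DeltaX fr a t (s⁻¹ • mk p) =
      Delta fr a t (p.1.1 + pair s.μ (matAct s.g⁻¹ p.1.2)) (matAct s.g⁻¹ p.1.2) := by
  change Delta fr a t (s⁻¹ • p).1.1 (s⁻¹ • p).1.2 = _
  rw [inv_smul_val]

/-! ### Cochains of degrees `1` and `2`, and the values of their differentials -/

section
variable {G X I : Type} [Group G] [TopologicalSpace X] [MulAction G X] [MulAction G I]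
  {𝒱 : EquivCover G X I} {F : EquivPresheaf G X}

/-- The `1`-cochain with given components. -/
def cochain₁ (c01 : BiCochain 𝒱 F 0 1) (c10 : BiCochain 𝒱 F 1 0) : EquivCochain 𝒱 F 1
  | 0, 1, _ => c01
  | 1, 0, _ => c10
  | 0, 0, h => absurd h (by omega)
  | 0, _ + 2, h => absurd h (by omega)
  | 1, _ + 1, h => absurd h (by omega)
  | _ + 2, _, h => absurd h (by omega)

/-- The `2`-cochain with given components. -/
def cochain₂ (c02 : BiCochain 𝒱 F 0 2) (c11 : BiCochain 𝒱 F 1 1) (c20 : BiCochain 𝒱 F 2 0) :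
    EquivCochain 𝒱 F 2
  | 0, 2, _ => c02
  | 1, 1, _ => c11
  | 2, 0, _ => c20
  | 0, 0, h => absurd h (by omega)
  | 0, 1, h => absurd h (by omega)
  | 0, _ + 3, h => absurd h (by omega)
  | 1, 0, h => absurd h (by omega)
  | 1, _ + 2, h => absurd h (by omega)
  | 2, _ + 1, h => absurd h (by omega)
  | _ + 3, _, h => absurd h (by omega)

end

section
variable {I : Type} [MulAction ISL3 I] {𝒱 : EquivCover ISL3 X I} {p q : ℕ}

lemma holEval_cechD (c : BiCochain 𝒱 holSheaf p q) (g : Fin p → ISL3) (a : Fin (q + 2) → I)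
    (y : 𝒱.inter a) : (holEval y (cechD 𝒱 holSheaf c g a) : ℂ) =
      ∏ i : Fin (q + 2), (holEval ⟨y, 𝒱.inter_face a i y.2⟩ (c g (a ∘ i.succAbove)) : ℂ) ^
        ((-1 : ℤ) ^ (i : ℕ)) := by
  rw [cechD, map_prod, Units.coe_prod]
  refine Finset.prod_congr rfl fun i _ => ?_
  rw [map_zpow, holEval_res, Units.val_zpow_eq_zpow_val]

lemma holEval_groupD (c : BiCochain 𝒱 holSheaf p q) (g : Fin (p + 1) → ISL3)
    (a : Fin (q + 1) → I) (y : 𝒱.inter a) : (holEval y (groupD 𝒱 holSheaf c g a) : ℂ) =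
      (holEval ⟨(g 0)⁻¹ • (y : X), 𝒱.inter_smul (g 0) a y y.2⟩
        (c (fun j => g j.succ) ((g 0)⁻¹ • a)) : ℂ) *
      ∏ j : Fin (p + 1), (holEval y (c (Fin.contractNth j (· * ·) g) a) : ℂ) ^
        ((-1 : ℤ) ^ ((j : ℕ) + 1)) := by
  rw [groupD, map_mul, Units.val_mul, holEval_pull, map_prod, Units.coe_prod]
  congr 1
  refine Finset.prod_congr rfl fun i _ => ?_
  rw [map_zpow, Units.val_zpow_eq_zpow_val]

lemma isGermOf_cechD {c : BiCochain 𝒱 merSheaf p q} {f : (Fin p → ISL3) → (Fin (q + 1) → I) → X → ℂ}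
    (h : ∀ g a, IsGermOf (c g a) (f g a)) (g : Fin p → ISL3) (a : Fin (q + 2) → I) :
    IsGermOf (cechD 𝒱 merSheaf c g a)
      fun y => ∏ i : Fin (q + 2), f g (a ∘ i.succAbove) y ^ ((-1 : ℤ) ^ (i : ℕ)) :=
  IsGermOf.prod _ fun i => ((h g _).res (𝒱.inter_face a i)).zpow _

lemma isGermOf_groupD {c : BiCochain 𝒱 merSheaf p q}
    {f : (Fin p → ISL3) → (Fin (q + 1) → I) → X → ℂ}
    (h : ∀ g a, IsGermOf (c g a) (f g a)) (g : Fin (p + 1) → ISL3) (a : Fin (q + 1) → I) :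
    IsGermOf (groupD 𝒱 merSheaf c g a) fun y =>
      f (fun j => g j.succ) ((g 0)⁻¹ • a) ((g 0)⁻¹ • y) *
      ∏ j : Fin (p + 1), f (Fin.contractNth j (· * ·) g) a y ^ ((-1 : ℤ) ^ ((j : ℕ) + 1)) :=
  ((h _ _).pull _).mul (IsGermOf.prod _ fun _ => (h _ a).zpow _)

end

lemma mem_inter_cover {q : ℕ} {a : Fin (q + 1) → Prim} {y : X} (hy : y ∈ cover.inter a)
    (i : Fin (q + 1)) : y ∈ VSet (a i) := (cover.mem_inter a y).1 hy i

lemma smul_mem_VSet (s : ISL3) {a : Prim} {y : X} (hy : y ∈ VSet a) : s • y ∈ VSet (s • a) :=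
  cover.equivariant s a y hy

variable (fr : Framing)

/-- A `2`-cochain whose values at generic points are those of the coboundary of `(Γ, Δ)` is a
cocycle: at these points nothing vanishes, and the factors of its differential cancel. -/
lemma isCocycle_of_generic {φ : EquivCochain cover holSheaf 2}
    (h02 : ∀ g a (y : cover.inter a), (y : X) ∈ genericPoints →
      (holEval y (φ 0 2 rfl g a) : ℂ) = cobGam (a 0) (a 1) (a 2) y)
    (h11 : ∀ g a (y : cover.inter a), (y : X) ∈ genericPoints →
      (holEval y (φ 1 1 rfl g a) : ℂ) = cobMixed fr (g 0) (a 0) (a 1) y)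
    (h20 : ∀ g a (y : cover.inter a), (y : X) ∈ genericPoints →
      (holEval y (φ 2 0 rfl g a) : ℂ) = cobDelta fr (g 0) (g 1) (a 0) y) : IsCocycle φ := by
  funext p q h g a
  refine holSheaf_eq_one fun y hy => ?_
  have hV := mem_inter_cover y.2
  have hΓ : ∀ i j, GamX (a i) (a j) y ≠ 0 := fun i j => GamX_ne_zero (hV i) (hV j) hy
  have hΔ : ∀ i s, DeltaX fr (a i) s y ≠ 0 := fun i s => DeltaX_ne_zero fr s (hV i) hy
  have hsΓ : ∀ (s : ISL3) i j, GamX (s • a i) (s • a j) (s • (y : X)) ≠ 0 := fun s i j =>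
    GamX_ne_zero (smul_mem_VSet s (hV i)) (smul_mem_VSet s (hV j)) (smul_mem_genericPoints s hy)
  have hsΔ : ∀ (s : ISL3) i t, DeltaX fr (s • a i) t (s • (y : X)) ≠ 0 := fun s i t =>
    DeltaX_ne_zero fr t (smul_mem_VSet s (hV i)) (smul_mem_genericPoints s hy)
  match p, q, h with
  | 0, 3, h =>
    change (holEval y (cechD cover holSheaf (φ 0 2 rfl) g a) : ℂ) = 1
    rw [holEval_cechD]
    simp only [h02 _ _ ⟨y, _⟩ hy, Fin.prod_univ_succ, cobGam]
    change ((GamX (a 2) (a 3) y * (GamX (a 1) (a 3) y)⁻¹ * GamX (a 1) (a 2) y) ^ (1 : ℤ) *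
      ((GamX (a 2) (a 3) y * (GamX (a 0) (a 3) y)⁻¹ * GamX (a 0) (a 2) y) ^ (-1 : ℤ) *
      ((GamX (a 1) (a 3) y * (GamX (a 0) (a 3) y)⁻¹ * GamX (a 0) (a 1) y) ^ (1 : ℤ) *
      ((GamX (a 1) (a 2) y * (GamX (a 0) (a 2) y)⁻¹ * GamX (a 0) (a 1) y) ^ (-1 : ℤ) * 1)))) = 1
    have := hΓ 2 3; have := hΓ 1 3; have := hΓ 1 2; have := hΓ 0 3; have := hΓ 0 2
    have := hΓ 0 1
    simp only [zpow_one, zpow_neg]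
    field_simp
  | 1, 2, h =>
    change (holEval y ((cechD cover holSheaf (φ 1 1 rfl) g a *
      groupD cover holSheaf (φ 0 2 rfl) g a) ^ (-1 : ℤ)) : ℂ) = 1
    rw [map_zpow, map_mul, Units.val_zpow_eq_zpow_val, Units.val_mul, holEval_cechD,
      holEval_groupD, h02 _ _ _ (smul_mem_genericPoints _ hy)]
    simp only [h02 _ _ y hy, h11 _ _ ⟨y, _⟩ hy, Fin.prod_univ_succ]
    set s := g 0
    change ((cobMixed fr s (a 1) (a 2) y ^ (1 : ℤ) * (cobMixed fr s (a 0) (a 2) y ^ (-1 : ℤ) *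
      (cobMixed fr s (a 0) (a 1) y ^ (1 : ℤ) * 1))) *
      (cobGam (s⁻¹ • a 0) (s⁻¹ • a 1) (s⁻¹ • a 2) (s⁻¹ • y) *
        (cobGam (a 0) (a 1) (a 2) y ^ (-1 : ℤ) * 1))) ^ (-1 : ℤ) = 1
    have := hΓ 1 2; have := hΓ 0 2; have := hΓ 0 1
    have := hsΓ s⁻¹ 1 2; have := hsΓ s⁻¹ 0 2; have := hsΓ s⁻¹ 0 1
    have := hΔ 0 s; have := hΔ 1 s; have := hΔ 2 s
    simp only [zpow_one, zpow_neg, cobGam, cobMixed]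
    field_simp
  | 2, 1, h =>
    change (holEval y ((cechD cover holSheaf (φ 2 0 rfl) g a *
      groupD cover holSheaf (φ 1 1 rfl) g a) ^ (1 : ℤ)) : ℂ) = 1
    rw [zpow_one, map_mul, Units.val_mul, holEval_cechD,
      holEval_groupD, h11 _ _ _ (smul_mem_genericPoints _ hy)]
    simp only [h11 _ _ y hy, h20 _ _ ⟨y, _⟩ hy, Fin.prod_univ_succ]
    set s := g 0
    set t := g 1
    change (cobDelta fr s t (a 1) y ^ (1 : ℤ) * (cobDelta fr s t (a 0) y ^ (-1 : ℤ) * 1)) *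
      (cobMixed fr t (s⁻¹ • a 0) (s⁻¹ • a 1) (s⁻¹ • y) *
        (cobMixed fr (s * t) (a 0) (a 1) y ^ (-1 : ℤ) *
        (cobMixed fr s (a 0) (a 1) y ^ (1 : ℤ) * 1))) = 1
    have := hΓ 0 1; have := hsΓ s⁻¹ 0 1
    have h3 := hsΓ (s * t)⁻¹ 0 1
    have := hΔ 0 s; have := hΔ 1 s; have := hΔ 0 (s * t); have := hΔ 1 (s * t)
    have := hsΔ s⁻¹ 0 t; have := hsΔ s⁻¹ 1 t
    simp only [mul_inv_rev, mul_smul] at h3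
    simp only [zpow_one, zpow_neg, cobDelta, cobMixed, mul_inv_rev, mul_smul]
    field_simp
  | 3, 0, h =>
    change (holEval y (groupD cover holSheaf (φ 2 0 rfl) g a ^ (-1 : ℤ)) : ℂ) = 1
    rw [map_zpow, Units.val_zpow_eq_zpow_val, holEval_groupD,
      h20 _ _ _ (smul_mem_genericPoints _ hy)]
    simp only [h20 _ _ y hy, Fin.prod_univ_succ]
    set s := g 0
    set t := g 1
    set u := g 2
    change (cobDelta fr t u (s⁻¹ • a 0) (s⁻¹ • y) *
      (cobDelta fr (s * t) u (a 0) y ^ (-1 : ℤ) * (cobDelta fr s (t * u) (a 0) y ^ (1 : ℤ) *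
        (cobDelta fr s t (a 0) y ^ (-1 : ℤ) * 1)))) ^ (-1 : ℤ) = 1
    have h3 := hsΔ (s * t)⁻¹ 0 u
    have := hΔ 0 s; have := hΔ 0 (s * t); have := hΔ 0 (s * (t * u))
    have := hsΔ s⁻¹ 0 t; have := hsΔ s⁻¹ 0 (t * u)
    simp only [mul_inv_rev, mul_smul] at h3
    simp only [zpow_one, zpow_neg, cobDelta, mul_inv_rev, mul_smul, mul_assoc]
    field_simp
  | 0, 0, h => omega
  | 0, 1, h => omega
  | 0, 2, h => omega
  | 0, _ + 4, h => omega
  | 1, 0, h => omega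
  | 1, 1, h => omega
  | 1, _ + 3, h => omega
  | 2, 0, h => omega
  | 2, _ + 2, h => omega
  | 3, _ + 1, h => omega
  | _ + 4, _, h => omega

/-- The image in `ℳˣ` of a family of sections of `𝒪ˣ` that agree generically with the coboundary
of `(Γ, Δ)` is this coboundary. -/
lemma totalD_eq_of_eventually {φ : EquivCochain cover holSheaf 2} {Φ : EquivCochain cover merSheaf 1}
    (hΓ : ∀ g a, IsGermOf (Φ 0 1 rfl g a) (GamX (a 0) (a 1)))
    (hΔ : ∀ g a, IsGermOf (Φ 1 0 rfl g a) (DeltaX fr (a 0) (g 0)))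
    {E02 : (Fin 0 → ISL3) → (Fin 3 → Prim) → X → ℂ} {E11 : (Fin 1 → ISL3) → (Fin 2 → Prim) → X → ℂ}
    {E20 : (Fin 2 → ISL3) → (Fin 1 → Prim) → X → ℂ}
    (g02 : ∀ g a, IsGermOf (holToMer _ (φ 0 2 rfl g a)) (E02 g a))
    (g11 : ∀ g a, IsGermOf (holToMer _ (φ 1 1 rfl g a)) (E11 g a))
    (g20 : ∀ g a, IsGermOf (holToMer _ (φ 2 0 rfl g a)) (E20 g a))
    (h02 : ∀ g a, ∀ᶠ y : cover.inter a in denseOpens _, E02 g a y = cobGam (a 0) (a 1) (a 2) y)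
    (h11 : ∀ g a, ∀ᶠ y : cover.inter a in denseOpens _, E11 g a y = cobMixed fr (g 0) (a 0) (a 1) y)
    (h20 : ∀ g a, ∀ᶠ y : cover.inter a in denseOpens _, E20 g a y = cobDelta fr (g 0) (g 1) (a 0) y) :
    totalD Φ = cochainHolToMer φ := by
  funext p q h g a
  match p, q, h with
  | 0, 2, h =>
    refine (isGermOf_cechD hΓ g a).eq (g02 g a) ?_
    filter_upwards [h02 g a] with y hy
    rw [hy]
    simp only [Fin.prod_univ_succ]
    change GamX (a 1) (a 2) y ^ (1 : ℤ) * (GamX (a 0) (a 2) y ^ (-1 : ℤ) *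
      (GamX (a 0) (a 1) y ^ (1 : ℤ) * 1)) = _
    simp only [zpow_one, zpow_neg, cobGam, mul_one, mul_assoc]
  | 1, 1, h =>
    refine (((isGermOf_cechD hΔ g a).mul (isGermOf_groupD hΓ g a)).zpow (-1)).eq (g11 g a) ?_
    filter_upwards [h11 g a] with y hy
    rw [hy]
    simp only [Fin.prod_univ_succ]
    change ((DeltaX fr (a 1) (g 0) y ^ (1 : ℤ) * (DeltaX fr (a 0) (g 0) y ^ (-1 : ℤ) * 1)) *
      (GamX ((g 0)⁻¹ • a 0) ((g 0)⁻¹ • a 1) ((g 0)⁻¹ • y) *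
        (GamX (a 0) (a 1) y ^ (-1 : ℤ) * 1))) ^ (-1 : ℤ) = _
    simp only [zpow_one, zpow_neg, cobMixed, mul_one]
  | 2, 0, h =>
    refine ((isGermOf_groupD hΔ g a).zpow 1).eq (g20 g a) ?_
    filter_upwards [h20 g a] with y hy
    rw [hy]
    simp only [Fin.prod_univ_succ]
    change (DeltaX fr ((g 0)⁻¹ • a 0) (g 1) ((g 0)⁻¹ • y) *
      (DeltaX fr (a 0) (g 0 * g 1) y ^ (-1 : ℤ) *
        (DeltaX fr (a 0) (g 0) y ^ (1 : ℤ) * 1))) ^ (1 : ℤ) = _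
    simp only [zpow_one, zpow_neg, cobDelta, mul_one]
  | 0, 0, h => omega
  | 0, 1, h => omega
  | 0, _ + 3, h => omega
  | 1, 0, h => omega
  | 1, _ + 2, h => omega
  | 2, _ + 1, h => omega
  | _ + 3, _, h => omega

/-! ### The pointwise laws on `X` -/

section
variable {fr} {P : QxW} {p : Tot}

/-- The relation for three vectors, in terms of the coboundary of `(Γ, Δ)`. -/
lemma exp_eq_cobGam {a b c : Prim} (hP : Gam a b p.1.1 p.1.2 ≠ 0 → Gam b c p.1.1 p.1.2 ≠ 0 →
      Gam c a p.1.1 p.1.2 ≠ 0 →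
      Gam a b p.1.1 p.1.2 * Gam b c p.1.1 p.1.2 * Gam c a p.1.1 p.1.2 =
        Complex.exp (-(Real.pi * Complex.I / 3) * P.eval p.1.1 p.1.2))
    (h1 : GamX b c (mk p) ≠ 0) (h2 : GamX a c (mk p) ≠ 0) (h3 : GamX a b (mk p) ≠ 0) :
    Complex.exp (-(2 * Real.pi * Complex.I / (Nat.factorial 3)) * P.eval p.1.1 p.1.2) =
      cobGam a b c (mk p) := by
  have e : Gam c a p.1.1 p.1.2 = (GamX a c (mk p))⁻¹ := Gam_inv c a _ _
  have := hP h3 h1 (by rw [e]; exact inv_ne_zero h2)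
  rw [e] at this
  have e2 : -(2 * Real.pi * Complex.I / ((Nat.factorial 3 : ℕ) : ℂ)) =
      -(Real.pi * Complex.I / 3) := by
    rw [show Nat.factorial 3 = 6 from rfl]; push_cast; ring
  rw [e2, ← this, cobGam]
  change GamX a b (mk p) * GamX b c (mk p) * _ = _
  ring

/-- The transformation law of `Γ_{a,b}`, in terms of the coboundary of `(Γ, Δ)`. -/
lemma exp_eq_cobMixed {a b : Prim} {s : ISL3} (hP : Gam a b p.1.1 p.1.2 ≠ 0 →
      Gam (s⁻¹ • a) (s⁻¹ • b) (p.1.1 + pair s.μ (matAct s.g⁻¹ p.1.2)) (matAct s.g⁻¹ p.1.2) ≠ 0 →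
      Delta fr a s p.1.1 p.1.2 ≠ 0 → Delta fr b s p.1.1 p.1.2 ≠ 0 →
      Gam (s⁻¹ • a) (s⁻¹ • b) (p.1.1 + pair s.μ (matAct s.g⁻¹ p.1.2)) (matAct s.g⁻¹ p.1.2) /
        Gam a b p.1.1 p.1.2 = Complex.exp (Real.pi * Complex.I * P.eval p.1.1 p.1.2) *
          (Delta fr a s p.1.1 p.1.2 / Delta fr b s p.1.1 p.1.2))
    (h1 : GamX a b (mk p) ≠ 0) (h2 : GamX (s⁻¹ • a) (s⁻¹ • b) (s⁻¹ • mk p) ≠ 0)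
    (h3 : DeltaX fr a s (mk p) ≠ 0) (h4 : DeltaX fr b s (mk p) ≠ 0) :
    Complex.exp (-(2 * Real.pi * Complex.I / (Nat.factorial 2)) * P.eval p.1.1 p.1.2) =
      cobMixed fr s a b (mk p) := by
  have := hP h1 (by rwa [← GamX_inv_smul_mk]) h3 h4
  rw [← GamX_inv_smul_mk] at this
  have e2 : -(2 * Real.pi * Complex.I / ((Nat.factorial 2 : ℕ) : ℂ)) * P.eval p.1.1 p.1.2 =
      -(Real.pi * Complex.I * P.eval p.1.1 p.1.2) := by
    rw [show Nat.factorial 2 = 2 from rfl]; push_cast; ring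
  rw [e2, Complex.exp_neg, cobMixed, ← div_eq_mul_inv (GamX _ _ _)]
  change _ / GamX a b (mk p) = _ * (DeltaX fr a s (mk p) / DeltaX fr b s (mk p)) at this
  rw [this]
  field_simp

/-- The transformation law of `Δ_a`, in terms of the coboundary of `(Γ, Δ)`. -/
lemma exp_eq_cobDelta {a : Prim} {s t : ISL3} (hP : Delta fr a (s * t) p.1.1 p.1.2 ≠ 0 →
      Delta fr a s p.1.1 p.1.2 ≠ 0 →
      Delta fr (s⁻¹ • a) t (p.1.1 + pair s.μ (matAct s.g⁻¹ p.1.2)) (matAct s.g⁻¹ p.1.2) ≠ 0 →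
      Delta fr a (s * t) p.1.1 p.1.2 =
        Complex.exp (2 * Real.pi * Complex.I * P.eval p.1.1 p.1.2) * Delta fr a s p.1.1 p.1.2 *
          Delta fr (s⁻¹ • a) t (p.1.1 + pair s.μ (matAct s.g⁻¹ p.1.2)) (matAct s.g⁻¹ p.1.2))
    (h1 : DeltaX fr a (s * t) (mk p) ≠ 0) (h2 : DeltaX fr a s (mk p) ≠ 0)
    (h3 : DeltaX fr (s⁻¹ • a) t (s⁻¹ • mk p) ≠ 0) :
    Complex.exp (-(2 * Real.pi * Complex.I) * P.eval p.1.1 p.1.2) =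
      cobDelta fr s t a (mk p) := by
  have := hP h1 h2 (by rwa [← DeltaX_inv_smul_mk])
  rw [← DeltaX_inv_smul_mk] at this
  change DeltaX fr a (s * t) (mk p) = _ * DeltaX fr a s (mk p) * _ at this
  rw [neg_mul, Complex.exp_neg, cobDelta, this]
  field_simp

end

end GammaGerbe

theorem theorem1 (fr : Framing) :
    -- convergence of the products that define `Γ_{a,b}` and `Δ_a`
    (∀ a b : Prim, a.1 ⨯₃ b.1 ≠ 0 → ∀ (w : ℂ) (x : Fin 3 → ℂ), x ∈ Uplus a.1 → x ∈ Uplus b.1 →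
      pair (gam a.1 b.1) x ≠ 0 ∧
      Multipliable (fun q : CpmQuot (gam a.1 b.1) a.1 b.1 =>
        gammaFactor (gam a.1 b.1) (-1) w x q) ∧
      Multipliable (fun q : CpmQuot (gam a.1 b.1) b.1 a.1 =>
        gammaFactor (gam a.1 b.1) 1 w x q)) ∧
    (∀ (a : Prim) (x : Fin 3 → ℂ), x ∈ Uplus a.1 →
      fr.coord a 2 x ≠ 0 ∧ ∀ z : ℂ, Multipliable (thetaFactor z (fr.coord a 1 x / fr.coord a 2 x))) ∧
    -- the cocycle relation for two vectors
    (∀ (a b : Prim) (w : ℂ) (x : Fin 3 → ℂ), x ∈ Uplus a.1 → x ∈ Uplus b.1 →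
      Gam a b w x ≠ 0 → Gam a b w x * Gam b a w x = 1) ∧
    ∃ (Pabc : Prim → Prim → Prim → QxW) (Pab : Prim → Prim → ISL3 → QxW)
      (Pa : Prim → ISL3 → ISL3 → QxW),
      -- the cocycle relation for three vectors
      (∀ (a b c : Prim) (w : ℂ) (x : Fin 3 → ℂ),
        x ∈ Uplus a.1 → x ∈ Uplus b.1 → x ∈ Uplus c.1 →
        (Pabc a b c).RegularAt x ∧ (Pabc a b c).eval w x = PBernoulli a b c w x ∧
        (Gam a b w x ≠ 0 → Gam b c w x ≠ 0 → Gam c a w x ≠ 0 →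
          Gam a b w x * Gam b c w x * Gam c a w x =
            Complex.exp (-(Real.pi * Complex.I / 3) * (Pabc a b c).eval w x))) ∧
      -- the transformation law of `Γ_{a,b}`
      (∀ (a b : Prim) (s : ISL3) (w : ℂ) (x : Fin 3 → ℂ), x ∈ Uplus a.1 → x ∈ Uplus b.1 →
        (Pab a b s).RegularAt x ∧
        (Gam a b w x ≠ 0 →
          Gam (s⁻¹ • a) (s⁻¹ • b) (w + pair s.μ (matAct s.g⁻¹ x)) (matAct s.g⁻¹ x) ≠ 0 →
          Delta fr a s w x ≠ 0 → Delta fr b s w x ≠ 0 →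
          Gam (s⁻¹ • a) (s⁻¹ • b) (w + pair s.μ (matAct s.g⁻¹ x)) (matAct s.g⁻¹ x) / Gam a b w x =
            Complex.exp (Real.pi * Complex.I * (Pab a b s).eval w x) *
              (Delta fr a s w x / Delta fr b s w x))) ∧
      -- the transformation law of `Δ_a`
      (∀ (a : Prim) (s t : ISL3) (w : ℂ) (x : Fin 3 → ℂ), x ∈ Uplus a.1 →
        (Pa a s t).RegularAt x ∧
        (Delta fr a (s * t) w x ≠ 0 → Delta fr a s w x ≠ 0 →
          Delta fr (s⁻¹ • a) t (w + pair s.μ (matAct s.g⁻¹ x)) (matAct s.g⁻¹ x) ≠ 0 →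
          Delta fr a (s * t) w x =
            Complex.exp (2 * Real.pi * Complex.I * (Pa a s t).eval w x) * Delta fr a s w x *
              Delta fr (s⁻¹ • a) t (w + pair s.μ (matAct s.g⁻¹ x)) (matAct s.g⁻¹ x))) ∧
      -- the equivariant Čech cocycle with values in `𝒪ˣ`
      ∃ φ : EquivCochain cover holSheaf 2,
        (∀ (g : Fin 0 → ISL3) (a : Fin 3 → Prim) (p : Tot) (h : mk p ∈ cover.inter a),
          (holFun (φ 0 2 rfl g a) ⟨mk p, h⟩ : ℂ) =
            Complex.exp (-(2 * Real.pi * Complex.I / (Nat.factorial 3)) *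
              (Pabc (a 0) (a 1) (a 2)).eval p.1.1 p.1.2)) ∧
        (∀ (g : Fin 1 → ISL3) (a : Fin 2 → Prim) (p : Tot) (h : mk p ∈ cover.inter a),
          (holFun (φ 1 1 rfl g a) ⟨mk p, h⟩ : ℂ) =
            Complex.exp (-(2 * Real.pi * Complex.I / (Nat.factorial 2)) *
              (Pab (a 0) (a 1) (g 0)).eval p.1.1 p.1.2)) ∧
        (∀ (g : Fin 2 → ISL3) (a : Fin 1 → Prim) (p : Tot) (h : mk p ∈ cover.inter a),
          (holFun (φ 2 0 rfl g a) ⟨mk p, h⟩ : ℂ) =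
            Complex.exp (-(2 * Real.pi * Complex.I) *
              (Pa (a 0) (g 0) (g 1)).eval p.1.1 p.1.2)) ∧
        IsCocycle φ ∧
        -- its image in the complex for `ℳˣ` is the coboundary of `(Γ_{a,b}, Δ_a)`
        ∃ Φ : EquivCochain cover merSheaf 1,
          (∀ (g : Fin 0 → ISL3) (a : Fin 2 → Prim), IsGermOf (Φ 0 1 rfl g a) (GamX (a 0) (a 1))) ∧
          (∀ (g : Fin 1 → ISL3) (a : Fin 1 → Prim),
            IsGermOf (Φ 1 0 rfl g a) (DeltaX fr (a 0) (g 0))) ∧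
          totalD Φ = cochainHolToMer φ := by
  choose Pabc hPabc using isQxW_PBernoulli
  choose Pab hPab using exists_Gam_transform fr
  choose Pa hPa using exists_Delta_transform fr
  have law3 : ∀ (a b c : Prim) (w : ℂ) (x : Fin 3 → ℂ),
      x ∈ Uplus a.1 → x ∈ Uplus b.1 → x ∈ Uplus c.1 →
      Gam a b w x ≠ 0 → Gam b c w x ≠ 0 → Gam c a w x ≠ 0 →
      Gam a b w x * Gam b c w x * Gam c a w x =
        Complex.exp (-(Real.pi * Complex.I / 3) * (Pabc a b c).eval w x) := by
    intro a b c w x hxa hxb hxc h1 h2 h3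
    rw [(hPabc a b c x ⟨⟨hxa, hxb⟩, hxc⟩).2 w]
    exact Gam_triple hxa hxb hxc h1 h2 h3
  have hU : ∀ {q : ℕ} (a : Fin (q + 1) → Prim) (i : Fin (q + 1)), ∀ p : Tot,
      mk p ∈ cover.inter a → p.1.2 ∈ Uplus (a i).1 := fun a i p hp =>
    (mk_mem_VSet (a i) p).1 (mem_inter_cover hp i)
  -- the exponentials of the polynomials agree at generic points with the coboundary of `(Γ, Δ)`
  have e02 : ∀ (a : Fin 3 → Prim) (p : Tot), mk p ∈ cover.inter a →
      GamX (a 1) (a 2) (mk p) ≠ 0 → GamX (a 0) (a 2) (mk p) ≠ 0 → GamX (a 0) (a 1) (mk p) ≠ 0 →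
      Complex.exp (-(2 * Real.pi * Complex.I / (Nat.factorial 3)) *
        (Pabc (a 0) (a 1) (a 2)).eval p.1.1 p.1.2) = cobGam (a 0) (a 1) (a 2) (mk p) :=
    fun a p hp => exp_eq_cobGam
      (law3 _ _ _ _ _ (hU a 0 p hp) (hU a 1 p hp) (hU a 2 p hp))
  have e11 : ∀ (s : ISL3) (a : Fin 2 → Prim) (p : Tot), mk p ∈ cover.inter a →
      GamX (a 0) (a 1) (mk p) ≠ 0 → GamX (s⁻¹ • a 0) (s⁻¹ • a 1) (s⁻¹ • mk p) ≠ 0 →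
      DeltaX fr (a 0) s (mk p) ≠ 0 → DeltaX fr (a 1) s (mk p) ≠ 0 →
      Complex.exp (-(2 * Real.pi * Complex.I / (Nat.factorial 2)) *
        (Pab (a 0) (a 1) s).eval p.1.1 p.1.2) = cobMixed fr s (a 0) (a 1) (mk p) :=
    fun s a p hp => exp_eq_cobMixed ((hPab _ _ s _ (hU a 0 p hp) (hU a 1 p hp)).2 _)
  have e20 : ∀ (s t : ISL3) (a : Fin 1 → Prim) (p : Tot), mk p ∈ cover.inter a →
      DeltaX fr (a 0) (s * t) (mk p) ≠ 0 → DeltaX fr (a 0) s (mk p) ≠ 0 →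
      DeltaX fr (s⁻¹ • a 0) t (s⁻¹ • mk p) ≠ 0 →
      Complex.exp (-(2 * Real.pi * Complex.I) * (Pa (a 0) s t).eval p.1.1 p.1.2) =
        cobDelta fr s t (a 0) (mk p) :=
    fun s t a p hp => exp_eq_cobDelta ((hPa _ s t _ (hU a 0 p hp)).2 _)
  have g02 : ∀ (a : Fin 3 → Prim) (p : Tot), mk p ∈ cover.inter a → mk p ∈ GammaGerbe.genericPoints → _ =
      cobGam (a 0) (a 1) (a 2) (mk p) := fun a p hp hg =>
    have hV := mem_inter_cover hp
    e02 a p hp (GamX_ne_zero (hV 1) (hV 2) hg) (GamX_ne_zero (hV 0) (hV 2) hg)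
      (GamX_ne_zero (hV 0) (hV 1) hg)
  have g11 : ∀ (s : ISL3) (a : Fin 2 → Prim) (p : Tot), mk p ∈ cover.inter a →
      mk p ∈ GammaGerbe.genericPoints → _ = cobMixed fr s (a 0) (a 1) (mk p) := fun s a p hp hg =>
    have hV := mem_inter_cover hp
    e11 s a p hp (GamX_ne_zero (hV 0) (hV 1) hg)
      (GamX_ne_zero (smul_mem_VSet _ (hV 0)) (smul_mem_VSet _ (hV 1)) (smul_mem_genericPoints _ hg))
      (DeltaX_ne_zero fr s (hV 0) hg) (DeltaX_ne_zero fr s (hV 1) hg)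
  have g20 : ∀ (s t : ISL3) (a : Fin 1 → Prim) (p : Tot), mk p ∈ cover.inter a →
      mk p ∈ GammaGerbe.genericPoints → _ = cobDelta fr s t (a 0) (mk p) := fun s t a p hp hg =>
    have hV := mem_inter_cover hp
    e20 s t a p hp (DeltaX_ne_zero fr _ (hV 0) hg) (DeltaX_ne_zero fr s (hV 0) hg)
      (DeltaX_ne_zero fr t (smul_mem_VSet _ (hV 0)) (smul_mem_genericPoints _ hg))
  let c02 : BiCochain cover holSheaf 0 2 := fun g a => holSection _
    (holOn_expEval (g02 a) fun p hp => (hPabc _ _ _ _ ⟨⟨hU a 0 p hp, hU a 1 p hp⟩, hU a 2 p hp⟩).1)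
    (expEval_ne_zero _ _)
  let c11 : BiCochain cover holSheaf 1 1 := fun g a => holSection _
    (holOn_expEval (g11 (g 0) a) fun p hp => (hPab _ _ _ _ (hU a 0 p hp) (hU a 1 p hp)).1)
    (expEval_ne_zero _ _)
  let c20 : BiCochain cover holSheaf 2 0 := fun g a => holSection _
    (holOn_expEval (g20 (g 0) (g 1) a) fun p hp => (hPa _ _ _ _ (hU a 0 p hp)).1)
    (expEval_ne_zero _ _)
  have m2 : ∀ (a : Fin 2 → Prim), ∀ y ∈ cover.inter a, y ∈ VSet (a 0) ∧ y ∈ VSet (a 1) :=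
    fun a y hy => ⟨mem_inter_cover hy 0, mem_inter_cover hy 1⟩
  have m1 : ∀ (a : Fin 1 → Prim), ∀ y ∈ cover.inter a, y ∈ VSet (a 0) :=
    fun a y hy => mem_inter_cover hy 0
  choose d01 hd01 using fun a => exists_isGermOf_GamX (m2 a)
  choose d10 hd10 using fun (s : ISL3) a => exists_isGermOf_DeltaX fr s (m1 a)
  refine ⟨fun a b h w x hxa hxb => ⟨pair_gam_ne_zero h hxa,
    multipliable_gammaFactor h hxa hxb 0 0 w, multipliable_gammaFactor_swap h hxa hxb 0 0 w⟩,
    fun a x hx => ⟨right_ne_zero_of_im_div_pos (fr.im_pos hx), fun z =>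
      multipliable_thetaFactor (fr.im_pos hx) z⟩,
    fun a b w x _ _ h => ?_, Pabc, Pab, Pa,
    fun a b c w x hxa hxb hxc => ⟨(hPabc a b c x ⟨⟨hxa, hxb⟩, hxc⟩).1,
      (hPabc a b c x ⟨⟨hxa, hxb⟩, hxc⟩).2 w, law3 a b c w x hxa hxb hxc⟩,
    fun a b s w x hxa hxb => ⟨(hPab a b s x hxa hxb).1, (hPab a b s x hxa hxb).2 w⟩,
    fun a s t w x hx => ⟨(hPa a s t x hx).1, (hPa a s t x hx).2 w⟩,
    cochain₂ c02 c11 c20,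
    fun g a p hp => expEval_mk (g02 a) p hp, fun g a p hp => expEval_mk (g11 (g 0) a) p hp,
    fun g a p hp => expEval_mk (g20 (g 0) (g 1) a) p hp,
    isCocycle_of_generic fr (fun g a y hy => expEval_eq_of_generic (g02 a) y.2 hy)
      (fun g a y hy => expEval_eq_of_generic (g11 (g 0) a) y.2 hy)
      (fun g a y hy => expEval_eq_of_generic (g20 (g 0) (g 1) a) y.2 hy),
    cochain₁ (fun _ => d01) (fun g => d10 (g 0)), fun _ => hd01, fun g => hd10 (g 0),
    totalD_eq_of_eventually fr (fun _ => hd01) (fun g => hd10 (g 0))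
      (E02 := fun _ a => expEval _ (Pabc (a 0) (a 1) (a 2)))
      (E11 := fun g a => expEval _ (Pab (a 0) (a 1) (g 0)))
      (E20 := fun g a => expEval _ (Pa (a 0) (g 0) (g 1)))
      (fun _ _ => rfl) (fun _ _ => rfl) (fun _ _ => rfl)
      (fun g a => ?_) (fun g a => ?_) (fun g a => ?_)⟩
  · rw [Gam_inv b a, mul_inv_cancel₀ h]
  · filter_upwards [eventually_GamX_ne_zero (a := a 1) (b := a 2) (U := cover.inter a)
        fun y hy => ⟨mem_inter_cover hy 1, mem_inter_cover hy 2⟩,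
      eventually_GamX_ne_zero (a := a 0) (b := a 2) (U := cover.inter a)
        fun y hy => ⟨mem_inter_cover hy 0, mem_inter_cover hy 2⟩,
      eventually_GamX_ne_zero (a := a 0) (b := a 1) (U := cover.inter a)
        fun y hy => ⟨mem_inter_cover hy 0, mem_inter_cover hy 1⟩]
    rintro ⟨y, hy⟩ h1 h2 h3
    obtain ⟨p, rfl⟩ : ∃ p : Tot, mk p = y := Quotient.exists_rep y
    exact (expEval_mk (g02 a) p hy).trans (e02 a p hy h1 h2 h3)
  · filter_upwards [eventually_GamX_ne_zero (m2 a),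
      (tendsto_shift (g 0) (cover.inter_smul (g 0) a)).eventually
        (eventually_GamX_ne_zero (m2 ((g 0)⁻¹ • a))),
      eventually_DeltaX_ne_zero fr (g 0) (U := cover.inter a) fun y hy => (m2 a y hy).1,
      eventually_DeltaX_ne_zero fr (g 0) (U := cover.inter a) fun y hy => (m2 a y hy).2]
    rintro ⟨y, hy⟩ h1 h2 h3 h4
    obtain ⟨p, rfl⟩ : ∃ p : Tot, mk p = y := Quotient.exists_rep y
    exact (expEval_mk (g11 (g 0) a) p hy).trans (e11 (g 0) a p hy h1 h2 h3 h4)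
  · filter_upwards [eventually_DeltaX_ne_zero fr (g 0 * g 1) (m1 a),
      eventually_DeltaX_ne_zero fr (g 0) (m1 a),
      (tendsto_shift (g 0) (cover.inter_smul (g 0) a)).eventually
        (eventually_DeltaX_ne_zero fr (g 1) (m1 ((g 0)⁻¹ • a)))]
    rintro ⟨y, hy⟩ h1 h2 h3
    obtain ⟨p, rfl⟩ : ∃ p : Tot, mk p = y := Quotient.exists_rep y
    exact (expEval_mk (g20 (g 0) (g 1) a) p hy).trans (e20 (g 0) (g 1) a p hy h1 h2 h3)
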